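/- **Theorem.** Let $\Omega\subset\mathbb R^2$ be a closed planar domain with compact smooth boundary: $K=\partial\Omega$ is a finite disjoint union of smooth simple closed curves, and $\Omega$ lies locally on exactly one side of $K$ (neither $\Omega$ nor $K$ need be connected, and $\Omega$ may be unbounded). Orient $K$ so that $\Omega$ lies on its left, let $L(K)$ be its length and $\kappa$ its signed curvature with respect to this orientation, and let $ds$, $dp$, $dq$ denote arc length on $K$. For $w$ in the interior of $\Omega$ put $$V(w,\Omega)=\lim_{\varepsilon\to0^+}\left(\int_{\Omega\setminus B_\varepsilon(w)}\frac{d^2z}{|z-w|^4}-\frac{\pi}{\varepsilon^2}\right),\qquad E(\Omega)=\lim_{\delta\to0^+}\left(\int_{\Omega_\delta}V(w,\Omega)\,d^2w+\frac{\pi}{4\delta}L(K)\right),$$ where $\Omega_\delta=\{w\in\Omega: d(w,K)\ge\delta\}$. For $p\ne q$ in $K$ let $\theta_p$ (resp. $\theta_q$) be the oriented angle from the positive unit tangent of $K$ at $p$ (resp. at $q$) to the vector $q-p$, and let $\Delta_\varepsilon=\{(p,q): |q-p|\le\varepsilon\}$. Then the limits defining $V(w,\Omega)$ and $E(\Omega)$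 exist and are finite, $V(\cdot,\Omega)$ is integrable on $\Omega_\delta$ for every $\delta>0$, and $$E(\Omega)=\lim_{\varepsilon\to0^+}\left(\frac{L(K)}{\varepsilon}-\frac12\int_{K\times K\setminus\Delta_\varepsilon}\cos\theta_p\cos\theta_q\,\frac{dp\,dq}{|q-p|^2}\right)+\frac{\pi}{8}\int_K\kappa(s)\,ds,$$ where the limit exists and is finite, and $$E(\Omega)=-\frac12\int_{K\times K}\sin\theta_p\sin\theta_q\,\frac{dp\,dq}{|q-p|^2}+\frac{\pi}{8}\int_K\kappa(s)\,ds,$$ where the double integral converges absolutely. If moreover $\Omega$ is compact, then the real de Rham cohomology of $\Omega$ is finite dimensional and $$\frac{\pi}{8}\int_K\kappa(s)\,ds=\frac{\pi^2}{4}\chi(\Omega),$$ where $\chi(\Omega)$ is the Euler characteristic of $\Omega$. -/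

import Mathlib

open Set Filter Topology MeasureTheory
open scoped ContDiff

/-! The plane `ℝ²` is `ℂ`, with its Euclidean norm and its area measure. -/

/-- The boundary `K` of a closed planar domain `Ω` with compact smooth boundary, parametrized by
arc length with the orientation induced by `Ω`: `K` is the disjoint union of finitely many smooth
simple closed curves `γ i`, of lengths `len i`, with `Ω` on their left and the complement of `Ω`
on their right. Neither `Ω` nor `K` has to be connected, and `Ω` may be unbounded. -/
structure SmoothBoundary (Ω : Set ℂ) where
  /-- the number of boundary curves -/
  k : ℕ
  /-- the lengths of the boundary curves -/
  len : Fin k → ℝ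
  /-- the arc-length parametrizations of the boundary curves -/
  γ : Fin k → ℝ → ℂ
  len_pos : ∀ i, 0 < len i
  smooth : ∀ i, ContDiff ℝ ∞ (γ i)
  periodic : ∀ i, Function.Periodic (γ i) (len i)
  unit_speed : ∀ i s, ‖deriv (γ i) s‖ = 1
  simple : ∀ i j, ∀ s ∈ Ico 0 (len i), ∀ t ∈ Ico 0 (len j), γ i s = γ j t → i = j ∧ s = t
  frontier_eq : frontier Ω = ⋃ i, range (γ i)
  left_mem : ∀ i s, ∀ᶠ t : ℝ in 𝓝[>] 0,
    γ i s + t * (Complex.I * deriv (γ i) s) ∈ interior Ω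
  right_notMem : ∀ i s, ∀ᶠ t : ℝ in 𝓝[>] 0,
    γ i s - t * (Complex.I * deriv (γ i) s) ∉ Ω

/-- The oriented angle from the nonzero vector `T` to the nonzero vector `v`. -/
noncomputable def orientedAngle (T v : ℂ) : ℝ := Complex.arg (v / T)

/-! ### The renormalized potential -/

/-- `∫_{Ω ∖ B_ε(w)} d²z / |z - w|⁴ - π / ε²`. -/
noncomputable def truncatedPotential (Ω : Set ℂ) (w : ℂ) (ε : ℝ) : ℝ :=
  (∫ z in Ω \ Metric.ball w ε, 1 / ‖z - w‖ ^ 4) - Real.pi / ε ^ 2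

/-- The renormalized potential `V(w, Ω)`, the limit of `truncatedPotential Ω w` as `ε → 0⁺`. -/
noncomputable def renormalizedPotential (Ω : Set ℂ) (w : ℂ) : ℝ :=
  limUnder (𝓝[>] (0 : ℝ)) (truncatedPotential Ω w)

/-- `Ω_δ`, the points of `Ω` at distance at least `δ` from the boundary of `Ω`. -/
def innerDomain (Ω : Set ℂ) (δ : ℝ) : Set ℂ :=
  {w | w ∈ Ω ∧ ∀ p ∈ frontier Ω, δ ≤ dist w p}

namespace SmoothBoundary

variable {Ω : Set ℂ} (K : SmoothBoundary Ω)

/-- The length `L(K)`. -/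
noncomputable def length : ℝ := ∑ i, K.len i

/-- The signed curvature of the `i`-th boundary curve, with respect to the orientation induced
by `Ω`: the determinant of the first and second derivatives of the arc-length parametrization. -/
noncomputable def curvature (i : Fin K.k) (s : ℝ) : ℝ :=
  ((starRingEnd ℂ) (deriv (K.γ i) s) * deriv (deriv (K.γ i)) s).im

/-- `∫_K κ(s) ds`. -/
noncomputable def totalCurvature : ℝ := ∑ i, ∫ s in (0 : ℝ)..K.len i, K.curvature i s

/-- `∫_{Ω_δ} V(w, Ω) d²w + (π / (4 δ)) L(K)`. -/
noncomputable def truncatedEnergy (δ : ℝ) : ℝ :=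
  (∫ w in innerDomain Ω δ, renormalizedPotential Ω w) + Real.pi / (4 * δ) * K.length

/-- The renormalized Möbius energy `E(Ω)`, the limit of `truncatedEnergy` as `δ → 0⁺`. -/
noncomputable def energy : ℝ := limUnder (𝓝[>] (0 : ℝ)) K.truncatedEnergy

/-- The chord `q - p` from `p = γ i s` to `q = γ j t`, where `x = (s, t)`. -/
noncomputable def chord (i j : Fin K.k) (x : ℝ × ℝ) : ℂ := K.γ j x.2 - K.γ i x.1

/-- `θ_p`, the oriented angle from the positive tangent of `K` at `p` to `q - p`. -/
noncomputable def angleP (i j : Fin K.k) (x : ℝ × ℝ) : ℝ :=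
  orientedAngle (deriv (K.γ i) x.1) (K.chord i j x)

/-- `θ_q`, the oriented angle from the positive tangent of `K` at `q` to `q - p`. -/
noncomputable def angleQ (i j : Fin K.k) (x : ℝ × ℝ) : ℝ :=
  orientedAngle (deriv (K.γ j) x.2) (K.chord i j x)

/-- The pairs of arc-length parameters that describe (up to measure zero) the pairs `(p, q)` with
`p` on the `i`-th and `q` on the `j`-th boundary curve. -/
def pairs (i j : Fin K.k) : Set (ℝ × ℝ) := Ioc 0 (K.len i) ×ˢ Ioc 0 (K.len j)

/-- `cos θ_p cos θ_q / |q - p|²`. -/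
noncomputable def cosDensity (i j : Fin K.k) (x : ℝ × ℝ) : ℝ :=
  Real.cos (K.angleP i j x) * Real.cos (K.angleQ i j x) / ‖K.chord i j x‖ ^ 2

/-- `sin θ_p sin θ_q / |q - p|²`. -/
noncomputable def sinDensity (i j : Fin K.k) (x : ℝ × ℝ) : ℝ :=
  Real.sin (K.angleP i j x) * Real.sin (K.angleQ i j x) / ‖K.chord i j x‖ ^ 2

/-- `∫_{K × K ∖ Δ_ε} cos θ_p cos θ_q dp dq / |q - p|²` with `Δ_ε = {(p, q) : |q - p| ≤ ε}`. -/
noncomputable def cosIntegral (ε : ℝ) : ℝ :=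
  ∑ i, ∑ j, ∫ x in K.pairs i j ∩ {x | ε < ‖K.chord i j x‖}, K.cosDensity i j x

/-- `∫_{K × K} sin θ_p sin θ_q dp dq / |q - p|²`. -/
noncomputable def sinIntegral : ℝ := ∑ i, ∑ j, ∫ x in K.pairs i j, K.sinDensity i j x

end SmoothBoundary

/-! ### The Euler characteristic

`Ω` is treated as a surface with boundary. A smooth `n`-form on the closed set `Ω` is the
restriction to `Ω` of a smooth `n`-form on the plane. -/

/-- Differential `n`-forms on the plane, not necessarily smooth. -/
def PlaneForm (n : ℕ) : Type := ℂ → ℂ [⋀^Fin n]→L[ℝ] ℝ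

noncomputable instance (n : ℕ) : AddCommGroup (PlaneForm n) :=
  inferInstanceAs (AddCommGroup (ℂ → ℂ [⋀^Fin n]→L[ℝ] ℝ))

noncomputable instance (n : ℕ) : Module ℝ (PlaneForm n) :=
  inferInstanceAs (Module ℝ (ℂ → ℂ [⋀^Fin n]→L[ℝ] ℝ))

/-- Smoothness of a form on the plane. -/
def PlaneForm.Smooth {n : ℕ} (α : PlaneForm n) : Prop :=
  ContDiff ℝ ∞ (fun x => (α x : ℂ [⋀^Fin n]→L[ℝ] ℝ))

/-- The exterior derivative of a form on the plane. -/
noncomputable def PlaneForm.d {n : ℕ} (α : PlaneForm n) : PlaneForm (n + 1) := extDeriv α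

theorem PlaneForm.smooth_zero (n : ℕ) : (0 : PlaneForm n).Smooth :=
  (contDiff_const : ContDiff ℝ ∞ fun _ : ℂ => (0 : ℂ [⋀^Fin n]→L[ℝ] ℝ))

theorem PlaneForm.Smooth.add {n : ℕ} {α β : PlaneForm n} (hα : α.Smooth) (hβ : β.Smooth) :
    (α + β).Smooth := ContDiff.add hα hβ

theorem PlaneForm.Smooth.smul {n : ℕ} (c : ℝ) {α : PlaneForm n} (hα : α.Smooth) :
    (c • α).Smooth := ContDiff.const_smul c hα

theorem PlaneForm.d_add {n : ℕ} {α β : PlaneForm n} (hα : α.Smooth) (hβ : β.Smooth) (x : ℂ) :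
    (α + β).d x = α.d x + β.d x :=
  extDeriv_add (ContDiff.differentiable hα (by simp) x) (ContDiff.differentiable hβ (by simp) x)

theorem PlaneForm.d_smul {n : ℕ} (c : ℝ) (α : PlaneForm n) (x : ℂ) :
    (c • α).d x = c • α.d x := extDeriv_smul c α

theorem PlaneForm.d_zero (n : ℕ) (x : ℂ) : (0 : PlaneForm n).d x = 0 := by
  have h := PlaneForm.d_smul (0 : ℝ) (0 : PlaneForm n) x
  rwa [zero_smul, zero_smul] at h

/-- Smooth `n`-forms on the plane whose restriction to `Ω` is closed. -/
def closedForms (Ω : Set ℂ) (n : ℕ) : Submodule ℝ (PlaneForm n) where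
  carrier := {α | α.Smooth ∧ ∀ x ∈ Ω, α.d x = 0}
  zero_mem' := ⟨PlaneForm.smooth_zero n, fun x _ => PlaneForm.d_zero n x⟩
  add_mem' := by
    rintro a b ⟨ha, ha'⟩ ⟨hb, hb'⟩
    refine ⟨ha.add hb, fun x hx => ?_⟩
    rw [PlaneForm.d_add ha hb, ha' x hx, hb' x hx, add_zero]
  smul_mem' := by
    rintro c a ⟨ha, ha'⟩
    refine ⟨ha.smul c, fun x hx => ?_⟩
    rw [PlaneForm.d_smul, ha' x hx, smul_zero]

/-- Smooth `n`-forms on the plane whose restriction to `Ω` is exact; in degree zero, those whose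
restriction to `Ω` vanishes. -/
def exactForms (Ω : Set ℂ) : (n : ℕ) → Submodule ℝ (PlaneForm n)
  | 0 =>
    { carrier := {α | α.Smooth ∧ ∀ x ∈ Ω, α x = 0}
      zero_mem' := ⟨PlaneForm.smooth_zero 0, fun _ _ => rfl⟩
      add_mem' := by
        rintro a b ⟨ha, ha'⟩ ⟨hb, hb'⟩
        refine ⟨ha.add hb, fun x hx => ?_⟩
        change a x + b x = 0
        rw [ha' x hx, hb' x hx, add_zero]
      smul_mem' := by
        rintro c a ⟨ha, ha'⟩
        refine ⟨ha.smul c, fun x hx => ?_⟩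
        change c • a x = 0
        rw [ha' x hx, smul_zero] }
  | n + 1 =>
    { carrier := {α | α.Smooth ∧ ∃ β : PlaneForm n, β.Smooth ∧ ∀ x ∈ Ω, α x = β.d x}
      zero_mem' := ⟨PlaneForm.smooth_zero _, 0, PlaneForm.smooth_zero n,
        fun x _ => (PlaneForm.d_zero n x).symm⟩
      add_mem' := by
        rintro a b ⟨ha, β, hβ, ha'⟩ ⟨hb, β', hβ', hb'⟩
        refine ⟨ha.add hb, β + β', hβ.add hβ', fun x hx => ?_⟩
        rw [PlaneForm.d_add hβ hβ', ← ha' x hx, ← hb' x hx]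
        rfl
      smul_mem' := by
        rintro c a ⟨ha, β, hβ, ha'⟩
        refine ⟨ha.smul c, c • β, hβ.smul c, fun x hx => ?_⟩
        rw [PlaneForm.d_smul, ← ha' x hx]
        rfl }

/-- The `n`-th de Rham cohomology `H^n(Ω)`: closed `n`-forms on `Ω` modulo exact ones. -/
abbrev DeRhamCohomology (Ω : Set ℂ) (n : ℕ) : Type :=
  closedForms Ω n ⧸ (exactForms Ω n).comap (closedForms Ω n).subtype

/-- The Euler characteristic `χ(Ω)`, the alternating sum of the Betti numbers. -/
noncomputable def eulerCharacteristic (Ω : Set ℂ) : ℤ :=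
  ∑ n ∈ Finset.range 3, (-1) ^ n * (Module.finrank ℝ (DeRhamCohomology Ω n) : ℤ)

/-! ### Arc-length parametrized smooth simple closed curves -/

/-- A smooth simple closed curve in the plane, parametrized by arc length. -/
structure ArcLoop where
  /-- the parametrization -/
  γ : ℝ → ℂ
  /-- the length -/
  l : ℝ
  l_pos : 0 < l
  smooth : ContDiff ℝ ∞ γ
  periodic : Function.Periodic γ l
  unit_speed : ∀ s, ‖deriv γ s‖ = 1
  simple : ∀ s ∈ Ico 0 l, ∀ t ∈ Ico 0 l, γ s = γ t → s = t

/-- The `i`-th boundary curve. -/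
def SmoothBoundary.loop {Ω : Set ℂ} (K : SmoothBoundary Ω) (i : Fin K.k) : ArcLoop where
  γ := K.γ i
  l := K.len i
  l_pos := K.len_pos i
  smooth := K.smooth i
  periodic := K.periodic i
  unit_speed := K.unit_speed i
  simple := fun s hs t ht h => (K.simple i i s hs t ht h).2

theorem periodic_deriv {g : ℝ → ℂ} {l : ℝ} (h : Function.Periodic g l) :
    Function.Periodic (deriv g) l := by
  intro x
  rw [← deriv_comp_add_const]
  congr 1
  funext y
  exact h y

theorem contDiff_deriv {g : ℝ → ℂ} (h : ContDiff ℝ ∞ g) : ContDiff ℝ ∞ (deriv g) :=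
  ((contDiff_infty_iff_deriv (𝕜 := ℝ)).1 h).2

theorem exists_norm_le_of_periodic {g : ℝ → ℂ} {l : ℝ} (hl : l ≠ 0) (h : Function.Periodic g l)
    (hg : Continuous g) : ∃ M, 0 ≤ M ∧ ∀ s, ‖g s‖ ≤ M := by
  obtain ⟨M, hM⟩ := (h.isBounded_of_continuous hl hg).exists_norm_le
  exact ⟨M, (norm_nonneg _).trans (hM _ (mem_range_self 0)), fun s => hM _ (mem_range_self s)⟩

/-- A mean value inequality with a bound on a symmetric interval. -/
theorem norm_sub_le_of_norm_deriv_le {f f' : ℝ → ℂ} (hf : ∀ x, HasDerivAt f (f' x) x) {C u : ℝ}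
    (h : ∀ x, |x| ≤ |u| → ‖f' x‖ ≤ C) : ‖f u - f 0‖ ≤ C * |u| := by
  have := (convex_uIcc (0 : ℝ) u).norm_image_sub_le_of_norm_hasDerivWithin_le
    (f := f) (f' := f') (C := C) (x := 0) (y := u)
    (fun x _ => (hf x).hasDerivWithinAt) (fun x hx => h x ?_) left_mem_uIcc right_mem_uIcc
  · simpa using this
  · rcases le_total 0 u with hu | hu
    · rw [uIcc_of_le hu] at hx
      rw [abs_of_nonneg hx.1, abs_of_nonneg hu]; exact hx.2
    · rw [uIcc_of_ge hu] at hx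
      rw [abs_of_nonpos hx.2, abs_of_nonpos hu]; linarith [hx.1]

theorem exists_taylor_bound {g : ℝ → ℂ} {l : ℝ} (hl : l ≠ 0) (h : Function.Periodic g l)
    (hg : ContDiff ℝ ∞ g) : ∃ M, 0 ≤ M ∧ (∀ s u, ‖g (s + u) - g s‖ ≤ M * |u|) ∧
      (∀ s u, ‖g (s + u) - g s - u * deriv g s‖ ≤ M * |u| ^ 2) := by
  have d1 : ∀ x, HasDerivAt g (deriv g x) x := fun x =>
    (hg.differentiable (by simp) x).hasDerivAt
  have hg1 := contDiff_deriv hg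
  have d2 : ∀ x, HasDerivAt (deriv g) (deriv (deriv g) x) x := fun x =>
    (hg1.differentiable (by simp) x).hasDerivAt
  obtain ⟨M₁, hM₁, h1⟩ := exists_norm_le_of_periodic hl (periodic_deriv h) hg1.continuous
  obtain ⟨M₂, hM₂, h2⟩ := exists_norm_le_of_periodic hl (periodic_deriv (periodic_deriv h))
    (contDiff_deriv hg1).continuous
  have e1 : ∀ s u, ‖g (s + u) - g s‖ ≤ M₁ * |u| := fun s u => by
    have := norm_sub_le_of_norm_deriv_le (f := fun u => g (s + u)) (f' := fun u => deriv g (s + u))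
      (fun x => (d1 (s + x)).comp_const_add s x) (C := M₁) (u := u) (fun x _ => h1 _)
    simpa using this
  have e2 : ∀ s u, ‖deriv g (s + u) - deriv g s‖ ≤ M₂ * |u| := fun s u => by
    have := norm_sub_le_of_norm_deriv_le (f := fun u => deriv g (s + u))
      (f' := fun u => deriv (deriv g) (s + u))
      (fun x => (d2 (s + x)).comp_const_add s x) (C := M₂) (u := u) (fun x _ => h2 _)
    simpa using this
  refine ⟨max M₁ M₂, le_max_of_le_left hM₁, fun s u => (e1 s u).trans (by gcongr; simp), ?_⟩
  intro s u
  have := norm_sub_le_of_norm_deriv_le (f := fun u => g (s + u) - g s - u * deriv g s)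
      (f' := fun u => deriv g (s + u) - deriv g s)
      (fun x => by
        have := (((d1 (s + x)).comp_const_add s x).sub_const (g s)).fun_sub
          ((Complex.ofRealCLM.hasDerivAt (x := x)).mul_const (deriv g s))
        simpa using this) (C := M₂ * |u|) (u := u)
      (fun x hx => (e2 s x).trans (by gcongr))
  simp only [add_zero, sub_self, Complex.ofReal_zero, zero_mul, sub_zero] at this
  refine this.trans ?_
  rw [mul_assoc, ← sq]
  gcongr
  simp

namespace ArcLoop

variable (c : ArcLoop)

/-- The unit tangent. -/
noncomputable def T (s : ℝ) : ℂ := deriv c.γ s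

/-- The signed curvature. -/
noncomputable def κ (s : ℝ) : ℝ := ((starRingEnd ℂ) (c.T s) * deriv c.T s).im

theorem l_ne : c.l ≠ 0 := c.l_pos.ne'

theorem norm_T (s : ℝ) : ‖c.T s‖ = 1 := c.unit_speed s

theorem T_ne (s : ℝ) : c.T s ≠ 0 := fun h => by simpa [h] using c.norm_T s

theorem smooth_T : ContDiff ℝ ∞ c.T := contDiff_deriv c.smooth

theorem smooth_T' : ContDiff ℝ ∞ (deriv c.T) := contDiff_deriv c.smooth_T

theorem continuous_γ : Continuous c.γ := c.smooth.continuous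

theorem continuous_T : Continuous c.T := c.smooth_T.continuous

theorem continuous_T' : Continuous (deriv c.T) := c.smooth_T'.continuous

theorem hasDerivAt_γ (s : ℝ) : HasDerivAt c.γ (c.T s) s :=
  (c.smooth.differentiable (by simp) s).hasDerivAt

theorem hasDerivAt_T' (s : ℝ) : HasDerivAt c.T (deriv c.T s) s :=
  (c.smooth_T.differentiable (by simp) s).hasDerivAt

theorem periodic_T : Function.Periodic c.T c.l := periodic_deriv c.periodic

theorem periodic_T' : Function.Periodic (deriv c.T) c.l := periodic_deriv c.periodic_T

theorem smooth_κ : ContDiff ℝ ∞ c.κ := by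
  have h : c.κ = fun s => Complex.imCLM (Complex.conjCLE (c.T s) * deriv c.T s) := by
    funext s; simp [κ]
  rw [h]
  have h1 := c.smooth_T
  have h2 := c.smooth_T'
  fun_prop

theorem continuous_κ : Continuous c.κ := c.smooth_κ.continuous

theorem periodic_κ : Function.Periodic c.κ c.l := fun s => by
  simp only [κ, c.periodic_T s, c.periodic_T' s]

theorem conj_T_mul_T (s : ℝ) : (starRingEnd ℂ) (c.T s) * c.T s = 1 := by
  rw [mul_comm, Complex.mul_conj, Complex.normSq_eq_norm_sq, c.norm_T]; simp

theorem T_mul_conj_T (s : ℝ) : c.T s * (starRingEnd ℂ) (c.T s) = 1 := by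
  rw [mul_comm, c.conj_T_mul_T]

theorem hasDerivAt_conj_T (s : ℝ) :
    HasDerivAt (fun s => (starRingEnd ℂ) (c.T s)) ((starRingEnd ℂ) (deriv c.T s)) s := by
  exact Complex.conjCLE.toContinuousLinearMap.hasFDerivAt.comp_hasDerivAt s
    (c.hasDerivAt_T' s)

theorem deriv_T (s : ℝ) : deriv c.T s = Complex.I * c.κ s * c.T s := by
  have h1 : HasDerivAt (fun s => (starRingEnd ℂ) (c.T s) * c.T s) _ s :=
    (c.hasDerivAt_conj_T s).mul (c.hasDerivAt_T' s)
  have h2 : (fun s => (starRingEnd ℂ) (c.T s) * c.T s) = fun _ => 1 := funext c.conj_T_mul_T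
  rw [h2] at h1
  have h3 := (hasDerivAt_const s (1 : ℂ)).unique h1
  have h4 : ((starRingEnd ℂ) (c.T s) * deriv c.T s).re = 0 := by
    have := congrArg Complex.re h3
    simp at this ⊢
    linarith
  have h5 : (starRingEnd ℂ) (c.T s) * deriv c.T s = Complex.I * c.κ s := by
    apply Complex.ext
    · simp [h4]
    · simp [κ]
  calc deriv c.T s = (c.T s * (starRingEnd ℂ) (c.T s)) * deriv c.T s := by
        rw [c.T_mul_conj_T, one_mul]
    _ = _ := by rw [mul_assoc, h5]; ring

theorem hasDerivAt_T (s : ℝ) : HasDerivAt c.T (Complex.I * c.κ s * c.T s) s :=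
  c.deriv_T s ▸ c.hasDerivAt_T' s

theorem γ_eq_iff {s t : ℝ} : c.γ s = c.γ t ↔ ∃ n : ℤ, t = s + n * c.l := by
  constructor
  · intro h
    have e : ∀ x, c.γ (toIcoMod c.l_pos 0 x) = c.γ x := fun x => by
      rw [toIcoMod]
      exact c.periodic.sub_zsmul_eq _
    have := c.simple (toIcoMod c.l_pos 0 s) (by simpa using toIcoMod_mem_Ico c.l_pos 0 s)
      (toIcoMod c.l_pos 0 t) (by simpa using toIcoMod_mem_Ico c.l_pos 0 t) (by rw [e, e, h])
    refine ⟨toIcoDiv c.l_pos 0 t - toIcoDiv c.l_pos 0 s, ?_⟩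
    have h1 := self_sub_toIcoDiv_zsmul c.l_pos 0 s
    have h2 := self_sub_toIcoDiv_zsmul c.l_pos 0 t
    simp only [zsmul_eq_mul] at h1 h2
    push_cast
    linarith
  · rintro ⟨n, rfl⟩
    have := c.periodic.int_mul n s
    simpa using this.symm

theorem γ_add_ne {s u : ℝ} (hu : u ≠ 0) (hu' : |u| < c.l) : c.γ (s + u) ≠ c.γ s := by
  intro h
  obtain ⟨n, hn⟩ := c.γ_eq_iff.1 h.symm
  have h1 : u = n * c.l := by linarith
  have h2 : (n : ℝ) ≠ 0 := fun h => hu (by rw [h1, h, zero_mul])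
  have h3 : (1 : ℝ) ≤ |(n : ℝ)| := by
    have : n ≠ 0 := by exact_mod_cast h2
    exact_mod_cast Int.one_le_abs this
  rw [h1, abs_mul, abs_of_pos c.l_pos] at hu'
  nlinarith [c.l_pos]

/-- Taylor estimates that are uniform along the curve. -/
theorem exists_bounds : ∃ M, 1 ≤ M ∧ (∀ s, |c.κ s| ≤ M) ∧
    (∀ s u, ‖c.T (s + u) - c.T s‖ ≤ M * |u|) ∧
    (∀ s u, ‖c.γ (s + u) - c.γ s - u * c.T s‖ ≤ M * |u| ^ 2) ∧
    (∀ s u, ‖c.γ (s + u) - c.γ s - u * c.T s - u ^ 2 / 2 * deriv c.T s‖ ≤ M * |u| ^ 3) ∧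
    (∀ s u, |c.κ (s + u) - c.κ s| ≤ M * |u|) := by
  obtain ⟨M₁, hM₁, h1, h2⟩ := exists_taylor_bound c.l_ne c.periodic c.smooth
  obtain ⟨M₂, hM₂, h3, h4⟩ := exists_taylor_bound c.l_ne c.periodic_T c.smooth_T
  have hk : ContDiff ℝ ∞ (fun s => (c.κ s : ℂ)) := Complex.ofRealCLM.contDiff.comp c.smooth_κ
  have hkp : Function.Periodic (fun s => (c.κ s : ℂ)) c.l := fun s => by
    simp only [c.periodic_κ s]
  obtain ⟨M₃, hM₃, h5, h6⟩ := exists_taylor_bound c.l_ne hkp hk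
  obtain ⟨M₄, hM₄, h7⟩ := exists_norm_le_of_periodic c.l_ne hkp hk.continuous
  set M := 1 + M₁ + M₂ + M₃ + M₄ with hM
  have l1 : M₁ ≤ M := by linarith
  have l2 : M₂ ≤ M := by linarith
  have l3 : M₃ ≤ M := by linarith
  have l4 : M₄ ≤ M := by linarith
  refine ⟨M, by linarith, fun s => ?_, fun s u => (h3 s u).trans (by gcongr),
    fun s u => (h2 s u).trans (by gcongr), fun s u => ?_, fun s u => ?_⟩
  · simpa using (h7 s).trans l4
  · have := norm_sub_le_of_norm_deriv_le
      (f := fun u => c.γ (s + u) - c.γ s - u * c.T s - u ^ 2 / 2 * deriv c.T s)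
      (f' := fun u => c.T (s + u) - c.T s - u * deriv c.T s)
      (fun x => by
        have e := (Complex.ofRealCLM.hasDerivAt (x := x))
        have := ((((c.hasDerivAt_γ (s + x)).comp_const_add s x).sub_const (c.γ s)).sub
          (e.mul_const (c.T s))).sub (((e.pow 2).div_const 2).mul_const (deriv c.T s))
        convert! this using 1
        simp) (C := M₂ * |u| ^ 2) (u := u)
      (fun x hx => (h4 s x).trans (by gcongr))
    simp only [add_zero, sub_self, Complex.ofReal_zero, zero_mul, sub_zero, ne_eq,
      OfNat.ofNat_ne_zero, not_false_eq_true, zero_pow, zero_div] at this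
    refine this.trans ?_
    rw [mul_assoc, ← pow_succ]
    gcongr
  · have := (h5 s u).trans (mul_le_mul_of_nonneg_right l3 (abs_nonneg u))
    rwa [← Complex.ofReal_sub, Complex.norm_real, Real.norm_eq_abs] at this

theorem norm_chord_le (s u : ℝ) : ‖c.γ (s + u) - c.γ s‖ ≤ |u| := by
  have := norm_sub_le_of_norm_deriv_le (f := fun u => c.γ (s + u)) (f' := fun u => c.T (s + u))
      (fun x => (c.hasDerivAt_γ (s + x)).comp_const_add s x) (C := 1) (u := u)
      (fun x _ => (c.norm_T _).le)
  simpa using this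

theorem exists_chord_lower_bound : ∃ c₀, 0 < c₀ ∧ c₀ ≤ 1 ∧
    ∀ s u, |u| ≤ c.l / 2 → c₀ * |u| ≤ ‖c.γ (s + u) - c.γ s‖ := by
  obtain ⟨M, hM, -, -, h2, -⟩ := c.exists_bounds
  have hl := c.l_pos
  have hη : 0 < 1 / (2 * M) := by positivity
  set η := 1 / (2 * M) with hηdef
  set S : Set (ℝ × ℝ) := Icc 0 c.l ×ˢ {u | η ≤ |u| ∧ |u| ≤ c.l / 2}
  have hS : IsCompact S := by
    refine isCompact_Icc.prod ?_
    refine (isCompact_Icc (a := -(c.l / 2)) (b := c.l / 2)).of_isClosed_subset ?_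
      (fun u hu => abs_le.1 hu.2)
    exact (isClosed_le continuous_const continuous_abs).inter
      (isClosed_le continuous_abs continuous_const)
  have small : ∀ s u, |u| ≤ η → 1 / 2 * |u| ≤ ‖c.γ (s + u) - c.γ s‖ := fun s u hu => by
    have h3 := h2 s u
    have h4 : ‖(u : ℂ) * c.T s‖ ≤ ‖c.γ (s + u) - c.γ s - u * c.T s‖ + ‖c.γ (s + u) - c.γ s‖ := by
      rw [← norm_neg (c.γ (s + u) - c.γ s - u * c.T s)]
      refine le_trans (le_of_eq ?_) (norm_add_le _ _)
      congr 1; ring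
    rw [norm_mul, c.norm_T, Complex.norm_real, Real.norm_eq_abs, mul_one] at h4
    have h5 : M * |u| ^ 2 ≤ 1 / 2 * |u| := by
      have : M * |u| ≤ 1 / 2 := by
        calc M * |u| ≤ M * η := by gcongr
          _ = 1 / 2 := by rw [hηdef]; field_simp
      nlinarith [abs_nonneg u]
    linarith
  have hper : ∀ s u, ‖c.γ (toIcoMod c.l_pos 0 s + u) - c.γ (toIcoMod c.l_pos 0 s)‖ =
      ‖c.γ (s + u) - c.γ s‖ := fun s u => by
    rw [toIcoMod, sub_add_eq_add_sub, c.periodic.sub_zsmul_eq, c.periodic.sub_zsmul_eq]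
  have hlow : ∃ c₁, 0 < c₁ ∧ ∀ x ∈ S, c₁ ≤ ‖c.γ (x.1 + x.2) - c.γ x.1‖ := by
    rcases S.eq_empty_or_nonempty with h | h
    · exact ⟨1, one_pos, by simp [h]⟩
    · have hc : Continuous fun x : ℝ × ℝ => ‖c.γ (x.1 + x.2) - c.γ x.1‖ := by
        have := c.continuous_γ
        fun_prop
      obtain ⟨x, hx, hx'⟩ := hS.exists_isMinOn h hc.continuousOn
      refine ⟨_, ?_, fun y hy => hx' hy⟩
      rw [norm_pos_iff, sub_ne_zero]
      refine c.γ_add_ne ?_ (lt_of_le_of_lt hx.2.2 (by linarith))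
      rw [← abs_pos]; exact hη.trans_le hx.2.1
  obtain ⟨c₁, hc₁, hl1⟩ := hlow
  refine ⟨min (1 / 2) (c₁ / c.l), by positivity, (min_le_left _ _).trans (by norm_num), ?_⟩
  intro s u hu
  rcases le_total |u| η with h | h
  · exact (mul_le_mul_of_nonneg_right (min_le_left _ _) (abs_nonneg u)).trans (small s u h)
  · have h3 := hl1 (toIcoMod c.l_pos 0 s, u)
      ⟨Ico_subset_Icc_self (by simpa using toIcoMod_mem_Ico c.l_pos 0 s), h, hu⟩
    simp only [hper] at h3
    refine le_trans ?_ h3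
    calc min (1 / 2) (c₁ / c.l) * |u| ≤ c₁ / c.l * (c.l) := by
          gcongr
          · exact min_le_right _ _
          · linarith
      _ = c₁ := by field_simp

end ArcLoop

/-! ### Tubular neighbourhoods -/

namespace ArcLoop

variable (c : ArcLoop)

/-- Normal coordinates: the point at signed distance `t` to the left of `γ s`. -/
noncomputable def tube (s t : ℝ) : ℂ := c.γ s + t * (Complex.I * c.T s)

@[simp] theorem tube_zero (s : ℝ) : c.tube s 0 = c.γ s := by simp [tube]

theorem T_eq_of_γ_eq {s t : ℝ} (h : c.γ s = c.γ t) : c.T s = c.T t := by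
  obtain ⟨n, rfl⟩ := c.γ_eq_iff.1 h
  simpa using (c.periodic_T.int_mul n s).symm

theorem κ_eq_of_γ_eq {s t : ℝ} (h : c.γ s = c.γ t) : c.κ s = c.κ t := by
  obtain ⟨n, rfl⟩ := c.γ_eq_iff.1 h
  simpa using (c.periodic_κ.int_mul n s).symm

theorem tube_eq_of_γ_eq {s s' : ℝ} (h : c.γ s = c.γ s') (t : ℝ) : c.tube s t = c.tube s' t := by
  rw [tube, tube, h, c.T_eq_of_γ_eq h]

theorem norm_tube_sub (s t : ℝ) : ‖c.tube s t - c.γ s‖ = |t| := by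
  simp [tube, c.norm_T]

theorem exists_γ_eq_add (s s' : ℝ) : ∃ u, |u| ≤ c.l / 2 ∧ c.γ s' = c.γ (s + u) := by
  have hl := c.l_pos
  set n : ℤ := round ((s' - s) / c.l)
  refine ⟨s' - s - n * c.l, ?_, ?_⟩
  · have := abs_sub_round ((s' - s) / c.l)
    have h2 : s' - s - n * c.l = ((s' - s) / c.l - n) * c.l := by field_simp
    rw [h2, abs_mul, abs_of_pos hl]
    nlinarith
  · rw [c.γ_eq_iff]
    exact ⟨-n, by push_cast; ring⟩

theorem exists_mem_Ico (s : ℝ) : ∃ s' ∈ Ico 0 c.l, c.γ s' = c.γ s := by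
  refine ⟨toIcoMod c.l_pos 0 s, by simpa using toIcoMod_mem_Ico c.l_pos 0 s, ?_⟩
  rw [toIcoMod]
  exact c.periodic.sub_zsmul_eq _

theorem exists_tube_injective : ∃ δ, 0 < δ ∧ (∀ s s' t t', |t| < δ → |t'| < δ →
    c.tube s t = c.tube s' t' → c.γ s = c.γ s' ∧ t = t') ∧
    (∀ s t, |t| < δ → 1 / 2 ≤ 1 - t * c.κ s) := by
  obtain ⟨M, hM, hk, h1, h2, -⟩ := c.exists_bounds
  obtain ⟨c₀, hc₀, hc₁, hc⟩ := c.exists_chord_lower_bound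
  have key : ∀ s u t t', |u| ≤ c.l / 2 → |t| < c₀ / (8 * M) → |t'| < c₀ / (8 * M) →
      c.tube s t = c.tube (s + u) t' → u = 0 := by
    intro s u t t' hu ht ht' h
    have e1 : c.γ (s + u) - c.γ s = Complex.I * (t * c.T s - t' * c.T (s + u)) := by
      simp only [tube] at h
      linear_combination -h
    have n1 : ‖c.γ (s + u) - c.γ s‖ ≤ |t| + |t'| := by
      rw [e1, norm_mul, Complex.norm_I, one_mul]
      refine (norm_sub_le _ _).trans ?_
      simp [c.norm_T]
    have hM0 : 0 < M := by linarith
    have hb : |t| + |t'| ≤ c₀ / (4 * M) := by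
      have : c₀ / (8 * M) + c₀ / (8 * M) = c₀ / (4 * M) := by field_simp; norm_num
      linarith
    have n2 : |u| ≤ 1 / (4 * M) := by
      have := (hc s u hu).trans (n1.trans hb)
      rw [show c₀ / (4 * M) = c₀ * (1 / (4 * M)) by ring] at this
      exact le_of_mul_le_mul_left this hc₀
    have e2 : ((c.γ (s + u) - c.γ s - u * c.T s) * (starRingEnd ℂ) (c.T s)).re + u =
        t' * ((c.T (s + u) - c.T s) * (starRingEnd ℂ) (c.T s)).im := by
      have e3 : (c.γ (s + u) - c.γ s - u * c.T s) * (starRingEnd ℂ) (c.T s) =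
          Complex.I * (t - t') - u
            - Complex.I * (t' * ((c.T (s + u) - c.T s) * (starRingEnd ℂ) (c.T s))) := by
        rw [e1]
        linear_combination (Complex.I * (t - t') - u) * c.T_mul_conj_T s
      rw [e3]
      simp [-map_sub]
    have b1 : |((c.γ (s + u) - c.γ s - u * c.T s) * (starRingEnd ℂ) (c.T s)).re| ≤ M * |u| ^ 2 := by
      refine (Complex.abs_re_le_norm _).trans ?_
      rw [norm_mul, RCLike.norm_conj, c.norm_T, mul_one]
      exact h2 s u
    have b2 : |((c.T (s + u) - c.T s) * (starRingEnd ℂ) (c.T s)).im| ≤ M * |u| := by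
      refine (Complex.abs_im_le_norm _).trans ?_
      rw [norm_mul, RCLike.norm_conj, c.norm_T, mul_one]
      exact h1 s u
    have b3 : |u| ≤ |t'| * (M * |u|) + M * |u| ^ 2 := by
      have : u = t' * ((c.T (s + u) - c.T s) * (starRingEnd ℂ) (c.T s)).im -
        ((c.γ (s + u) - c.γ s - u * c.T s) * (starRingEnd ℂ) (c.T s)).re := by linarith
      calc |u| = |t' * ((c.T (s + u) - c.T s) * (starRingEnd ℂ) (c.T s)).im -
        ((c.γ (s + u) - c.γ s - u * c.T s) * (starRingEnd ℂ) (c.T s)).re| := by rw [← this]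
        _ ≤ _ := abs_sub _ _
        _ ≤ _ := by rw [abs_mul]; gcongr
    have b4 : |t'| * M ≤ 1 / 8 := by
      have : |t'| * M ≤ c₀ / (8 * M) * M := by gcongr
      rw [div_mul_eq_mul_div, mul_div_mul_right _ _ hM0.ne'] at this
      linarith
    have b5 : M * |u| ≤ 1 / 4 := by
      have : M * |u| ≤ M * (1 / (4 * M)) := by gcongr
      rwa [show M * (1 / (4 * M)) = 1 / 4 by field_simp] at this
    have b6 : |u| ≤ 0 := by nlinarith [abs_nonneg u, abs_nonneg t']
    exact abs_eq_zero.1 (le_antisymm b6 (abs_nonneg u))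
  have hM0 : 0 < M := by linarith
  refine ⟨c₀ / (8 * M), by positivity, fun s s' t t' ht ht' h => ?_, fun s t ht => ?_⟩
  · obtain ⟨u, hu, hu'⟩ := c.exists_γ_eq_add s s'
    rw [c.tube_eq_of_γ_eq hu' t'] at h
    have hu0 := key s u t t' hu ht ht' h
    subst hu0
    rw [add_zero] at hu' h
    refine ⟨hu'.symm, ?_⟩
    simp only [tube, add_right_inj] at h
    exact_mod_cast mul_right_cancel₀ (mul_ne_zero Complex.I_ne_zero (c.T_ne s)) h
  · have : |t * c.κ s| ≤ c₀ / (8 * M) * M := by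
      rw [abs_mul]; gcongr; exact hk s
    rw [div_mul_eq_mul_div, mul_div_mul_right _ _ hM0.ne'] at this
    linarith [(abs_le.1 this).2]

theorem isCompact_range : IsCompact (range c.γ) :=
  c.periodic.compact_of_continuous c.l_ne c.continuous_γ

theorem continuous_tube : Continuous fun x : ℝ × ℝ => c.tube x.1 x.2 := by
  have := c.continuous_γ
  have := c.continuous_T
  unfold tube
  fun_prop

/-- The normal direction at a nearest point. -/
theorem exists_eq_tube_of_forall_norm_le {w : ℂ} {s : ℝ}
    (h : ∀ s', ‖w - c.γ s‖ ≤ ‖w - c.γ s'‖) : ∃ t, w = c.tube s t := by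
  have hd : HasDerivAt (fun s => ‖w - c.γ s‖ ^ 2) (2 * inner ℝ (w - c.γ s) (-c.T s)) s :=
    ((c.hasDerivAt_γ s).const_sub w).norm_sq
  have hmin : IsLocalMin (fun s => ‖w - c.γ s‖ ^ 2) s :=
    Filter.Eventually.of_forall fun s' => by
      have := h s'
      simp only
      gcongr
  have h0 := hmin.hasDerivAt_eq_zero hd
  have h1 : ((w - c.γ s) * (starRingEnd ℂ) (c.T s)).re = 0 := by
    rw [inner_neg_right, Complex.inner] at h0
    simp at h0 ⊢
    linarith
  refine ⟨((w - c.γ s) * (starRingEnd ℂ) (c.T s)).im, ?_⟩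
  have h2 : ((((w - c.γ s) * (starRingEnd ℂ) (c.T s)).im : ℝ) : ℂ) * Complex.I =
      (w - c.γ s) * (starRingEnd ℂ) (c.T s) := by
    apply Complex.ext
    · simpa using h1.symm
    · simp
  rw [tube]
  rw [← mul_assoc, h2, mul_assoc, c.conj_T_mul_T]
  ring

end ArcLoop

namespace SmoothBoundary

variable {Ω : Set ℂ} (K : SmoothBoundary Ω)

theorem mem_frontier_iff {z : ℂ} : z ∈ frontier Ω ↔ ∃ i s, (K.loop i).γ s = z := by
  rw [K.frontier_eq]; simp [loop]

theorem isCompact_frontier (K : SmoothBoundary Ω) : IsCompact (frontier Ω) := by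
  rw [K.frontier_eq]
  exact isCompact_iUnion fun i => (K.loop i).isCompact_range

theorem γ_ne {i j : Fin K.k} (h : i ≠ j) (s t : ℝ) : (K.loop i).γ s ≠ (K.loop j).γ t := by
  intro he
  obtain ⟨s', hs', es⟩ := (K.loop i).exists_mem_Ico s
  obtain ⟨t', ht', et⟩ := (K.loop j).exists_mem_Ico t
  exact h (K.simple i j s' hs' t' ht' (es.trans (he.trans et.symm))).1

theorem exists_separation : ∃ d, 0 < d ∧ ∀ i j, i ≠ j → ∀ s t,
    d ≤ ‖(K.loop i).γ s - (K.loop j).γ t‖ := by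
  have : ∀ x : Fin K.k × Fin K.k, ∃ d, 0 < d ∧ (x.1 ≠ x.2 → ∀ s t,
      d ≤ ‖(K.loop x.1).γ s - (K.loop x.2).γ t‖) := by
    rintro ⟨i, j⟩
    by_cases h : i = j
    · exact ⟨1, one_pos, fun h' => (h' h).elim⟩
    · have hd : Disjoint (range (K.loop i).γ) (range (K.loop j).γ) := by
        rw [Set.disjoint_left]
        rintro _ ⟨s, rfl⟩ ⟨t, ht⟩
        exact K.γ_ne h s t ht.symm
      obtain ⟨r, hr, hr'⟩ := Metric.exists_pos_forall_lt_edist (K.loop i).isCompact_range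
        (K.loop j).isCompact_range.isClosed hd
      refine ⟨r, hr, fun _ s t => ?_⟩
      have := hr' _ (mem_range_self s) _ (mem_range_self t)
      rw [edist_nndist, ENNReal.coe_lt_coe] at this
      rw [← dist_eq_norm, ← coe_nndist]
      exact_mod_cast this.le
  choose d hd hd' using this
  rcases isEmpty_or_nonempty (Fin K.k × Fin K.k) with h | h
  · exact ⟨1, one_pos, fun i j => h.elim (i, j)⟩
  · obtain ⟨x, hx⟩ := Finite.exists_min d
    exact ⟨d x, hd x, fun i j hij s t => (hx (i, j)).trans (hd' (i, j) hij s t)⟩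

/-- `δ₀` is an admissible radius of a tubular neighbourhood of the boundary. -/
structure IsTubular (δ₀ : ℝ) : Prop where
  pos : 0 < δ₀
  inj : ∀ i j s s' t t', |t| < δ₀ → |t'| < δ₀ → (K.loop i).tube s t = (K.loop j).tube s' t' →
    i = j ∧ (K.loop i).γ s = (K.loop j).γ s' ∧ t = t'
  jac : ∀ i s t, |t| < δ₀ → 1 / 2 ≤ 1 - t * (K.loop i).κ s

theorem exists_isTubular : ∃ δ₀, K.IsTubular δ₀ := by
  obtain ⟨d, hd, hsep⟩ := K.exists_separation
  choose δ hδ h1 h2 using fun i => (K.loop i).exists_tube_injective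
  obtain ⟨δ', hδ', hle⟩ : ∃ δ', 0 < δ' ∧ ∀ i, δ' ≤ δ i := by
    rcases isEmpty_or_nonempty (Fin K.k) with h | h
    · exact ⟨1, one_pos, fun i => h.elim i⟩
    · obtain ⟨x, hx⟩ := Finite.exists_min δ
      exact ⟨δ x, hδ x, hx⟩
  refine ⟨min δ' (d / 2), by positivity, ?_, ?_⟩
  · intro i j s s' t t' ht ht' h
    have ht1 := (lt_min_iff.1 ht)
    have ht2 := (lt_min_iff.1 ht')
    by_cases hij : i = j
    · subst hij
      exact ⟨rfl, h1 i s s' t t' (ht1.1.trans_le (hle i)) (ht2.1.trans_le (hle i)) h⟩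
    · exfalso
      have e : (K.loop i).γ s - (K.loop j).γ s' =
          ((K.loop j).tube s' t' - (K.loop j).γ s') - ((K.loop i).tube s t - (K.loop i).γ s) := by
        rw [h]; ring
      have := hsep i j hij s s'
      rw [e] at this
      have h3 := norm_sub_le ((K.loop j).tube s' t' - (K.loop j).γ s')
        ((K.loop i).tube s t - (K.loop i).γ s)
      rw [ArcLoop.norm_tube_sub, ArcLoop.norm_tube_sub] at h3
      linarith [ht1.2, ht2.2]
  · intro i s t ht
    exact h2 i s t ((lt_min_iff.1 ht).1.trans_le (hle i))

variable {K} {δ₀ : ℝ}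

theorem exists_eq_tube_of_dist_lt (K : SmoothBoundary Ω) {w p : ℂ} (hp : p ∈ frontier Ω) :
    ∃ i, ∃ s ∈ Ico 0 (K.loop i).l, ∃ t, w = (K.loop i).tube s t ∧ |t| ≤ dist w p ∧
      ∀ p' ∈ frontier Ω, |t| ≤ dist w p' := by
  obtain ⟨q, hq, hmin⟩ := K.isCompact_frontier.exists_isMinOn ⟨p, hp⟩
    (f := fun q => dist w q) (by fun_prop)
  obtain ⟨i, s, rfl⟩ := K.mem_frontier_iff.1 hq
  obtain ⟨s', hs', e⟩ := (K.loop i).exists_mem_Ico s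
  obtain ⟨t, ht⟩ := (K.loop i).exists_eq_tube_of_forall_norm_le (w := w) (s := s') fun s'' => by
    rw [e, ← dist_eq_norm, ← dist_eq_norm]
    exact hmin (K.mem_frontier_iff.2 ⟨i, s'', rfl⟩)
  have h1 : |t| = dist w ((K.loop i).γ s) := by
    rw [← e, dist_eq_norm, ht, ArcLoop.norm_tube_sub]
  exact ⟨i, s', hs', t, ht, h1 ▸ hmin hp, fun p' hp' => h1 ▸ hmin hp'⟩

namespace IsTubular

theorem le_dist (h : K.IsTubular δ₀) (i : Fin K.k) (s : ℝ) {t : ℝ} (ht : |t| < δ₀) {p : ℂ} (hp : p ∈ frontier Ω) :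
    |t| ≤ dist ((K.loop i).tube s t) p := by
  obtain ⟨j, s', -, t', e, h1, h2⟩ :=
    K.exists_eq_tube_of_dist_lt (w := (K.loop i).tube s t)
      (K.mem_frontier_iff.2 ⟨i, s, rfl⟩)
  rw [dist_eq_norm, ArcLoop.norm_tube_sub] at h1
  obtain ⟨-, -, rfl⟩ := h.inj i j s s' t t' ht (h1.trans_lt ht) e
  exact h2 p hp

theorem tube_notMem_frontier (h : K.IsTubular δ₀) (i : Fin K.k) (s : ℝ) {t : ℝ} (ht : |t| < δ₀) (h0 : t ≠ 0) :
    (K.loop i).tube s t ∉ frontier Ω := by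
  intro hf
  have := h.le_dist i s ht hf
  rw [dist_self] at this
  exact h0 (abs_eq_zero.1 (le_antisymm this (abs_nonneg t)))

theorem tube_mem_interior (h : K.IsTubular δ₀) (i : Fin K.k) (s : ℝ) {t : ℝ} (h0 : 0 < t) (ht : t < δ₀) :
    (K.loop i).tube s t ∈ interior Ω := by
  have hc : IsPreconnected ((fun t => (K.loop i).tube s t) '' Ioo 0 δ₀) :=
    isPreconnected_Ioo.image _ ((K.loop i).continuous_tube.comp
      (Continuous.prodMk_right s)).continuousOn
  by_contra hn
  have hs : (fun t => (K.loop i).tube s t) '' Ioo 0 δ₀ ⊆ interior Ω := by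
    refine hc.subset_of_closure_inter_subset isOpen_interior ?_ ?_
    · obtain ⟨x, hx⟩ := ((K.left_mem i s).and (Ioo_mem_nhdsGT h.pos)).exists
      exact ⟨_, ⟨x, hx.2, rfl⟩, hx.1⟩
    · rintro _ ⟨hz, ⟨x, hx, rfl⟩⟩
      by_contra hni
      refine h.tube_notMem_frontier i s (t := x) (by rw [abs_of_pos hx.1]; exact hx.2) hx.1.ne' ?_
      exact ⟨closure_mono interior_subset hz, hni⟩
  exact hn (hs ⟨t, ⟨h0, ht⟩, rfl⟩)

theorem tube_notMem (h : K.IsTubular δ₀) (i : Fin K.k) (s : ℝ) {t : ℝ} (h0 : t < 0) (ht : -δ₀ < t) :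
    (K.loop i).tube s t ∉ Ω := by
  have hc : IsPreconnected ((fun t => (K.loop i).tube s (-t)) '' Ioo 0 δ₀) :=
    isPreconnected_Ioo.image _ ((K.loop i).continuous_tube.comp
      (by fun_prop : Continuous fun t : ℝ => (s, -t))).continuousOn
  have hs : (fun t => (K.loop i).tube s (-t)) '' Ioo 0 δ₀ ⊆ (closure Ω)ᶜ := by
    refine hc.subset_of_closure_inter_subset isClosed_closure.isOpen_compl ?_ ?_
    · obtain ⟨x, hx⟩ := ((K.right_notMem i s).and (Ioo_mem_nhdsGT h.pos)).exists
      refine ⟨_, ⟨x, hx.2, rfl⟩, ?_⟩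
      intro hcl
      refine h.tube_notMem_frontier i s (t := -x) (by
        rw [abs_neg, abs_of_pos hx.2.1]; exact hx.2.2) (neg_ne_zero.2 hx.2.1.ne') ?_
      refine ⟨hcl, fun hi => hx.1 (interior_subset ?_)⟩
      convert! hi using 1
      simp [ArcLoop.tube, loop, ArcLoop.T]; ring
    · rintro _ ⟨hz, ⟨x, hx, rfl⟩⟩ hcl
      refine h.tube_notMem_frontier i s (t := -x) (by
        rw [abs_neg, abs_of_pos hx.1]; exact hx.2) (neg_ne_zero.2 hx.1.ne') ⟨hcl, ?_⟩
      rw [closure_compl] at hz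
      exact fun hi => hz (interior_mono subset_closure hi)
  intro hΩ
  exact hs ⟨-t, ⟨by linarith, by linarith⟩, by simp⟩ (subset_closure hΩ)

theorem tube_mem_innerDomain_iff (h : K.IsTubular δ₀) (hΩ : IsClosed Ω) (i : Fin K.k) (s : ℝ) {t δ : ℝ} (hδ : 0 ≤ δ)
    (ht : |t| < δ₀) : (K.loop i).tube s t ∈ innerDomain Ω δ ↔ δ ≤ t := by
  constructor
  · rintro ⟨h1, h2⟩
    have h3 : 0 ≤ t := by
      by_contra hn
      exact h.tube_notMem i s (not_le.1 hn) (abs_lt.1 ht).1 h1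
    have := h2 _ (K.mem_frontier_iff.2 ⟨i, s, rfl⟩)
    rwa [dist_eq_norm, ArcLoop.norm_tube_sub, abs_of_nonneg h3] at this
  · intro hle
    refine ⟨?_, fun p hp => (hle.trans (le_abs_self t)).trans (h.le_dist i s ht hp)⟩
    rcases (hδ.trans hle).eq_or_lt with h0 | h0
    · rw [← h0, ArcLoop.tube_zero]
      exact hΩ.frontier_subset (K.mem_frontier_iff.2 ⟨i, s, rfl⟩)
    · exact interior_subset (h.tube_mem_interior i s h0 (abs_lt.1 ht).2)

theorem innerDomain_inter_thickening (h : K.IsTubular δ₀) (hΩ : IsClosed Ω) {δ b : ℝ} (hδ : 0 ≤ δ) (hb : b ≤ δ₀) :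
    innerDomain Ω δ ∩ Metric.thickening b (frontier Ω) =
      ⋃ i, (fun x : ℝ × ℝ => (K.loop i).tube x.1 x.2) '' (Ico 0 (K.loop i).l ×ˢ Ico δ b) := by
  ext w
  simp only [mem_inter_iff, mem_iUnion, mem_image, mem_prod, Prod.exists]
  constructor
  · rintro ⟨hw, hw'⟩
    obtain ⟨p, hp, hlt⟩ := Metric.mem_thickening_iff.1 hw'
    obtain ⟨i, s, hs, t, rfl, h1, h2⟩ := K.exists_eq_tube_of_dist_lt (w := w) hp
    have ht : |t| < δ₀ := (h1.trans_lt hlt).trans_le hb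
    have := (h.tube_mem_innerDomain_iff hΩ i s hδ ht).1 hw
    exact ⟨i, s, t, ⟨hs, this, (le_abs_self t).trans_lt (h1.trans_lt hlt)⟩, rfl⟩
  · rintro ⟨i, s, t, ⟨hs, ht⟩, rfl⟩
    have h0 : |t| = t := abs_of_nonneg (hδ.trans ht.1)
    refine ⟨(h.tube_mem_innerDomain_iff hΩ i s hδ (h0.trans_lt (ht.2.trans_le hb))).2 ht.1, ?_⟩
    refine Metric.mem_thickening_iff.2 ⟨_, K.mem_frontier_iff.2 ⟨i, s, rfl⟩, ?_⟩
    rw [dist_eq_norm, ArcLoop.norm_tube_sub, h0]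
    exact ht.2

end IsTubular

end SmoothBoundary

/-! ### Green's formula -/

/-- A smooth cutoff function between disjoint closed sets. -/
theorem exists_contDiff_cutoff {A B : Set ℂ} (hA : IsClosed A) (hB : IsClosed B)
    (h : Disjoint A B) : ∃ χ : ℂ → ℝ, ContDiff ℝ ∞ χ ∧ (∀ z ∈ A, χ z = 1) ∧ (∀ z ∈ B, χ z = 0) ∧
      ∀ z, 0 ≤ χ z ∧ χ z ≤ 1 := by
  obtain ⟨f, h0, h1, h2⟩ := exists_contMDiffMap_zero_one_of_isClosed (n := (⊤ : ℕ∞))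
    (modelWithCornersSelf ℝ ℂ) hB hA h.symm
  exact ⟨f, f.contMDiff.contDiff, fun z hz => h1 hz, fun z hz => h0 hz, fun z => h2 z⟩

theorem tendsto_line_cocompact (a : ℂ) {v : ℂ} (hv : v ≠ 0) :
    Tendsto (fun x : ℝ => a + x * v) atTop (cocompact ℂ) ∧
      Tendsto (fun x : ℝ => a + x * v) atBot (cocompact ℂ) := by
  have h : Tendsto (fun x : ℝ => a + x * v) (cocompact ℝ) (cocompact ℂ) := by
    have h1 : Tendsto (fun x : ℝ => (x : ℂ)) (cocompact ℝ) (cocompact ℂ) :=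
      Complex.isometry_ofReal.isClosedEmbedding.tendsto_cocompact
    have h2 : Tendsto (fun z : ℂ => a + z * v) (cocompact ℂ) (cocompact ℂ) :=
      ((Homeomorph.mulRight₀ v hv).trans (Homeomorph.addLeft a)).isClosedEmbedding.tendsto_cocompact
    exact h2.comp h1
  exact ⟨h.mono_left atTop_le_cocompact, h.mono_left atBot_le_cocompact⟩

theorem integral_fderiv_eq_zero {f : ℂ → ℝ} (hf : ContDiff ℝ 1 f)
    (h0 : Tendsto f (cocompact ℂ) (𝓝 0)) (hi : Integrable (fderiv ℝ f)) (v : ℂ) :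
    ∫ z, fderiv ℝ f z v = 0 := by
  have hd : ∀ z, HasFDerivAt f (fderiv ℝ f z) z := fun z =>
    (hf.differentiable (by simp) z).hasFDerivAt
  have hmp := Complex.volume_preserving_equiv_real_prod.symm
  have line : ∀ (a v : ℂ), v ≠ 0 → Integrable (fun x : ℝ => fderiv ℝ f (a + x * v) v) →
      ∫ x : ℝ, fderiv ℝ f (a + x * v) v = 0 := by
    intro a v hv hint
    have := integral_of_hasDerivAt_of_tendsto (f := fun x : ℝ => f (a + x * v))
      (f' := fun x : ℝ => fderiv ℝ f (a + x * v) v) (fun x => by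
        have h1 : HasDerivAt (fun x : ℝ => a + (x : ℂ) * v) v x := by
          simpa using ((Complex.ofRealCLM.hasDerivAt (x := x)).mul_const v).const_add a
        exact (hd _).comp_hasDerivAt x h1) hint
      (h0.comp (tendsto_line_cocompact a hv).2) (h0.comp (tendsto_line_cocompact a hv).1)
    simpa using this
  have main : ∀ v : ℂ, v = 1 ∨ v = Complex.I → ∫ z, fderiv ℝ f z v = 0 := by
    intro v hv
    have hiv : Integrable (fun z => fderiv ℝ f z v) := hi.apply_continuousLinearMap v
    have hip : Integrable (fun x : ℝ × ℝ => fderiv ℝ f (x.1 + x.2 * Complex.I) v) := by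
      have := (hmp.integrable_comp_emb (MeasurableEquiv.measurableEmbedding _)).2 hiv
      convert! this using 2
      simp [Complex.mk_eq_add_mul_I]
    rw [← hmp.integral_comp (MeasurableEquiv.measurableEmbedding _)]
    have e : ∀ x : ℝ × ℝ, Complex.measurableEquivRealProd.symm x = x.1 + x.2 * Complex.I :=
      fun x => by simp [Complex.mk_eq_add_mul_I]
    simp only [e]
    rcases hv with rfl | rfl
    · rw [Measure.volume_eq_prod, integral_prod_symm _ hip]
      refine integral_eq_zero_of_ae ?_
      filter_upwards [hip.prod_left_ae] with y hy
      have := line (y * Complex.I) 1 one_ne_zero (by simpa [add_comm] using hy)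
      simpa [add_comm] using this
    · rw [Measure.volume_eq_prod, integral_prod _ hip]
      refine integral_eq_zero_of_ae ?_
      filter_upwards [hip.prod_right_ae] with x hx
      exact line x Complex.I Complex.I_ne_zero hx
  have hv : v = v.re • (1 : ℂ) + v.im • Complex.I := by simp
  have : ∀ z, fderiv ℝ f z v = v.re * fderiv ℝ f z 1 + v.im * fderiv ℝ f z Complex.I := fun z => by
    conv_lhs => rw [hv]
    rw [map_add, map_smul, map_smul]; rfl
  simp only [this]
  rw [integral_add ((hi.apply_continuousLinearMap _).const_mul _)
    ((hi.apply_continuousLinearMap _).const_mul _), integral_const_mul, integral_const_mul,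
    main 1 (Or.inl rfl), main Complex.I (Or.inr rfl)]
  simp

/-- The divergence theorem on a rectangle. -/
theorem integral_rectangle_divergence {P Q P' Q' : ℝ × ℝ → ℝ} (hP' : Continuous P')
    (hQ' : Continuous Q') (hP : ∀ s t, HasDerivAt (fun s => P (s, t)) (P' (s, t)) s)
    (hQ : ∀ s t, HasDerivAt (fun t => Q (s, t)) (Q' (s, t)) t) {l a b : ℝ} (hl : 0 ≤ l)
    (hab : a ≤ b) :
    ∫ x in Ico 0 l ×ˢ Ico a b, (P' x + Q' x) =
      (∫ t in a..b, (P (l, t) - P (0, t))) + ∫ s in 0..l, (Q (s, b) - Q (s, a)) := by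
  have hint : ∀ {g : ℝ × ℝ → ℝ}, Continuous g → IntegrableOn g (Ico 0 l ×ˢ Ico a b) := fun hg =>
    (hg.continuousOn.integrableOn_compact (isCompact_Icc.prod isCompact_Icc)).mono_set
      (prod_mono Ico_subset_Icc_self Ico_subset_Icc_self)
  rw [integral_add (hint hP') (hint hQ')]
  congr 1
  · have h1 : ∫ x in Ico 0 l ×ˢ Ico a b, P' x =
        ∫ t in Ico a b, ∫ s in Ico 0 l, P' (s, t) := by
      have h2 := hint hP'
      rw [IntegrableOn, Measure.volume_eq_prod, ← Measure.prod_restrict] at h2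
      rw [Measure.volume_eq_prod, ← Measure.prod_restrict, integral_prod_symm _ h2]
    rw [h1, intervalIntegral.integral_of_le hab, integral_Ico_eq_integral_Ioc]
    congr 1
    funext t
    rw [integral_Ico_eq_integral_Ioc, ← intervalIntegral.integral_of_le hl]
    exact intervalIntegral.integral_eq_sub_of_hasDerivAt (fun s _ => hP s t)
      (Continuous.intervalIntegrable (by fun_prop) _ _)
  · rw [Measure.volume_eq_prod, setIntegral_prod _ (hint hQ'),
      intervalIntegral.integral_of_le hl, integral_Ico_eq_integral_Ioc]
    congr 1
    funext s
    rw [integral_Ico_eq_integral_Ioc, ← intervalIntegral.integral_of_le hab]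
    exact intervalIntegral.integral_eq_sub_of_hasDerivAt (fun t _ => hQ s t)
      (Continuous.intervalIntegrable (by fun_prop) _ _)

namespace ArcLoop

variable (c : ArcLoop)

/-- The Jacobian of normal coordinates. -/
noncomputable def jac (s t : ℝ) : ℝ := 1 - t * c.κ s

/-- The component of `v` in the direction of the left normal. -/
noncomputable def nc (v : ℂ) (s : ℝ) : ℝ := ((starRingEnd ℂ) v * (Complex.I * c.T s)).re

/-- The component of `v` in the direction of the tangent. -/
noncomputable def tc (v : ℂ) (s : ℝ) : ℝ := ((starRingEnd ℂ) v * c.T s).re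

theorem eq_tc_add_nc (v : ℂ) (s : ℝ) :
    v = c.tc v s • c.T s + c.nc v s • (Complex.I * c.T s) := by
  have h := c.conj_T_mul_T s
  have hre : (c.T s).re * (c.T s).re + (c.T s).im * (c.T s).im = 1 := by
    simpa using congrArg Complex.re h
  apply Complex.ext
  · simp [tc, nc]
    linear_combination -v.re * hre
  · simp [tc, nc]
    linear_combination -v.im * hre

theorem hasDerivAt_tube_fst (s t : ℝ) :
    HasDerivAt (fun s => c.tube s t) (c.jac s t • c.T s) s := by
  have := (c.hasDerivAt_γ s).add (((c.hasDerivAt_T s).const_mul Complex.I).const_mul (t : ℂ))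
  convert! this using 1
  simp only [jac, Complex.real_smul, Complex.ofReal_sub, Complex.ofReal_one, Complex.ofReal_mul]
  linear_combination (-(t : ℂ) * c.κ s * c.T s) * Complex.I_mul_I

theorem hasDerivAt_tube_snd (s t : ℝ) :
    HasDerivAt (fun t => c.tube s t) (Complex.I * c.T s) t := by
  have := ((Complex.ofRealCLM.hasDerivAt (x := t)).mul_const (Complex.I * c.T s)).const_add
    (c.γ s)
  convert! this using 1
  simp

theorem contDiff_tube : ContDiff ℝ ∞ fun x : ℝ × ℝ => c.tube x.1 x.2 := by
  have h1 := c.smooth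
  have h2 := c.smooth_T
  have h3 : ContDiff ℝ ∞ fun x : ℝ × ℝ => (x.2 : ℂ) :=
    Complex.ofRealCLM.contDiff.comp contDiff_snd
  unfold tube
  fun_prop

/-- The derivative of normal coordinates. -/
noncomputable def tubeDeriv (s t : ℝ) : ℂ →L[ℝ] ℂ :=
  Complex.reCLM.smulRight (c.jac s t • c.T s) + Complex.imCLM.smulRight (Complex.I * c.T s)

theorem hasFDerivAt_tube (z : ℂ) :
    HasFDerivAt (fun z : ℂ => c.tube z.re z.im) (c.tubeDeriv z.re z.im) z := by
  have h1 : HasFDerivAt (fun z : ℂ => c.γ z.re) (Complex.reCLM.smulRight (c.T z.re)) z := by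
    have := (c.hasDerivAt_γ z.re).hasFDerivAt.comp z Complex.reCLM.hasFDerivAt
    convert! this using 1
  have h2 : HasFDerivAt (fun z : ℂ => Complex.I * c.T z.re)
      (Complex.reCLM.smulRight (Complex.I * (Complex.I * c.κ z.re * c.T z.re))) z := by
    have := ((c.hasDerivAt_T z.re).const_mul Complex.I).hasFDerivAt.comp z
      Complex.reCLM.hasFDerivAt
    convert! this using 1
  have h3 : HasFDerivAt (fun z : ℂ => (z.im : ℂ)) (Complex.ofRealCLM.comp Complex.imCLM) z :=
    (Complex.ofRealCLM.comp Complex.imCLM).hasFDerivAt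
  have := h1.add (h3.mul h2)
  convert! this using 1
  refine ContinuousLinearMap.ext fun x => ?_
  simp only [tubeDeriv, jac, _root_.add_apply, ContinuousLinearMap.smulRight_apply,
    Complex.reCLM_apply, Complex.imCLM_apply, _root_.smul_apply,
    ContinuousLinearMap.comp_apply, Complex.ofRealCLM_apply, Complex.real_smul, smul_eq_mul,
    Complex.ofReal_sub, Complex.ofReal_one, Complex.ofReal_mul]
  linear_combination (-(x.re : ℂ) * z.im * c.κ z.re * c.T z.re) * Complex.I_mul_I

theorem det_tubeDeriv (s t : ℝ) : (c.tubeDeriv s t).det = c.jac s t := by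
  have hre : (c.T s).re * (c.T s).re + (c.T s).im * (c.T s).im = 1 := by
    simpa using congrArg Complex.re (c.conj_T_mul_T s)
  rw [ContinuousLinearMap.det, ← LinearMap.det_toMatrix Complex.basisOneI, Matrix.det_fin_two]
  simp [LinearMap.toMatrix_apply, tubeDeriv]
  linear_combination c.jac s t * hre

end ArcLoop

namespace ArcLoop

variable (c : ArcLoop)

theorem periodic_tube (t : ℝ) : Function.Periodic (fun s => c.tube s t) c.l := fun s =>
  c.tube_eq_of_γ_eq (c.periodic s) t

theorem continuous_nc (v : ℂ) : Continuous (c.nc v) := by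
  have := c.continuous_T
  unfold nc
  fun_prop

theorem continuous_tc (v : ℂ) : Continuous (c.tc v) := by
  have := c.continuous_T
  unfold tc
  fun_prop

theorem continuous_jac : Continuous fun x : ℝ × ℝ => c.jac x.1 x.2 := by
  have := c.continuous_κ
  unfold jac
  fun_prop

theorem hasDerivAt_tc (v : ℂ) (s : ℝ) : HasDerivAt (c.tc v) (c.κ s * c.nc v s) s := by
  have := Complex.reCLM.hasFDerivAt.comp_hasDerivAt s
    ((c.hasDerivAt_T s).const_mul ((starRingEnd ℂ) v))
  convert! this using 1
  simp [nc]
  ring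

theorem integral_jac_mul_fderiv {F : ℂ → ℝ} (hF : ContDiff ℝ 1 F) (v : ℂ) {a b : ℝ}
    (hab : a ≤ b) :
    ∫ x in Ico 0 c.l ×ˢ Ico a b, c.jac x.1 x.2 * fderiv ℝ F (c.tube x.1 x.2) v =
      ∫ s in 0..c.l, (c.jac s b * F (c.tube s b) * c.nc v s -
        c.jac s a * F (c.tube s a) * c.nc v s) := by
  have hd : ∀ z, HasFDerivAt F (fderiv ℝ F z) z := fun z =>
    (hF.differentiable (by simp) z).hasFDerivAt
  have hFc : Continuous (fderiv ℝ F) := hF.continuous_fderiv (by simp)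
  have ct := c.continuous_tube
  have cj := c.continuous_jac
  have ck := c.continuous_κ
  have cT := c.continuous_T
  have cn := c.continuous_nc v
  have ctc := c.continuous_tc v
  have hF0 := hF.continuous
  have hFt : Continuous fun x : ℝ × ℝ => fderiv ℝ F (c.tube x.1 x.2) := hFc.comp ct
  have := integral_rectangle_divergence
    (P := fun x => F (c.tube x.1 x.2) * c.tc v x.1)
    (P' := fun x => fderiv ℝ F (c.tube x.1 x.2) (c.jac x.1 x.2 • c.T x.1) * c.tc v x.1 +
      F (c.tube x.1 x.2) * (c.κ x.1 * c.nc v x.1))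
    (Q := fun x => c.jac x.1 x.2 * F (c.tube x.1 x.2) * c.nc v x.1)
    (Q' := fun x => (-c.κ x.1 * F (c.tube x.1 x.2) +
      c.jac x.1 x.2 * fderiv ℝ F (c.tube x.1 x.2) (Complex.I * c.T x.1)) * c.nc v x.1)
    (by fun_prop) (by fun_prop)
    (fun s t => ((hd _).comp_hasDerivAt s (c.hasDerivAt_tube_fst s t)).mul (c.hasDerivAt_tc v s))
    (fun s t => by
      have h1 : HasDerivAt (fun t => c.jac s t) (-c.κ s) t := by
        simpa [jac] using ((hasDerivAt_id t).mul_const (c.κ s)).const_sub 1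
      exact (h1.mul ((hd _).comp_hasDerivAt t (c.hasDerivAt_tube_snd s t))).mul_const (c.nc v s))
    c.l_pos.le hab
  have e0 : ∀ t, F (c.tube c.l t) * c.tc v c.l - F (c.tube 0 t) * c.tc v 0 = 0 := fun t => by
    have h1 := c.periodic_tube t 0
    have h2 := c.periodic_T 0
    simp only [zero_add] at h1 h2
    rw [h1, tc, h2, ← tc, sub_self]
  simp only [e0, intervalIntegral.integral_zero, zero_add] at this
  rw [← this]
  congr 1
  funext x
  have hv := c.eq_tc_add_nc v x.1
  conv_lhs => rw [hv]
  simp only [map_add, map_smul, smul_eq_mul]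
  ring

theorem integral_tube_image (g : ℂ → ℝ) {S : Set (ℝ × ℝ)} (hS : MeasurableSet S)
    (hinj : InjOn (fun x : ℝ × ℝ => c.tube x.1 x.2) S) :
    MeasurableSet ((fun x : ℝ × ℝ => c.tube x.1 x.2) '' S) ∧
    ∫ z in (fun x : ℝ × ℝ => c.tube x.1 x.2) '' S, g z =
      ∫ x in S, |c.jac x.1 x.2| * g (c.tube x.1 x.2) := by
  set e := Complex.measurableEquivRealProd
  have he : ∀ z, e z = (z.re, z.im) := fun z => rfl
  have himg : (fun x : ℝ × ℝ => c.tube x.1 x.2) '' S =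
      (fun z : ℂ => c.tube z.re z.im) '' (e ⁻¹' S) := by
    rw [← e.image_symm, image_image]
    rfl
  have hS' : MeasurableSet (e ⁻¹' S) := e.measurable hS
  have hinj' : InjOn (fun z : ℂ => c.tube z.re z.im) (e ⁻¹' S) := by
    intro z hz w hw hzw
    exact e.injective (hinj hz hw hzw)
  have hd : ∀ z ∈ e ⁻¹' S, HasFDerivWithinAt (fun z : ℂ => c.tube z.re z.im)
      (c.tubeDeriv z.re z.im) (e ⁻¹' S) z := fun z _ => (c.hasFDerivAt_tube z).hasFDerivWithinAt
  rw [himg]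
  refine ⟨measurable_image_of_fderivWithin hS' hd hinj', ?_⟩
  rw [integral_image_eq_integral_abs_det_fderiv_smul volume hS' hd hinj']
  rw [← Complex.volume_preserving_equiv_real_prod.setIntegral_preimage_emb
    e.measurableEmbedding]
  simp only [det_tubeDeriv, smul_eq_mul]
  rfl

end ArcLoop

theorem isClosed_innerDomain {Ω : Set ℂ} (hΩ : IsClosed Ω) (δ : ℝ) :
    IsClosed (innerDomain Ω δ) := by
  have : innerDomain Ω δ = Ω ∩ ⋂ p ∈ frontier Ω, {w | δ ≤ dist w p} := by
    ext; simp [innerDomain]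
  rw [this]
  exact hΩ.inter (isClosed_biInter fun p _ => isClosed_le continuous_const (by fun_prop))

theorem innerDomain_zero (Ω : Set ℂ) : innerDomain Ω 0 = Ω := by
  ext; simp [innerDomain, dist_nonneg]

/-- A function that vanishes near the boundary may be cut off outside of the domain. -/
theorem setIntegral_innerDomain_fderiv_eq_zero {Ω : Set ℂ} (hΩ : IsClosed Ω) {δ a : ℝ}
    (hδa : δ < a) (ha : 0 < a) {g : ℂ → ℝ} (hg : ContDiff ℝ 1 g)
    (hg0 : ∀ z ∈ Metric.thickening a (frontier Ω), g z = 0)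
    (h0 : Tendsto g (cocompact ℂ) (𝓝 0)) (hi : Integrable (fderiv ℝ g)) (v : ℂ) :
    ∫ z in innerDomain Ω δ, fderiv ℝ g z v = 0 := by
  classical
  set D := innerDomain Ω δ
  have hD : IsClosed D := isClosed_innerDomain hΩ δ
  have hloc : ∀ z, (∀ᶠ w in 𝓝 z, D.indicator g w = g w) ∧ z ∈ D ∨
      (∀ᶠ w in 𝓝 z, D.indicator g w = 0) ∧ (z ∈ D → fderiv ℝ g z = 0) := by
    intro z
    by_cases hz : z ∈ Metric.thickening a (frontier Ω)
    · right
      have : ∀ᶠ w in 𝓝 z, g w = 0 := by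
        filter_upwards [Metric.isOpen_thickening.mem_nhds hz] with w hw using hg0 w hw
      refine ⟨this.mono fun w hw => by simp [indicator, hw], fun _ => ?_⟩
      have h1 : g =ᶠ[𝓝 z] fun _ => 0 := this
      rw [h1.fderiv_eq]; simp
    · have hz' : ∀ p ∈ frontier Ω, a ≤ dist z p := by
        simpa [Metric.mem_thickening_iff] using hz
      by_cases hzΩ : z ∈ Ω
      · left
        have hzi : z ∈ interior Ω := by
          by_contra hni
          have := hz' z ⟨subset_closure hzΩ, hni⟩
          rw [dist_self] at this
          linarith
        have hev : ∀ᶠ w in 𝓝 z, w ∈ D := by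
          filter_upwards [isOpen_interior.mem_nhds hzi,
            Metric.ball_mem_nhds z (sub_pos.2 hδa)] with w hw1 hw2
          refine ⟨interior_subset hw1, fun p hp => ?_⟩
          have := hz' p hp
          have h2 := dist_triangle z w p
          rw [Metric.mem_ball, dist_comm] at hw2
          linarith
        exact ⟨hev.mono fun w hw => by simp [hw], hev.self_of_nhds⟩
      · right
        refine ⟨?_, fun h => (hzΩ h.1).elim⟩
        filter_upwards [hΩ.isOpen_compl.mem_nhds hzΩ] with w hw
        exact indicator_of_notMem (fun h => hw h.1) _
  have hG : ContDiff ℝ 1 (D.indicator g) := by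
    rw [contDiff_iff_contDiffAt]
    intro z
    rcases hloc z with ⟨h, -⟩ | ⟨h, -⟩
    · exact hg.contDiffAt.congr_of_eventuallyEq h
    · exact contDiffAt_const.congr_of_eventuallyEq h
  have hfd : fderiv ℝ (D.indicator g) = D.indicator (fderiv ℝ g) := by
    funext z
    rcases hloc z with ⟨h, hz⟩ | ⟨h, hz⟩
    · rw [indicator_of_mem hz, Filter.EventuallyEq.fderiv_eq h]
    · have h1 : D.indicator g =ᶠ[𝓝 z] fun _ => 0 := h
      rw [h1.fderiv_eq]
      by_cases hzD : z ∈ D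
      · rw [indicator_of_mem hzD, hz hzD]; simp
      · rw [indicator_of_notMem hzD]; simp
  have h0' : Tendsto (D.indicator g) (cocompact ℂ) (𝓝 0) := by
    refine squeeze_zero_norm (fun z => norm_indicator_le_norm_self g z) ?_
    simpa using h0.norm
  have := integral_fderiv_eq_zero hG h0' (by
    rw [hfd]
    exact hi.norm.mono' (hi.aestronglyMeasurable.indicator hD.measurableSet)
      (.of_forall fun z => norm_indicator_le_norm_self _ z)) v
  rw [hfd] at this
  rw [← integral_indicator hD.measurableSet, ← this]
  congr 1
  funext z
  by_cases hzD : z ∈ D <;> simp [hzD]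

namespace SmoothBoundary

namespace IsTubular

variable {Ω : Set ℂ} {K : SmoothBoundary Ω} {δ₀ : ℝ}

theorem injOn_tube (h : K.IsTubular δ₀) (i : Fin K.k) {a b : ℝ} (ha : 0 ≤ a) (hb : b ≤ δ₀) :
    InjOn (fun x : ℝ × ℝ => (K.loop i).tube x.1 x.2) (Ico 0 (K.loop i).l ×ˢ Ico a b) := by
  rintro ⟨s, t⟩ ⟨hs, ht⟩ ⟨s', t'⟩ ⟨hs', ht'⟩ he
  change s ∈ Ico _ _ at hs
  change t ∈ Ico _ _ at ht
  change s' ∈ Ico _ _ at hs'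
  change t' ∈ Ico _ _ at ht'
  simp only at he
  obtain ⟨-, h1, h2⟩ := h.inj i i s s' t t'
    (by rw [abs_of_nonneg (ha.trans ht.1)]; exact ht.2.trans_le hb)
    (by rw [abs_of_nonneg (ha.trans ht'.1)]; exact ht'.2.trans_le hb) he
  rw [(K.loop i).simple s hs s' hs' h1, h2]

theorem setIntegral_tubes (h : K.IsTubular δ₀) (hΩ : IsClosed Ω) {a b : ℝ} (ha : 0 ≤ a)
    (hb : b ≤ δ₀) {g : ℂ → ℝ} (hg : Integrable g) :
    ∫ z in innerDomain Ω a ∩ Metric.thickening b (frontier Ω), g z =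
      ∑ i, ∫ x in Ico 0 (K.loop i).l ×ˢ Ico a b,
        (K.loop i).jac x.1 x.2 * g ((K.loop i).tube x.1 x.2) := by
  have hm : ∀ i, MeasurableSet (Ico 0 (K.loop i).l ×ˢ Ico a b) := fun i =>
    measurableSet_Ico.prod measurableSet_Ico
  rw [h.innerDomain_inter_thickening hΩ ha hb, integral_iUnion_fintype
    (fun i => ((K.loop i).integral_tube_image g (hm i) (h.injOn_tube i ha hb)).1)]
  · refine Finset.sum_congr rfl fun i _ => ?_
    rw [((K.loop i).integral_tube_image g (hm i) (h.injOn_tube i ha hb)).2]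
    refine setIntegral_congr_fun (hm i) fun x hx => ?_
    have := h.jac i x.1 x.2 (by
      rw [abs_of_nonneg (ha.trans hx.2.1)]; exact hx.2.2.trans_le hb)
    rw [abs_of_pos (by unfold ArcLoop.jac; linarith)]
  · intro i j hij
    rw [Function.onFun, Set.disjoint_left]
    rintro _ ⟨⟨s, t⟩, ⟨hs, ht⟩, rfl⟩ ⟨⟨s', t'⟩, ⟨hs', ht'⟩, he⟩
    simp only at hs ht hs' ht' he
    exact hij (h.inj i j s s' t t'
      (by rw [abs_of_nonneg (ha.trans ht.1)]; exact ht.2.trans_le hb)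
      (by rw [abs_of_nonneg (ha.trans ht'.1)]; exact ht'.2.trans_le hb) he.symm).1
  · exact fun i => hg.integrableOn

/-- **Green's formula** on the domains bounded by the parallel curves. -/
theorem green (h : K.IsTubular δ₀) (hΩ : IsClosed Ω) {δ : ℝ} (hδ : 0 ≤ δ) (hδ' : δ < δ₀)
    {f : ℂ → ℝ} (hf : ContDiff ℝ 1 f) (h0 : Tendsto f (cocompact ℂ) (𝓝 0))
    (hi : Integrable (fderiv ℝ f)) (v : ℂ) :
    ∫ z in innerDomain Ω δ, fderiv ℝ f z v =
      -∑ i, ∫ s in 0..(K.loop i).l, (K.loop i).jac s δ * f ((K.loop i).tube s δ) *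
        (K.loop i).nc v s := by
  obtain ⟨a, ha, ha'⟩ := exists_between hδ'
  obtain ⟨b₁, hb₁, hb₁'⟩ := exists_between ha'
  obtain ⟨b, hb, hb'⟩ := exists_between hb₁'
  have ha0 : 0 < a := hδ.trans_lt ha
  obtain ⟨χ, hχ, hχ1, hχ0, hχb⟩ := exists_contDiff_cutoff
    (A := Metric.cthickening a (frontier Ω)) (B := (Metric.thickening b₁ (frontier Ω))ᶜ)
    Metric.isClosed_cthickening Metric.isOpen_thickening.isClosed_compl
    (by
      rw [disjoint_compl_right_iff_subset]
      exact Metric.cthickening_subset_thickening' (ha0.trans hb₁) hb₁ _)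
  have hχ' : ContDiff ℝ 1 χ := hχ.of_le (by simp)
  set F : ℂ → ℝ := fun z => χ z * f z
  have hF : ContDiff ℝ 1 F := hχ'.mul hf
  have hF0 : ∀ z, z ∉ Metric.thickening b₁ (frontier Ω) → F z = 0 := fun z hz => by
    simp [F, hχ0 z hz]
  have hFs : HasCompactSupport F :=
    HasCompactSupport.intro (K.isCompact_frontier.cthickening (r := b₁)) fun z hz =>
      hF0 z fun hz' => hz (Metric.thickening_subset_cthickening _ _ hz')
  have hFi : Integrable (fderiv ℝ F) :=
    (hF.continuous_fderiv (by simp)).integrable_of_hasCompactSupport (hFs.fderiv ℝ)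
  have hFdz : ∀ z, z ∉ Metric.thickening b (frontier Ω) → fderiv ℝ F z = 0 := fun z hz => by
    have : F =ᶠ[𝓝 z] fun _ => 0 := by
      have hz' : z ∈ (Metric.cthickening b₁ (frontier Ω))ᶜ := fun h' =>
        hz (Metric.cthickening_subset_thickening' ((ha0.trans hb₁).trans hb) hb _ h')
      filter_upwards [Metric.isClosed_cthickening.isOpen_compl.mem_nhds hz'] with w hw
      exact hF0 w fun h' => hw (Metric.thickening_subset_cthickening _ _ h')
    rw [this.fderiv_eq]; simp
  set g : ℂ → ℝ := fun z => f z - F z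
  have hg : ContDiff ℝ 1 g := hf.sub hF
  have hgd : ∀ z, fderiv ℝ g z = fderiv ℝ f z - fderiv ℝ F z := fun z =>
    fderiv_fun_sub (hf.differentiable (by simp) z) (hF.differentiable (by simp) z)
  have hgi : Integrable (fderiv ℝ g) := by
    rw [show fderiv ℝ g = fun z => fderiv ℝ f z - fderiv ℝ F z from funext hgd]
    exact hi.sub hFi
  have hg00 : Tendsto g (cocompact ℂ) (𝓝 0) := by
    have h1 : Tendsto F (cocompact ℂ) (𝓝 0) := by
      have hc := hFs.isCompact.compl_mem_cocompact
      exact tendsto_const_nhds.congr' (by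
        filter_upwards [hc] with z hz
        exact (image_eq_zero_of_notMem_tsupport hz).symm)
    simpa using h0.sub h1
  have hz := setIntegral_innerDomain_fderiv_eq_zero hΩ ha ha0 hg (fun z hz => by
    simp [g, F, hχ1 z (Metric.thickening_subset_cthickening _ _ hz)]) hg00 hgi v
  have hFv : Integrable fun z => fderiv ℝ F z v := hFi.apply_continuousLinearMap v
  have e1 : ∫ z in innerDomain Ω δ, fderiv ℝ f z v = ∫ z in innerDomain Ω δ, fderiv ℝ F z v := by
    rw [← sub_eq_zero, ← hz, ← integral_sub (hi.apply_continuousLinearMap v).integrableOn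
      hFv.integrableOn]
    congr 1
    funext z
    rw [hgd]; simp
  have hDm := (isClosed_innerDomain hΩ δ).measurableSet
  have e2 : ∫ z in innerDomain Ω δ, fderiv ℝ F z v =
      ∫ z in innerDomain Ω δ ∩ Metric.thickening b (frontier Ω), fderiv ℝ F z v := by
    refine setIntegral_eq_of_subset_of_forall_sdiff_eq_zero hDm inter_subset_left fun z hz => ?_
    rw [hFdz z fun h' => hz.2 ⟨hz.1, h'⟩]; simp
  rw [e1, e2, h.setIntegral_tubes hΩ hδ hb'.le hFv, ← Finset.sum_neg_distrib]
  refine Finset.sum_congr rfl fun i _ => ?_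
  have hbδ : δ ≤ b := ((ha.trans hb₁).trans hb).le
  rw [(K.loop i).integral_jac_mul_fderiv hF v hbδ, ← intervalIntegral.integral_neg]
  congr 1
  funext s
  have h1 : F ((K.loop i).tube s b) = 0 := by
    refine hF0 _ fun h' => ?_
    obtain ⟨p, hp, hlt⟩ := Metric.mem_thickening_iff.1 h'
    have hb0 : |b| = b := abs_of_nonneg (hδ.trans hbδ)
    have := h.le_dist i s (hb0.trans_lt hb') hp
    rw [hb0] at this
    linarith
  have h2 : F ((K.loop i).tube s δ) = f ((K.loop i).tube s δ) := by
    have : (K.loop i).tube s δ ∈ Metric.cthickening a (frontier Ω) := by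
      refine Metric.mem_cthickening_of_dist_le _ ((K.loop i).γ s) _ _
        (K.mem_frontier_iff.2 ⟨i, s, rfl⟩) ?_
      rw [dist_eq_norm, ArcLoop.norm_tube_sub, abs_of_nonneg hδ]
      exact ha.le
    simp [F, hχ1 _ this]
  rw [h1, h2]
  ring

end IsTubular

end SmoothBoundary

/-! ### The kernels -/

theorem integrable_norm_rpow_neg_three : Integrable (fun z : ℂ => (1 + ‖z‖) ^ (-3 : ℝ)) :=
  integrable_one_add_norm (by norm_num [Complex.finrank_real_complex])

/-- Removing the singularity of a function with integrable gradient at infinity. -/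
theorem exists_regularization {f : ℂ → ℝ} {w : ℂ} {ρ C : ℝ} (hρ : 0 < ρ)
    (hf : ContDiffOn ℝ 1 f {w}ᶜ) (h0 : Tendsto f (cocompact ℂ) (𝓝 0))
    (hC : ∀ z, ρ ≤ ‖z - w‖ → ‖fderiv ℝ f z‖ ≤ C / ‖z - w‖ ^ 3) :
    ∃ F : ℂ → ℝ, ContDiff ℝ 1 F ∧ Tendsto F (cocompact ℂ) (𝓝 0) ∧ Integrable (fderiv ℝ F) ∧
      ∀ z, ρ ≤ ‖z - w‖ → F z = f z ∧ fderiv ℝ F z = fderiv ℝ f z := by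
  obtain ⟨χ, hχ, hχ1, hχ0, hχb⟩ := exists_contDiff_cutoff (A := (Metric.ball w (ρ / 2))ᶜ)
    (B := Metric.closedBall w (ρ / 3)) Metric.isOpen_ball.isClosed_compl
    Metric.isClosed_closedBall (by
      rw [disjoint_compl_left_iff_subset]
      exact Metric.closedBall_subset_ball (by linarith))
  have hχ' : ContDiff ℝ 1 χ := hχ.of_le (by simp)
  have hev : ∀ z, ρ ≤ ‖z - w‖ → (fun z => χ z * f z) =ᶠ[𝓝 z] f := fun z hz => by
    have : z ∈ (Metric.closedBall w (ρ / 2))ᶜ := by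
      simp only [mem_compl_iff, Metric.mem_closedBall, dist_eq_norm]; linarith
    filter_upwards [Metric.isClosed_closedBall.isOpen_compl.mem_nhds this] with y hy
    rw [hχ1 y fun h => hy (Metric.ball_subset_closedBall h), one_mul]
  have hF : ContDiff ℝ 1 (fun z => χ z * f z) := by
    rw [contDiff_iff_contDiffAt]
    intro z
    by_cases hz : z = w
    · have : (fun z => χ z * f z) =ᶠ[𝓝 z] fun _ => 0 := by
        filter_upwards [Metric.closedBall_mem_nhds z (by positivity : 0 < ρ / 3)] with y hy
        rw [hχ0 y (hz ▸ hy), zero_mul]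
      exact contDiffAt_const.congr_of_eventuallyEq this
    · exact hχ'.contDiffAt.mul (hf.contDiffAt (isOpen_compl_singleton.mem_nhds hz))
  refine ⟨fun z => χ z * f z, hF, ?_, ?_, fun z hz => ⟨(hev z hz).self_of_nhds,
    (hev z hz).fderiv_eq⟩⟩
  · refine squeeze_zero_norm (fun z => ?_) (by simpa using h0.norm)
    rw [norm_mul, Real.norm_eq_abs, abs_of_nonneg (hχb z).1]
    exact mul_le_of_le_one_left (norm_nonneg _) (hχb z).2
  · have hcont := hF.continuous_fderiv (by simp)
    obtain ⟨B, hB⟩ := (isCompact_closedBall w ρ).exists_bound_of_continuousOn hcont.continuousOn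
    have hBn : 0 ≤ B := (norm_nonneg _).trans (hB w (by simp [hρ.le]))
    set R := 1 + ‖w‖ + ρ
    have hR : 0 < R := by positivity
    have hCn : 0 ≤ C := by
      have h1 := (norm_nonneg _).trans (hC (w + ρ) (by simp [abs_of_pos hρ]))
      by_contra hn
      have h2 : C / ‖w + ρ - w‖ ^ 3 < 0 := by
        refine div_neg_of_neg_of_pos (not_le.1 hn) ?_
        rw [add_sub_cancel_left, Complex.norm_real, Real.norm_eq_abs, abs_of_pos hρ]
        positivity
      linarith
    refine Integrable.mono' ((integrable_norm_rpow_neg_three.const_mul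
      (B * R ^ 3 + C * (R / ρ) ^ 3))) hcont.aestronglyMeasurable (.of_forall fun z => ?_)
    have hz0 : 0 < 1 + ‖z‖ := by positivity
    have e : (1 + ‖z‖) ^ (-3 : ℝ) = 1 / (1 + ‖z‖) ^ 3 := by
      rw [Real.rpow_neg hz0.le, one_div]; norm_cast
    rw [e]
    have htri : ‖z‖ ≤ ‖z - w‖ + ‖w‖ := by simpa using norm_add_le (z - w) w
    rcases le_total ‖z - w‖ ρ with h | h
    · have h1 := hB z (by simpa [dist_eq_norm] using h)
      refine h1.trans ?_
      rw [mul_one_div, le_div_iff₀ (by positivity)]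
      have : (1 + ‖z‖) ^ 3 ≤ R ^ 3 := by
        gcongr
        simp only [R]; linarith
      have h3 : B * (1 + ‖z‖) ^ 3 ≤ B * R ^ 3 := by gcongr
      have : 0 ≤ C * (R / ρ) ^ 3 := by positivity
      linarith
    · have h1 := hC z h
      rw [← (hev z h).fderiv_eq] at h1
      refine h1.trans ?_
      have hzw : 0 < ‖z - w‖ := hρ.trans_le h
      rw [mul_one_div, div_le_div_iff₀ (by positivity) (by positivity)]
      have h2 : 1 + ‖z‖ ≤ R / ρ * ‖z - w‖ := by
        have : (1 + ‖w‖) ≤ (1 + ‖w‖) / ρ * ‖z - w‖ := by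
          rw [div_mul_eq_mul_div, le_div_iff₀ hρ]
          gcongr
        have e2 : R / ρ * ‖z - w‖ = (1 + ‖w‖) / ρ * ‖z - w‖ + ‖z - w‖ := by
          simp only [R]; field_simp
        linarith
      have h3 : (1 + ‖z‖) ^ 3 ≤ (R / ρ * ‖z - w‖) ^ 3 := by gcongr
      have h4 : C * (1 + ‖z‖) ^ 3 ≤ C * (R / ρ * ‖z - w‖) ^ 3 := by gcongr
      have : 0 ≤ B * R ^ 3 * ‖z - w‖ ^ 3 := by positivity
      calc C * (1 + ‖z‖) ^ 3 ≤ C * (R / ρ * ‖z - w‖) ^ 3 := h4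
        _ ≤ _ := by rw [mul_pow]; linarith

/-- `Re (ā z)`. -/
noncomputable def dotProd (a z : ℂ) : ℝ := ((starRingEnd ℂ) a * z).re

/-- `1 / |z - p|²`. -/
noncomputable def newton (p z : ℂ) : ℝ := (Complex.normSq (z - p))⁻¹

/-- `⟨a, z - w⟩ / |z - w|⁴`. -/
noncomputable def dipole (w a z : ℂ) : ℝ := dotProd a (z - w) * newton w z ^ 2

theorem abs_dotProd_le (a z : ℂ) : |dotProd a z| ≤ ‖a‖ * ‖z‖ := by
  refine (Complex.abs_re_le_norm _).trans ?_
  rw [norm_mul, RCLike.norm_conj]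

theorem newton_eq (p z : ℂ) : newton p z = (‖z - p‖ ^ 2)⁻¹ := by
  rw [newton, Complex.normSq_eq_norm_sq]

/-- `z ↦ ⟨a, z⟩` as a linear map. -/
noncomputable def dotProdCLM (a : ℂ) : ℂ →L[ℝ] ℝ := a.re • Complex.reCLM + a.im • Complex.imCLM

theorem dotProdCLM_apply (a z : ℂ) : dotProdCLM a z = dotProd a z := by
  simp [dotProdCLM, dotProd]

theorem norm_dotProdCLM_le (a : ℂ) : ‖dotProdCLM a‖ ≤ ‖a‖ :=
  ContinuousLinearMap.opNorm_le_bound _ (norm_nonneg _) fun z => by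
    rw [dotProdCLM_apply, Real.norm_eq_abs]; exact abs_dotProd_le a z

theorem hasFDerivAt_normSq (p z : ℂ) :
    HasFDerivAt (fun z => Complex.normSq (z - p)) ((2 : ℝ) • dotProdCLM (z - p)) z := by
  have h1 : HasFDerivAt (fun z : ℂ => (z - p).re) Complex.reCLM z := by
    simpa using Complex.reCLM.hasFDerivAt.sub_const p.re
  have h2 : HasFDerivAt (fun z : ℂ => (z - p).im) Complex.imCLM z := by
    simpa using Complex.imCLM.hasFDerivAt.sub_const p.im
  have := (h1.mul h1).add (h2.mul h2)
  convert! this using 1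
  ext
  simp [dotProdCLM]; ring

theorem hasFDerivAt_newton {p z : ℂ} (h : z ≠ p) :
    HasFDerivAt (newton p) ((-2 * newton p z ^ 2) • dotProdCLM (z - p)) z := by
  have hne : Complex.normSq (z - p) ≠ 0 := by
    simpa [Complex.normSq_eq_zero, sub_eq_zero] using h
  have := (hasDerivAt_inv hne).comp_hasFDerivAt z (hasFDerivAt_normSq p z)
  convert! this using 1
  rw [smul_smul]
  congr 1
  rw [newton, inv_pow]
  ring

theorem hasFDerivAt_dipole {w a z : ℂ} (h : z ≠ w) :
    HasFDerivAt (dipole w a) (newton w z ^ 2 • dotProdCLM a -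
      (4 * dotProd a (z - w) * newton w z ^ 3) • dotProdCLM (z - w)) z := by
  have h1 : HasFDerivAt (fun z => dotProd a (z - w)) (dotProdCLM a) z := by
    have := (dotProdCLM a).hasFDerivAt.comp z ((hasFDerivAt_id z).sub_const w)
    convert! this using 1
    funext y; simp [dotProdCLM_apply]
  have h2 := h1.mul ((hasFDerivAt_newton h).pow 2)
  convert! h2 using 1
  ext
  simp [dotProdCLM, dotProd]; ring

theorem contDiffOn_newton (p : ℂ) : ContDiffOn ℝ ∞ (newton p) {p}ᶜ := by
  unfold newton
  have : (fun z : ℂ => Complex.normSq (z - p)) =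
      fun z => (Complex.reCLM z - p.re) ^ 2 + (Complex.imCLM z - p.im) ^ 2 := by
    funext z; simp [Complex.normSq_apply, sq]
  refine ContDiffOn.inv ?_ fun z hz => ?_
  · rw [this]; fun_prop
  · simpa [Complex.normSq_eq_zero, sub_eq_zero] using hz

theorem contDiffOn_dipole (w a : ℂ) : ContDiffOn ℝ ∞ (dipole w a) {w}ᶜ := by
  unfold dipole
  have : (fun z : ℂ => dotProd a (z - w)) = fun z => dotProdCLM a (z - w) := by
    funext z; rw [dotProdCLM_apply]
  refine ContDiffOn.mul ?_ ((contDiffOn_newton w).pow 2)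
  rw [this]; fun_prop

theorem tendsto_norm_sub_cocompact (p : ℂ) :
    Tendsto (fun z => ‖z - p‖) (cocompact ℂ) atTop := by
  have : Tendsto (fun z => z - p) (cocompact ℂ) (cocompact ℂ) :=
    (Homeomorph.subRight p).isClosedEmbedding.tendsto_cocompact
  exact (tendsto_norm_cocompact_atTop (E := ℂ)).comp this

theorem tendsto_newton (p : ℂ) : Tendsto (newton p) (cocompact ℂ) (𝓝 0) := by
  have h := tendsto_inv_atTop_zero.comp
    ((tendsto_pow_atTop (two_ne_zero)).comp (tendsto_norm_sub_cocompact p))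
  refine h.congr fun z => ?_
  simp [newton_eq]

theorem tendsto_dipole (w a : ℂ) : Tendsto (dipole w a) (cocompact ℂ) (𝓝 0) := by
  have h := ((tendsto_inv_atTop_zero.comp
    ((tendsto_pow_atTop (three_ne_zero)).comp (tendsto_norm_sub_cocompact w))).const_mul ‖a‖)
  rw [mul_zero] at h
  refine squeeze_zero_norm (fun z => ?_) h
  rw [dipole, newton_eq, norm_mul, Real.norm_eq_abs, Real.norm_eq_abs]
  by_cases hz : ‖z - w‖ = 0
  · simp [hz]
  refine (mul_le_mul_of_nonneg_right (abs_dotProd_le _ _) (abs_nonneg _)).trans (le_of_eq ?_)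
  rw [abs_of_nonneg (by positivity)]
  simp only [Function.comp]
  field_simp

theorem norm_fderiv_newton_le {p z : ℂ} (h : z ≠ p) :
    ‖fderiv ℝ (newton p) z‖ ≤ 2 / ‖z - p‖ ^ 3 := by
  have hz : 0 < ‖z - p‖ := norm_pos_iff.2 (sub_ne_zero.2 h)
  rw [(hasFDerivAt_newton h).fderiv, norm_smul, newton_eq]
  refine (mul_le_mul_of_nonneg_left (norm_dotProdCLM_le _) (norm_nonneg _)).trans (le_of_eq ?_)
  rw [norm_mul, norm_neg, Real.norm_eq_abs, Real.norm_eq_abs, abs_of_nonneg (by positivity)]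
  rw [abs_of_nonneg (by positivity)]
  field_simp

theorem norm_fderiv_dipole_le {w a z : ℂ} (h : z ≠ w) :
    ‖fderiv ℝ (dipole w a) z‖ ≤ 5 * ‖a‖ / ‖z - w‖ ^ 4 := by
  have hz : 0 < ‖z - w‖ := norm_pos_iff.2 (sub_ne_zero.2 h)
  rw [(hasFDerivAt_dipole h).fderiv]
  refine (norm_sub_le _ _).trans ?_
  rw [norm_smul, norm_smul, newton_eq]
  have h1 : ‖((‖z - w‖ ^ 2)⁻¹ : ℝ) ^ 2‖ * ‖dotProdCLM a‖ ≤ ‖a‖ / ‖z - w‖ ^ 4 := by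
    refine (mul_le_mul_of_nonneg_left (norm_dotProdCLM_le _) (norm_nonneg _)).trans (le_of_eq ?_)
    rw [Real.norm_eq_abs, abs_of_nonneg (by positivity)]
    field_simp
  have h2 : ‖4 * dotProd a (z - w) * ((‖z - w‖ ^ 2)⁻¹ : ℝ) ^ 3‖ * ‖dotProdCLM (z - w)‖ ≤
      4 * ‖a‖ / ‖z - w‖ ^ 4 := by
    refine (mul_le_mul_of_nonneg_left (norm_dotProdCLM_le _) (norm_nonneg _)).trans ?_
    rw [norm_mul, norm_mul, Real.norm_eq_abs, Real.norm_eq_abs, Real.norm_eq_abs,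
      abs_of_nonneg (by positivity : (0 : ℝ) ≤ 4),
      abs_of_nonneg (by positivity : (0 : ℝ) ≤ ((‖z - w‖ ^ 2)⁻¹ : ℝ) ^ 3)]
    have := abs_dotProd_le a (z - w)
    calc 4 * |dotProd a (z - w)| * ((‖z - w‖ ^ 2)⁻¹ : ℝ) ^ 3 * ‖z - w‖
        ≤ 4 * (‖a‖ * ‖z - w‖) * ((‖z - w‖ ^ 2)⁻¹ : ℝ) ^ 3 * ‖z - w‖ := by gcongr
      _ = _ := by field_simp
  calc _ ≤ ‖a‖ / ‖z - w‖ ^ 4 + 4 * ‖a‖ / ‖z - w‖ ^ 4 := add_le_add h1 h2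
    _ = _ := by ring

/-- The vector field with components `dipole w 1`, `dipole w I` has divergence `-2 / |z - w|⁴`. -/
theorem fderiv_dipole_add {w z : ℂ} (h : z ≠ w) :
    fderiv ℝ (dipole w 1) z 1 + fderiv ℝ (dipole w Complex.I) z Complex.I =
      -2 * (1 / ‖z - w‖ ^ 4) := by
  have hz : ‖z - w‖ ≠ 0 := norm_ne_zero_iff.2 (sub_ne_zero.2 h)
  rw [(hasFDerivAt_dipole h).fderiv, (hasFDerivAt_dipole h).fderiv, newton_eq]
  have hn : (z - w).re * (z - w).re + (z - w).im * (z - w).im = ‖z - w‖ ^ 2 := by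
    rw [← Complex.normSq_eq_norm_sq, Complex.normSq_apply]
  simp only [_root_.sub_apply, _root_.smul_apply, dotProdCLM_apply, dotProd,
    smul_eq_mul, map_one, one_mul, mul_one, Complex.conj_I, Complex.one_re, Complex.mul_re,
    Complex.neg_re, Complex.neg_im, Complex.I_re, Complex.I_im, Complex.conj_re, Complex.conj_im]
  field_simp
  linear_combination (-4) * hn

theorem integral_norm_pow_four (w : ℂ) {ε : ℝ} (hε : 0 < ε) :
    IntegrableOn (fun z => 1 / ‖z - w‖ ^ 4) (Metric.ball w ε)ᶜ ∧
      ∫ z in (Metric.ball w ε)ᶜ, 1 / ‖z - w‖ ^ 4 = Real.pi / ε ^ 2 := by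
  set φ : ℝ → ℝ := (Ici ε).indicator fun r => 1 / r ^ 4
  have hind : (Metric.ball w ε)ᶜ.indicator (fun z => 1 / ‖z - w‖ ^ 4) =
      fun z => φ ‖z - w‖ := by
    funext z
    by_cases hz : ε ≤ ‖z - w‖
    · rw [indicator_of_mem (by simpa [dist_eq_norm] using hz)]
      simp only [φ]
      rw [indicator_of_mem (by exact hz)]
    · rw [indicator_of_notMem (by simpa [dist_eq_norm] using hz)]
      simp only [φ]
      rw [indicator_of_notMem (by exact hz)]
  have hm : MeasurableSet (Metric.ball w ε)ᶜ := Metric.isOpen_ball.measurableSet.compl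
  have hrad : ∀ y ∈ Ioi (0 : ℝ), y ^ (Module.finrank ℝ ℂ - 1) • φ y =
      (Ici ε).indicator (fun y => y ^ (-3 : ℝ)) y := by
    intro y hy
    have hy0 : (0 : ℝ) < y := hy
    rw [Complex.finrank_real_complex]
    by_cases h : y ∈ Ici ε
    · simp only [φ, indicator_of_mem h, smul_eq_mul]
      rw [Real.rpow_neg hy0.le]
      norm_cast
      field_simp
      simp
    · simp only [φ, indicator_of_notMem h, smul_zero]
  have hii : IntegrableOn (fun y : ℝ => y ^ (-3 : ℝ)) (Ici ε) :=
    (integrableOn_Ici_iff_integrableOn_Ioi (by finiteness)).2 (integrableOn_Ioi_rpow_of_lt (by norm_num) hε)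
  have hval : ∫ y in Ici ε, y ^ (-3 : ℝ) = 1 / (2 * ε ^ 2) := by
    rw [integral_Ici_eq_integral_Ioi, integral_Ioi_rpow_of_lt (by norm_num) hε]
    rw [show (-3 : ℝ) + 1 = -(2 : ℕ) by norm_num, Real.rpow_neg hε.le, Real.rpow_natCast]
    push_cast
    field_simp
  have hInt : Integrable fun z : ℂ => φ ‖z‖ := by
    rw [integrable_fun_norm_addHaar volume]
    refine (IntegrableOn.congr_fun ?_ (fun y hy => (hrad y hy).symm) measurableSet_Ioi)
    exact ((integrable_indicator_iff measurableSet_Ici).2 hii).integrableOn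
  constructor
  · rw [← integrable_indicator_iff hm, hind]
    exact hInt.comp_sub_right w
  · rw [← integral_indicator hm, hind, integral_sub_right_eq_self (fun z : ℂ => φ ‖z‖) w,
      integral_fun_norm_addHaar volume, setIntegral_congr_fun measurableSet_Ioi hrad,
      setIntegral_indicator measurableSet_Ici,
      inter_eq_right.2 (Ici_subset_Ioi.2 hε), hval, Complex.finrank_real_complex,
      Measure.real, Complex.volume_ball]
    simp
    field_simp

/-! ### The potential and the truncated energy as boundary integrals -/

theorem renormalizedPotential_eq {Ω : Set ℂ} (hΩ : IsClosed Ω) {w : ℂ} (hw : w ∈ interior Ω) :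
    IntegrableOn (fun z => 1 / ‖z - w‖ ^ 4) Ωᶜ ∧
    Tendsto (truncatedPotential Ω w) (𝓝[>] 0) (𝓝 (renormalizedPotential Ω w)) ∧
      renormalizedPotential Ω w = -∫ z in Ωᶜ, 1 / ‖z - w‖ ^ 4 := by
  obtain ⟨ρ, hρ, hball⟩ := Metric.mem_nhds_iff.1 (isOpen_interior.mem_nhds hw)
  have hsub : ∀ {ε}, ε ≤ ρ → Ωᶜ ⊆ (Metric.ball w ε)ᶜ := fun hε => compl_subset_compl.2
    ((Metric.ball_subset_ball hε).trans (hball.trans interior_subset))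
  have hint : IntegrableOn (fun z => 1 / ‖z - w‖ ^ 4) Ωᶜ :=
    (integral_norm_pow_four w hρ).1.mono_set (hsub le_rfl)
  have hev : ∀ᶠ ε in 𝓝[>] (0 : ℝ),
      truncatedPotential Ω w ε = -∫ z in Ωᶜ, 1 / ‖z - w‖ ^ 4 := by
    filter_upwards [Ioo_mem_nhdsGT hρ] with ε hε
    have h1 := integral_norm_pow_four w hε.1
    have hu : Ω \ Metric.ball w ε ∪ Ωᶜ = (Metric.ball w ε)ᶜ := by
      ext z
      have := @hsub ε hε.2.le z
      simp only [mem_union, Set.mem_sdiff, mem_compl_iff] at this ⊢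
      tauto
    have h2 := setIntegral_union (μ := volume) (f := fun z => 1 / ‖z - w‖ ^ 4)
      (disjoint_compl_right.mono_left sdiff_subset : Disjoint (Ω \ Metric.ball w ε) Ωᶜ)
      hΩ.measurableSet.compl
      (h1.1.mono_set fun z hz => hz.2) hint
    rw [hu, h1.2] at h2
    rw [truncatedPotential, h2]
    ring
  have ht : Tendsto (truncatedPotential Ω w) (𝓝[>] 0) (𝓝 (-∫ z in Ωᶜ, 1 / ‖z - w‖ ^ 4)) :=
    tendsto_const_nhds.congr' (hev.mono fun _ h => h.symm)
  have he := ht.limUnder_eq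
  refine ⟨hint, ?_, he⟩
  rw [renormalizedPotential, he]
  exact ht

theorem innerDomain_subset_interior {Ω : Set ℂ} {δ : ℝ} (hδ : 0 < δ) :
    innerDomain Ω δ ⊆ interior Ω := by
  intro w hw
  by_contra hn
  have := hw.2 w ⟨subset_closure hw.1, hn⟩
  rw [dist_self] at this
  linarith

namespace ArcLoop

variable (c : ArcLoop)

/-- The left unit normal. -/
noncomputable def N (s : ℝ) : ℂ := Complex.I * c.T s

theorem norm_N (s : ℝ) : ‖c.N s‖ = 1 := by simp [N, c.norm_T]

theorem nc_eq (v : ℂ) (s : ℝ) : c.nc v s = dotProd v (c.N s) := rfl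

theorem interval_eq (f : ℝ → ℝ) : ∫ s in 0..c.l, f s = ∫ s in Ioc 0 c.l, f s :=
  intervalIntegral.integral_of_le c.l_pos.le

end ArcLoop

namespace SmoothBoundary

variable {Ω : Set ℂ} {K : SmoothBoundary Ω} {δ₀ : ℝ}

theorem IsTubular.green_compl (h : K.IsTubular δ₀) (hΩ : IsClosed Ω) {w : ℂ}
    (hw : w ∈ interior Ω) {f : ℂ → ℝ} (hf : ContDiffOn ℝ 1 f {w}ᶜ)
    (h0 : Tendsto f (cocompact ℂ) (𝓝 0)) {C : ℝ}
    (hC : ∀ z, z ≠ w → ‖fderiv ℝ f z‖ ≤ C / ‖z - w‖ ^ 4) (v : ℂ) :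
    IntegrableOn (fun z => fderiv ℝ f z v) Ωᶜ ∧ ∫ z in Ωᶜ, fderiv ℝ f z v =
      ∑ i, ∫ s in 0..(K.loop i).l, f ((K.loop i).γ s) * (K.loop i).nc v s := by
  obtain ⟨ρ, hρ, hball⟩ := Metric.mem_nhds_iff.1 (isOpen_interior.mem_nhds hw)
  have hfar : ∀ z, z ∉ interior Ω → ρ ≤ ‖z - w‖ := fun z hz => by
    by_contra hn
    exact hz (hball (by simpa [dist_eq_norm] using hn))
  obtain ⟨F, hF, hF0, hFi, hFe⟩ := exists_regularization (C := C / ρ) hρ hf h0 (fun z hz => by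
    have hzw : 0 < ‖z - w‖ := hρ.trans_le hz
    have hne : z ≠ w := sub_ne_zero.1 (norm_pos_iff.1 hzw)
    refine (hC z hne).trans ?_
    have hCn : 0 ≤ C := by
      have h1 := (norm_nonneg _).trans (hC z hne)
      by_contra hn
      have : C / ‖z - w‖ ^ 4 < 0 := div_neg_of_neg_of_pos (not_le.1 hn) (by positivity)
      linarith
    rw [div_div]
    refine div_le_div_of_nonneg_left hCn (by positivity) ?_
    rw [pow_succ' _ 3]
    gcongr)
  have hm := hΩ.measurableSet
  have hFv := hFi.apply_continuousLinearMap v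
  have hcongr : EqOn (fun z => fderiv ℝ F z v) (fun z => fderiv ℝ f z v) Ωᶜ := fun z hz => by
    simp only
    rw [(hFe z (hfar z fun h' => hz (interior_subset h'))).2]
  refine ⟨hFv.integrableOn.congr_fun hcongr hm.compl, ?_⟩
  rw [← setIntegral_congr_fun hm.compl hcongr]
  have h1 := h.green hΩ le_rfl h.pos hF hF0 hFi v
  have h2 := integral_add_compl hm hFv
  rw [innerDomain_zero] at h1
  rw [integral_fderiv_eq_zero hF hF0 hFi v, h1] at h2
  have h3 : ∫ z in Ωᶜ, fderiv ℝ F z v = ∑ i, ∫ s in 0..(K.loop i).l,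
      (K.loop i).jac s 0 * F ((K.loop i).tube s 0) * (K.loop i).nc v s := by linarith
  rw [h3]
  refine Finset.sum_congr rfl fun i _ => ?_
  congr 1
  funext s
  rw [ArcLoop.tube_zero, (hFe _ (hfar _ (K.mem_frontier_iff.2 ⟨i, s, rfl⟩).2)).1, ArcLoop.jac]
  ring

theorem IsTubular.renormalizedPotential_eq_sum (h : K.IsTubular δ₀) (hΩ : IsClosed Ω) {w : ℂ}
    (hw : w ∈ interior Ω) : renormalizedPotential Ω w =
      1 / 4 * ∑ i, ∫ s in 0..(K.loop i).l,
        fderiv ℝ (newton ((K.loop i).γ s)) w ((K.loop i).N s) := by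
  have hd := fun a => h.green_compl hΩ hw ((contDiffOn_dipole w a).of_le (by simp))
    (tendsto_dipole w a) (fun z hz => norm_fderiv_dipole_le hz) a
  have hne : ∀ z ∈ Ωᶜ, z ≠ w := fun z hz he => hz (he ▸ interior_subset hw)
  rw [(renormalizedPotential_eq hΩ hw).2.2]
  have h1 : ∫ z in Ωᶜ, 1 / ‖z - w‖ ^ 4 = -(1 / 2) * ∫ z in Ωᶜ,
      (fderiv ℝ (dipole w 1) z 1 + fderiv ℝ (dipole w Complex.I) z Complex.I) := by
    rw [← integral_const_mul]
    refine setIntegral_congr_fun hΩ.measurableSet.compl fun z hz => ?_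
    rw [fderiv_dipole_add (hne z hz)]
    ring
  rw [h1, integral_add (hd 1).1 (hd Complex.I).1, (hd 1).2, (hd Complex.I).2,
    ← Finset.sum_add_distrib, ← neg_mul, neg_neg, Finset.mul_sum, Finset.mul_sum]
  refine Finset.sum_congr rfl fun i _ => ?_
  have hnf : ∀ s, (K.loop i).γ s ≠ w := fun s he =>
    (K.mem_frontier_iff.2 ⟨i, s, he⟩).2 hw
  have hcont : ∀ a, Continuous fun s => dipole w a ((K.loop i).γ s) * (K.loop i).nc a s :=
    fun a => by
      have h2 : Continuous fun s => dipole w a ((K.loop i).γ s) :=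
        (contDiffOn_dipole w a).continuousOn.comp_continuous (K.loop i).continuous_γ
          (fun s => hnf s)
      exact h2.mul ((K.loop i).continuous_nc a)
  rw [← intervalIntegral.integral_add ((hcont 1).intervalIntegrable _ _)
    ((hcont Complex.I).intervalIntegrable _ _), ← intervalIntegral.integral_const_mul,
    ← intervalIntegral.integral_const_mul]
  congr 1
  funext s
  rw [(hasFDerivAt_newton (hnf s).symm).fderiv]
  have hsymm : newton ((K.loop i).γ s) w = newton w ((K.loop i).γ s) := by
    rw [newton_eq, newton_eq, norm_sub_rev]
  rw [hsymm]
  simp only [dipole, ArcLoop.nc_eq, _root_.smul_apply, dotProdCLM_apply, dotProd, smul_eq_mul]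
  simp
  ring

/-- The kernel `(s, w) ↦ ∇ |w - γ s|⁻² · N` is integrable away from the boundary. -/
theorem integrable_kernel (K : SmoothBoundary Ω) (hΩ : IsClosed Ω) {δ : ℝ} (hδ : 0 < δ)
    (i : Fin K.k) : Integrable (fun x : ℝ × ℂ =>
      fderiv ℝ (newton ((K.loop i).γ x.1)) x.2 ((K.loop i).N x.1))
      ((volume.restrict (Ioc 0 (K.loop i).l)).prod (volume.restrict (innerDomain Ω δ))) := by
  set c := K.loop i
  have hD := isClosed_innerDomain hΩ δ
  have hdist : ∀ s, ∀ w ∈ innerDomain Ω δ, δ ≤ ‖w - c.γ s‖ := fun s w hw => by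
    rw [← dist_eq_norm]; exact hw.2 _ (K.mem_frontier_iff.2 ⟨i, s, rfl⟩)
  have hne : ∀ s, ∀ w ∈ innerDomain Ω δ, w ≠ c.γ s := fun s w hw =>
    sub_ne_zero.1 (norm_pos_iff.1 (hδ.trans_le (hdist s w hw)))
  obtain ⟨R, hR, hγ⟩ := exists_norm_le_of_periodic c.l_ne c.periodic c.continuous_γ
  have hm : MeasurableSet (Ioc 0 c.l ×ˢ innerDomain Ω δ) :=
    measurableSet_Ioc.prod hD.measurableSet
  rw [Measure.prod_restrict]
  have hcont : ContinuousOn (fun x : ℝ × ℂ => fderiv ℝ (newton (c.γ x.1)) x.2 (c.N x.1))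
      (Ioc 0 c.l ×ˢ innerDomain Ω δ) := by
    have h1 : ContinuousOn (fun x : ℝ × ℂ => -2 * ((Complex.normSq (x.2 - c.γ x.1))⁻¹) ^ 2 *
        ((starRingEnd ℂ) (x.2 - c.γ x.1) * c.N x.1).re) (Ioc 0 c.l ×ˢ innerDomain Ω δ) := by
      have := c.continuous_γ
      have := c.continuous_T
      refine ContinuousOn.mul (continuousOn_const.mul (ContinuousOn.pow
        (ContinuousOn.inv₀ (by fun_prop) fun x hx => ?_) 2))
        (Continuous.continuousOn (by unfold ArcLoop.N; fun_prop))
      simpa [Complex.normSq_eq_zero, sub_eq_zero] using hne x.1 x.2 hx.2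
    refine h1.congr fun x hx => ?_
    simp only
    rw [(hasFDerivAt_newton (hne x.1 x.2 hx.2)).fderiv, _root_.smul_apply, dotProdCLM_apply]
    rfl
  set A := (1 + R) / δ + 1
  have hA : 0 < A := by positivity
  have hg : Integrable (fun x : ℝ × ℂ => (1 : ℝ) * (2 * A ^ 3 * (1 + ‖x.2‖) ^ (-3 : ℝ)))
      ((volume.restrict (Ioc 0 c.l)).prod (volume.restrict (innerDomain Ω δ))) :=
    Integrable.mul_prod (f := fun _ : ℝ => (1 : ℝ))
      (g := fun w : ℂ => 2 * A ^ 3 * (1 + ‖w‖) ^ (-3 : ℝ))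
      (integrable_const _) ((integrable_norm_rpow_neg_three.const_mul _).integrableOn)
  rw [Measure.prod_restrict] at hg
  refine Integrable.mono' hg (hcont.aestronglyMeasurable hm) ?_
  filter_upwards [ae_restrict_mem hm] with x hx
  have hz0 : 0 < 1 + ‖x.2‖ := by positivity
  have e : (1 + ‖x.2‖) ^ (-3 : ℝ) = 1 / (1 + ‖x.2‖) ^ 3 := by
    rw [Real.rpow_neg hz0.le, one_div]; norm_cast
  have hd := hdist x.1 x.2 hx.2
  have hd0 := hδ.trans_le hd
  have h1 : ‖fderiv ℝ (newton (c.γ x.1)) x.2 (c.N x.1)‖ ≤ 2 / ‖x.2 - c.γ x.1‖ ^ 3 := by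
    refine ((fderiv ℝ (newton (c.γ x.1)) x.2).le_opNorm _).trans ?_
    rw [c.norm_N, mul_one]
    exact norm_fderiv_newton_le (hne x.1 x.2 hx.2)
  refine h1.trans ?_
  rw [e, one_mul, mul_one_div, div_le_div_iff₀ (by positivity) (by positivity), mul_assoc,
    ← mul_pow]
  gcongr
  have htri : ‖x.2‖ ≤ ‖x.2 - c.γ x.1‖ + ‖c.γ x.1‖ := by
    simpa using norm_add_le (x.2 - c.γ x.1) (c.γ x.1)
  have h2 : 1 + R ≤ (1 + R) / δ * ‖x.2 - c.γ x.1‖ := by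
    rw [div_mul_eq_mul_div, le_div_iff₀ hδ]
    gcongr
  have := hγ x.1
  simp only [A]
  linarith

theorem IsTubular.integrableOn_renormalizedPotential (h : K.IsTubular δ₀) (hΩ : IsClosed Ω)
    {δ : ℝ} (hδ : 0 < δ) : IntegrableOn (renormalizedPotential Ω) (innerDomain Ω δ) ∧
      ∫ w in innerDomain Ω δ, renormalizedPotential Ω w =
        1 / 4 * ∑ i, ∫ s in 0..(K.loop i).l, ∫ w in innerDomain Ω δ,
          fderiv ℝ (newton ((K.loop i).γ s)) w ((K.loop i).N s) := by
  have hm := (isClosed_innerDomain hΩ δ).measurableSet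
  have hk := fun i => K.integrable_kernel hΩ hδ i
  have he : EqOn (renormalizedPotential Ω) (fun w => 1 / 4 * ∑ i,
      ∫ s in Ioc 0 (K.loop i).l, fderiv ℝ (newton ((K.loop i).γ s)) w ((K.loop i).N s))
      (innerDomain Ω δ) := fun w hw => by
    rw [h.renormalizedPotential_eq_sum hΩ (innerDomain_subset_interior hδ hw)]
    simp only [ArcLoop.interval_eq]
  have hi : ∀ i, IntegrableOn (fun w => ∫ s in Ioc 0 (K.loop i).l,
      fderiv ℝ (newton ((K.loop i).γ s)) w ((K.loop i).N s)) (innerDomain Ω δ) := fun i =>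
    (hk i).integral_prod_right
  constructor
  · refine IntegrableOn.congr_fun ?_ he.symm hm
    exact (integrable_finsetSum _ fun i _ => hi i).const_mul _
  · rw [setIntegral_congr_fun hm he, integral_const_mul, integral_finsetSum _ fun i _ => hi i]
    congr 1
    refine Finset.sum_congr rfl fun i _ => ?_
    rw [ArcLoop.interval_eq]
    exact (integral_integral_swap (hk i)).symm

theorem IsTubular.setIntegral_fderiv_newton (h : K.IsTubular δ₀) (hΩ : IsClosed Ω) {δ : ℝ}
    (hδ : 0 < δ) (hδ' : δ < δ₀) {p : ℂ} (hp : p ∈ frontier Ω) (v : ℂ) :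
    ∫ w in innerDomain Ω δ, fderiv ℝ (newton p) w v =
      -∑ j, ∫ t in 0..(K.loop j).l, (K.loop j).jac t δ * newton p ((K.loop j).tube t δ) *
        (K.loop j).nc v t := by
  obtain ⟨F, hF, hF0, hFi, hFe⟩ := exists_regularization (C := 2) (w := p) hδ
    ((contDiffOn_newton p).of_le (by simp)) (tendsto_newton p) (fun z hz =>
      norm_fderiv_newton_le (sub_ne_zero.1 (norm_pos_iff.1 (hδ.trans_le hz))))
  have hm := (isClosed_innerDomain hΩ δ).measurableSet
  have hd : ∀ w ∈ innerDomain Ω δ, δ ≤ ‖w - p‖ := fun w hw => by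
    rw [← dist_eq_norm]; exact hw.2 p hp
  have hcongr : EqOn (fun w => fderiv ℝ (newton p) w v) (fun w => fderiv ℝ F w v)
      (innerDomain Ω δ) := fun w hw => by
    simp only
    rw [(hFe w (hd w hw)).2]
  rw [setIntegral_congr_fun hm hcongr, h.green hΩ hδ.le hδ' hF hF0 hFi v]
  congr 1
  refine Finset.sum_congr rfl fun j _ => ?_
  congr 1
  funext t
  rw [(hFe _ (hd _ ((h.tube_mem_innerDomain_iff hΩ j t hδ.le
    (by rwa [abs_of_pos hδ])).2 le_rfl))).1]

end SmoothBoundary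

namespace ArcLoop

/-- The double integrand of the truncated energy. -/
noncomputable def dens (c d : ArcLoop) (δ s t : ℝ) : ℝ :=
  d.jac t δ * (((d.tube t δ - c.γ s) * (starRingEnd ℂ) (c.T s)).im *
    ((d.tube t δ - c.γ s) * (starRingEnd ℂ) (d.T t)).im) / ‖d.tube t δ - c.γ s‖ ^ 4

variable (c d : ArcLoop)

theorem integral_newton_eq {δ s : ℝ} (h : ∀ t, d.tube t δ ≠ c.γ s) :
    ∫ t in 0..d.l, d.jac t δ * newton (c.γ s) (d.tube t δ) * d.nc (c.N s) t =
      2 * ∫ t in 0..d.l, c.dens d δ s t := by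
  have hne : ∀ t, d.tube t δ - c.γ s ≠ 0 := fun t => sub_ne_zero.2 (h t)
  have cγ := d.continuous_γ
  have cT := d.continuous_T
  have cκ := d.continuous_κ
  have ct : Continuous fun t => d.tube t δ := d.continuous_tube.comp
    (by fun_prop : Continuous fun t : ℝ => (t, δ))
  have cj : Continuous fun t => d.jac t δ := d.continuous_jac.comp
    (by fun_prop : Continuous fun t : ℝ => (t, δ))
  have hd : ∀ t, HasDerivAt (fun t => -(c.T s / (d.tube t δ - c.γ s)))
      (c.T s * (d.jac t δ • d.T t) / (d.tube t δ - c.γ s) ^ 2) t := fun t => by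
    have := ((((d.hasDerivAt_tube_fst t δ).sub_const (c.γ s)).inv (hne t)).const_mul (c.T s)).neg
    convert! this using 1
    ring
  have hc : Continuous fun t => c.T s * (d.jac t δ • d.T t) / (d.tube t δ - c.γ s) ^ 2 :=
    (by fun_prop : Continuous fun t => c.T s * (d.jac t δ • d.T t)).div (by fun_prop)
      fun t => pow_ne_zero 2 (hne t)
  have h0 : ∫ t in 0..d.l, c.T s * (d.jac t δ • d.T t) / (d.tube t δ - c.γ s) ^ 2 = 0 := by
    rw [intervalIntegral.integral_eq_sub_of_hasDerivAt (fun t _ => hd t)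
      (hc.intervalIntegrable _ _)]
    have := d.periodic_tube δ 0
    simp only [zero_add] at this
    rw [this, sub_self]
  have h1 : ∫ t in 0..d.l,
      (c.T s * (d.jac t δ • d.T t) / (d.tube t δ - c.γ s) ^ 2).re = 0 := by
    have := Complex.reCLM.intervalIntegral_comp_comm (hc.intervalIntegrable (μ := volume) 0 d.l)
    simp only [Complex.reCLM_apply] at this
    rw [this, h0, Complex.zero_re]
  have hdens : Continuous fun t => c.dens d δ s t := by
    unfold dens
    exact (by fun_prop : Continuous fun t => d.jac t δ *
      (((d.tube t δ - c.γ s) * (starRingEnd ℂ) (c.T s)).im *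
      ((d.tube t δ - c.γ s) * (starRingEnd ℂ) (d.T t)).im)).div (by fun_prop)
      fun t => pow_ne_zero 4 (norm_ne_zero_iff.2 (hne t))
  have key : ∀ t, d.jac t δ * newton (c.γ s) (d.tube t δ) * d.nc (c.N s) t =
      2 * c.dens d δ s t +
        (c.T s * (d.jac t δ • d.T t) / (d.tube t δ - c.γ s) ^ 2).re := fun t => by
    have hz := hne t
    set ζ := d.tube t δ - c.γ s with hζ
    have hn : ‖ζ‖ ≠ 0 := norm_ne_zero_iff.2 hz
    have e1 : c.T s * (d.jac t δ • d.T t) / ζ ^ 2 =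
        ((d.jac t δ / ‖ζ‖ ^ 4 : ℝ) : ℂ) * (c.T s * d.T t * (starRingEnd ℂ) ζ ^ 2) := by
      have e2 : ζ * (starRingEnd ℂ) ζ = ((‖ζ‖ ^ 2 : ℝ) : ℂ) := by
        rw [Complex.mul_conj, Complex.normSq_eq_norm_sq]
      have e3 : (starRingEnd ℂ) ζ ≠ 0 := (map_ne_zero _).2 hz
      have hn' : (‖ζ‖ : ℂ) ≠ 0 := by exact_mod_cast hn
      rw [Complex.real_smul, div_eq_iff (pow_ne_zero 2 hz)]
      push_cast at e2 ⊢
      field_simp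
      rw [show (‖ζ‖ : ℂ) ^ 4 = ((‖ζ‖ : ℂ) ^ 2) ^ 2 by ring, ← e2]
      ring
    rw [e1, Complex.re_ofReal_mul, newton_eq, nc_eq, dotProd, dens, ← hζ]
    have hnn : ‖ζ‖ ^ 2 = ζ.re * ζ.re + ζ.im * ζ.im := by
      rw [← Complex.normSq_eq_norm_sq, Complex.normSq_apply]
    have e4 : (‖ζ‖ ^ 2)⁻¹ = ‖ζ‖ ^ 2 / ‖ζ‖ ^ 4 := by field_simp
    rw [e4, hnn]
    simp [N, sq]
    ring
  have hre : Continuous fun t =>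
      (c.T s * (d.jac t δ • d.T t) / (d.tube t δ - c.γ s) ^ 2).re := Complex.continuous_re.comp hc
  simp only [key]
  rw [intervalIntegral.integral_add ((hdens.const_mul 2).intervalIntegrable _ _)
    (hre.intervalIntegrable _ _), h1,
    intervalIntegral.integral_const_mul, add_zero]

/-- Expansions along the diagonal, uniform along the curve. -/
theorem exists_expansions : ∃ M, 1 ≤ M ∧ (∀ t, |c.κ t| ≤ M) ∧ ∀ t u,
    |((c.γ t - c.γ (t + u)) * (starRingEnd ℂ) (c.T (t + u))).im| ≤ M * |u| ^ 2 ∧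
    |((c.γ t - c.γ (t + u)) * (starRingEnd ℂ) (c.T t)).im| ≤ M * |u| ^ 2 ∧
    |((c.γ t - c.γ (t + u)) * (starRingEnd ℂ) (c.T (t + u))).im +
      ((c.γ t - c.γ (t + u)) * (starRingEnd ℂ) (c.T t)).im| ≤ M * |u| ^ 3 ∧
    |((c.γ t - c.γ (t + u)) * (starRingEnd ℂ) (c.T t)).im + c.κ t * u ^ 2 / 2| ≤ M * |u| ^ 3 ∧
    |(c.T t * (starRingEnd ℂ) (c.T (t + u))).re - 1| ≤ M * |u| ^ 2 ∧
    |u ^ 2 - ‖c.γ t - c.γ (t + u)‖ ^ 2| ≤ M * u ^ 4 ∧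
    |((c.γ t - c.γ (t + u)) * (starRingEnd ℂ) (c.T t)).re + u| ≤ M * |u| ^ 3 := by
  obtain ⟨M, hM, hk, h1, h2, h3, h4⟩ := c.exists_bounds
  have hM0 : 0 ≤ M := by linarith
  have re1 : ∀ s, (c.T s).re * (c.T s).re + (c.T s).im * (c.T s).im = 1 := fun s => by
    simpa using congrArg Complex.re (c.T_mul_conj_T s)
  have im_le : ∀ (z : ℂ) s, |(z * (starRingEnd ℂ) (c.T s)).im| ≤ ‖z‖ := fun z s => by
    refine (Complex.abs_im_le_norm _).trans ?_
    rw [norm_mul, RCLike.norm_conj, c.norm_T, mul_one]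
  have re_le : ∀ (z : ℂ) s, |(z * (starRingEnd ℂ) (c.T s)).re| ≤ ‖z‖ := fun z s => by
    refine (Complex.abs_re_le_norm _).trans ?_
    rw [norm_mul, RCLike.norm_conj, c.norm_T, mul_one]
  have h2' : ∀ t u, ‖c.γ t - c.γ (t + u) + u * c.T (t + u)‖ ≤ M * |u| ^ 2 := fun t u => by
    have := h2 (t + u) (-u)
    rw [abs_neg, add_neg_cancel_right] at this
    push_cast at this
    rwa [neg_mul, sub_neg_eq_add] at this
  have h3' : ∀ t u, ‖c.γ t - c.γ (t + u) + u * c.T (t + u) -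
      u ^ 2 / 2 * (Complex.I * c.κ (t + u) * c.T (t + u))‖ ≤ M * |u| ^ 3 := fun t u => by
    have := h3 (t + u) (-u)
    rw [abs_neg, add_neg_cancel_right, c.deriv_T] at this
    push_cast at this
    rwa [neg_mul, sub_neg_eq_add, neg_sq] at this
  have b3 : ∀ t u, |((c.γ t - c.γ (t + u)) * (starRingEnd ℂ) (c.T t)).im + c.κ t * u ^ 2 / 2| ≤
      M * |u| ^ 3 := fun t u => by
    have := (im_le _ t).trans (h3 t u)
    rw [c.deriv_T, ← abs_neg] at this
    convert! this using 2
    simp [← Complex.ofReal_pow]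
    linear_combination (-(c.κ t * u ^ 2 / 2)) * re1 t
  have a3 : ∀ t u, |((c.γ t - c.γ (t + u)) * (starRingEnd ℂ) (c.T (t + u))).im -
      c.κ (t + u) * u ^ 2 / 2| ≤ M * |u| ^ 3 := fun t u => by
    have := (im_le _ (t + u)).trans (h3' t u)
    convert! this using 2
    simp [← Complex.ofReal_pow]
    linear_combination (c.κ (t + u) * u ^ 2 / 2) * (re1 (t + u))
  have r3 : ∀ t u, |((c.γ t - c.γ (t + u)) * (starRingEnd ℂ) (c.T t)).re + u| ≤
      M * |u| ^ 3 := fun t u => by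
    have := (re_le _ t).trans (h3 t u)
    rw [c.deriv_T, ← abs_neg] at this
    convert! this using 2
    simp [← Complex.ofReal_pow]
    linear_combination (-u) * re1 t
  refine ⟨4 * M ^ 2, by nlinarith, fun t => (hk t).trans (by nlinarith), fun t u => ?_⟩
  have hMM : M ≤ 4 * M ^ 2 := by nlinarith
  refine ⟨?_, ?_, ?_, ?_, ?_, ?_, (r3 t u).trans (by gcongr)⟩
  · have := (im_le _ (t + u)).trans (h2' t u)
    refine (le_of_eq ?_).trans (this.trans (by gcongr))
    congr 1
    simp
    ring
  · have := (im_le _ t).trans (h2 t u)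
    rw [← abs_neg] at this
    refine (le_of_eq ?_).trans (this.trans (by gcongr))
    congr 1
    simp
    ring
  · have e : ((c.γ t - c.γ (t + u)) * (starRingEnd ℂ) (c.T (t + u))).im +
      ((c.γ t - c.γ (t + u)) * (starRingEnd ℂ) (c.T t)).im =
      (((c.γ t - c.γ (t + u)) * (starRingEnd ℂ) (c.T (t + u))).im - c.κ (t + u) * u ^ 2 / 2) +
      (((c.γ t - c.γ (t + u)) * (starRingEnd ℂ) (c.T t)).im + c.κ t * u ^ 2 / 2) +
      (c.κ (t + u) - c.κ t) * u ^ 2 / 2 := by ring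
    rw [e]
    refine (abs_add_three _ _ _).trans ?_
    have e2 : |(c.κ (t + u) - c.κ t) * u ^ 2 / 2| ≤ M * |u| ^ 3 := by
      rw [abs_div, abs_mul, abs_of_nonneg (sq_nonneg u), abs_two, ← sq_abs u]
      have := mul_le_mul_of_nonneg_right (h4 t u) (sq_nonneg |u|)
      have : 0 ≤ |c.κ (t + u) - c.κ t| * |u| ^ 2 := by positivity
      nlinarith
    have := a3 t u
    have := b3 t u
    have : 3 * M * |u| ^ 3 ≤ 4 * M ^ 2 * |u| ^ 3 := by
      refine mul_le_mul_of_nonneg_right ?_ (by positivity)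
      nlinarith
    linarith
  · exact (b3 t u).trans (by gcongr)
  · have e : (c.T t * (starRingEnd ℂ) (c.T (t + u))).re - 1 =
        -(‖c.T (t + u) - c.T t‖ ^ 2 / 2) := by
      rw [← Complex.normSq_eq_norm_sq, Complex.normSq_apply]
      simp
      linear_combination (1 / 2) * re1 t + (1 / 2) * re1 (t + u)
    rw [e, abs_neg, abs_of_nonneg (by positivity)]
    have : ‖c.T (t + u) - c.T t‖ ^ 2 ≤ (M * |u|) ^ 2 := by gcongr; exact h1 t u
    rw [mul_pow] at this
    have : 0 ≤ M ^ 2 * |u| ^ 2 := by positivity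
    linarith
  · have hq : ‖c.γ t - c.γ (t + u)‖ ≤ |u| := by
      rw [norm_sub_rev]; exact c.norm_chord_le t u
    have hq2 : ‖c.γ t - c.γ (t + u)‖ ^ 2 ≤ u ^ 2 := by rw [← sq_abs u]; gcongr
    rw [abs_of_nonneg (by linarith)]
    set r := ((c.γ t - c.γ (t + u)) * (starRingEnd ℂ) (c.T t)).re
    have h5 : r ^ 2 ≤ ‖c.γ t - c.γ (t + u)‖ ^ 2 := by
      rw [← sq_abs r]
      gcongr
      exact re_le _ t
    have h6 : |r + u| * |u| ≤ M * |u| ^ 4 := by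
      have := mul_le_mul_of_nonneg_right (r3 t u) (abs_nonneg u)
      rwa [mul_assoc, ← pow_succ] at this
    have h7 : u ^ 2 - r ^ 2 ≤ 2 * (|r + u| * |u|) := by
      have h8 : u ^ 2 - r ^ 2 = 2 * ((r + u) * u) - (r + u) ^ 2 := by ring
      have h9 : (r + u) * u ≤ |r + u| * |u| := by rw [← abs_mul]; exact le_abs_self _
      nlinarith [sq_nonneg (r + u)]
    have h10 : |u| ^ 4 = u ^ 4 := by
      rw [show (4 : ℕ) = 2 * 2 by norm_num, pow_mul, pow_mul, sq_abs]
    rw [h10] at h6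
    have : 0 ≤ u ^ 4 := by positivity
    nlinarith

end ArcLoop

/-! ### Two improper integrals -/

theorem hasDerivAt_rational_aux (x a b d : ℝ) :
    HasDerivAt (fun x => a * Real.arctan x + b * (x / (1 + x ^ 2)) + d * (x / (1 + x ^ 2) ^ 2))
      (a / (1 + x ^ 2) + b * ((1 - x ^ 2) / (1 + x ^ 2) ^ 2) +
        d * ((1 - 3 * x ^ 2) / (1 + x ^ 2) ^ 3)) x := by
  have h0 : (1 + x ^ 2) ≠ 0 := by positivity
  have hp : HasDerivAt (fun x : ℝ => 1 + x ^ 2) (2 * x) x := by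
    simpa using (hasDerivAt_pow 2 x).const_add 1
  have h1 := (Real.hasDerivAt_arctan x).const_mul a
  have h2 := ((hasDerivAt_id x).div hp h0).const_mul b
  have h3 := ((hasDerivAt_id x).div (hp.pow 2) (pow_ne_zero 2 h0)).const_mul d
  convert! (h1.add h2).add h3 using 1
  simp
  field_simp
  ring

theorem tendsto_rational_aux (a b d : ℝ) :
    Tendsto (fun x => a * Real.arctan x + b * (x / (1 + x ^ 2)) + d * (x / (1 + x ^ 2) ^ 2))
      atTop (𝓝 (a * (Real.pi / 2))) ∧
    Tendsto (fun x => a * Real.arctan x + b * (x / (1 + x ^ 2)) + d * (x / (1 + x ^ 2) ^ 2))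
      atBot (𝓝 (a * (-(Real.pi / 2)))) := by
  have inv : Tendsto (fun x : ℝ => |x|⁻¹) (cocompact ℝ) (𝓝 0) :=
    tendsto_inv_atTop_zero.comp (tendsto_norm_cocompact_atTop (E := ℝ))
  have h2 : Tendsto (fun x : ℝ => x / (1 + x ^ 2)) (cocompact ℝ) (𝓝 0) := by
    refine squeeze_zero_norm (fun x => ?_) inv
    rw [norm_div, Real.norm_eq_abs, Real.norm_eq_abs, abs_of_pos (by positivity : 0 < 1 + x ^ 2)]
    rcases eq_or_ne x 0 with rfl | hx
    · simp
    rw [div_le_iff₀ (by positivity), ← sq_abs]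
    have : 0 < |x| := abs_pos.2 hx
    field_simp
    nlinarith
  have h3 : Tendsto (fun x : ℝ => x / (1 + x ^ 2) ^ 2) (cocompact ℝ) (𝓝 0) := by
    refine squeeze_zero_norm (fun x => ?_) (by simpa using h2.norm)
    rw [norm_div, Real.norm_eq_abs, Real.norm_eq_abs, abs_of_pos
      (by positivity : 0 < 1 + x ^ 2), abs_of_pos (by positivity : 0 < (1 + x ^ 2) ^ 2)]
    gcongr
    nlinarith [sq_nonneg x]
  constructor
  · have := ((tendsto_nhdsWithin_iff.1 Real.tendsto_arctan_atTop).1.const_mul a).add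
      (((h2.mono_left atTop_le_cocompact).const_mul b)) |>.add
      ((h3.mono_left atTop_le_cocompact).const_mul d)
    simpa using this
  · have := ((tendsto_nhdsWithin_iff.1 Real.tendsto_arctan_atBot).1.const_mul a).add
      (((h2.mono_left atBot_le_cocompact).const_mul b)) |>.add
      ((h3.mono_left atBot_le_cocompact).const_mul d)
    simpa using this

theorem integrable_of_abs_le_inv_one_add_sq {f : ℝ → ℝ} {C : ℝ} (hf : Continuous f)
    (h : ∀ x, |f x| ≤ C * (1 + x ^ 2)⁻¹) : Integrable f :=
  (integrable_inv_one_add_sq.const_mul C).mono' hf.aestronglyMeasurable (.of_forall h)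

theorem integral_inv_sq : Integrable (fun x : ℝ => 1 / (1 + x ^ 2) ^ 2) ∧
    ∫ x : ℝ, 1 / (1 + x ^ 2) ^ 2 = Real.pi / 2 := by
  have hpos : ∀ x : ℝ, 0 < 1 + x ^ 2 := fun x => by positivity
  have hi : Integrable (fun x : ℝ => 1 / (1 + x ^ 2) ^ 2) := by
    refine integrable_of_abs_le_inv_one_add_sq (C := 1)
      (continuous_const.div (by fun_prop) fun x => pow_ne_zero 2 (hpos x).ne') fun x => ?_
    have := hpos x
    rw [abs_of_pos (by positivity), one_mul, ← one_div]
    refine one_div_le_one_div_of_le this ?_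
    nlinarith [sq_nonneg x]
  refine ⟨hi, ?_⟩
  have hd : ∀ x : ℝ, HasDerivAt _ (1 / (1 + x ^ 2) ^ 2) x := fun x => by
    have := hasDerivAt_rational_aux x (1 / 2) (1 / 2) 0
    convert! this using 1
    have := (hpos x).ne'
    field_simp
    ring
  rw [integral_of_hasDerivAt_of_tendsto hd hi (tendsto_rational_aux _ _ _).2
    (tendsto_rational_aux _ _ _).1]
  ring

theorem integral_sub_div_cube : Integrable (fun x : ℝ => (x ^ 2 - 1) / (1 + x ^ 2) ^ 3) ∧
    ∫ x : ℝ, (x ^ 2 - 1) / (1 + x ^ 2) ^ 3 = -(Real.pi / 4) := by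
  have hpos : ∀ x : ℝ, 0 < 1 + x ^ 2 := fun x => by positivity
  have hi : Integrable (fun x : ℝ => (x ^ 2 - 1) / (1 + x ^ 2) ^ 3) := by
    refine integrable_of_abs_le_inv_one_add_sq (C := 1)
      ((by fun_prop : Continuous fun x : ℝ => x ^ 2 - 1).div (by fun_prop)
        fun x => pow_ne_zero 3 (hpos x).ne') fun x => ?_
    have h1 := hpos x
    rw [abs_div, abs_of_pos (by positivity : 0 < (1 + x ^ 2) ^ 3), one_mul, div_le_iff₀
      (by positivity), pow_succ' (1 + x ^ 2), inv_mul_cancel_left₀ h1.ne', abs_le]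
    constructor <;> nlinarith [sq_nonneg x]
  refine ⟨hi, ?_⟩
  have hd : ∀ x : ℝ, HasDerivAt _ ((x ^ 2 - 1) / (1 + x ^ 2) ^ 3) x := fun x => by
    have := hasDerivAt_rational_aux x (-1 / 4) (-1 / 4) (-1 / 2)
    convert! this using 1
    have := (hpos x).ne'
    field_simp
    ring
  rw [integral_of_hasDerivAt_of_tendsto hd hi (tendsto_rational_aux _ _ _).2
    (tendsto_rational_aux _ _ _).1]
  ring

namespace ArcLoop

variable (c : ArcLoop)

/-- `|ζ|²` for `ζ = γ t + δ N t - γ (t + u)`. -/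
noncomputable def sqDist (δ t u : ℝ) : ℝ := ‖c.γ t - c.γ (t + u)‖ ^ 2 +
  2 * δ * ((c.γ t - c.γ (t + u)) * (starRingEnd ℂ) (c.T t)).im + δ ^ 2

theorem norm_tube_sub_sq (δ t u : ℝ) : ‖c.tube t δ - c.γ (t + u)‖ ^ 2 = c.sqDist δ t u := by
  have re1 : (c.T t).re * (c.T t).re + (c.T t).im * (c.T t).im = 1 := by
    simpa using congrArg Complex.re (c.T_mul_conj_T t)
  rw [sqDist, ← Complex.normSq_eq_norm_sq, ← Complex.normSq_eq_norm_sq, Complex.normSq_apply,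
    Complex.normSq_apply]
  simp [tube]
  linear_combination δ ^ 2 * re1

theorem exists_sqDist_lower_bound : ∃ c₁ δ₁, 0 < c₁ ∧ c₁ ≤ 1 ∧ 0 < δ₁ ∧ δ₁ ≤ 1 ∧
    ∀ δ t u, 0 ≤ δ → δ < δ₁ → |u| ≤ c.l / 2 → c₁ * (u ^ 2 + δ ^ 2) ≤ c.sqDist δ t u := by
  obtain ⟨M, hM, hk, he⟩ := c.exists_expansions
  obtain ⟨c₀, hc₀, hc₀', hc⟩ := c.exists_chord_lower_bound
  have hM0 : 0 < M := by linarith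
  refine ⟨c₀ ^ 2 / 2, min 1 (c₀ ^ 2 / (4 * M)), by positivity, by nlinarith, by positivity,
    min_le_left _ _, fun δ t u hδ hδ' hu => ?_⟩
  obtain ⟨-, hB, -⟩ := he t u
  have h1 := hc t u hu
  rw [norm_sub_rev] at h1
  have h2 : c₀ ^ 2 * u ^ 2 ≤ ‖c.γ t - c.γ (t + u)‖ ^ 2 := by
    rw [← sq_abs u, ← mul_pow]; gcongr
  have h3 : δ * M ≤ c₀ ^ 2 / 4 := by
    have : δ ≤ c₀ ^ 2 / (4 * M) := hδ'.le.trans (min_le_right _ _)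
    calc δ * M ≤ c₀ ^ 2 / (4 * M) * M := by gcongr
      _ = _ := by field_simp
  rw [sq_abs] at hB
  have h4 := (abs_le.1 hB).1
  have h5 : 2 * δ * (-(M * u ^ 2)) ≤
      2 * δ * ((c.γ t - c.γ (t + u)) * (starRingEnd ℂ) (c.T t)).im := by gcongr
  have h6 : δ * M * u ^ 2 ≤ c₀ ^ 2 / 4 * u ^ 2 := by gcongr
  have h7 : c₀ ^ 2 / 2 * δ ^ 2 ≤ 1 * δ ^ 2 := by
    gcongr
    nlinarith
  rw [sqDist]
  nlinarith

/-- The integrand in coordinates along the diagonal. -/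
theorem dens_eq (δ t u : ℝ) : c.dens c δ (t + u) t = (1 - δ * c.κ t) *
    ((((c.γ t - c.γ (t + u)) * (starRingEnd ℂ) (c.T (t + u))).im +
      δ * (c.T t * (starRingEnd ℂ) (c.T (t + u))).re) *
    (((c.γ t - c.γ (t + u)) * (starRingEnd ℂ) (c.T t)).im + δ)) / c.sqDist δ t u ^ 2 := by
  have re1 : (c.T t).re * (c.T t).re + (c.T t).im * (c.T t).im = 1 := by
    simpa using congrArg Complex.re (c.T_mul_conj_T t)
  rw [dens, ← norm_tube_sub_sq, ← pow_mul, jac]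
  congr 2
  congr 1
  · simp [tube]; ring
  · simp [tube]
    linear_combination δ * re1

/-- The part of the integrand that converges as `δ → 0`. -/
noncomputable def regPart (δ t u : ℝ) : ℝ := (1 - δ * c.κ t) *
    (((c.γ t - c.γ (t + u)) * (starRingEnd ℂ) (c.T (t + u))).im *
      ((c.γ t - c.γ (t + u)) * (starRingEnd ℂ) (c.T t)).im +
    δ * (((c.γ t - c.γ (t + u)) * (starRingEnd ℂ) (c.T (t + u))).im +
      ((c.γ t - c.γ (t + u)) * (starRingEnd ℂ) (c.T t)).im *
        (c.T t * (starRingEnd ℂ) (c.T (t + u))).re) +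
    δ ^ 2 * ((c.T t * (starRingEnd ℂ) (c.T (t + u))).re - 1)) / c.sqDist δ t u ^ 2

/-- The part of the integrand that diverges as `δ → 0`. -/
noncomputable def singPart (δ t u : ℝ) : ℝ := (1 - δ * c.κ t) * δ ^ 2 / c.sqDist δ t u ^ 2

theorem dens_eq_add (δ t u : ℝ) :
    c.dens c δ (t + u) t = c.regPart δ t u + c.singPart δ t u := by
  rw [dens_eq, regPart, singPart, ← add_div]
  congr 1
  ring

theorem dens_zero_eq (t u : ℝ) : c.dens c 0 (t + u) t = c.regPart 0 t u := by
  rw [dens_eq_add, singPart]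
  simp

theorem measurable_regPart (δ : ℝ) : Measurable fun x : ℝ × ℝ => c.regPart δ x.1 x.2 := by
  have h1 := c.continuous_γ
  have h2 := c.continuous_T
  have h3 := c.continuous_κ
  unfold regPart sqDist
  refine Measurable.div (Continuous.measurable ?_) (Continuous.measurable ?_) <;> fun_prop

theorem measurable_singPart (δ : ℝ) : Measurable fun x : ℝ × ℝ => c.singPart δ x.1 x.2 := by
  have h1 := c.continuous_γ
  have h2 := c.continuous_T
  have h3 := c.continuous_κ
  unfold singPart sqDist
  refine Measurable.div (Continuous.measurable ?_) (Continuous.measurable ?_) <;> fun_prop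

theorem exists_regPart_bound : ∃ C δ₁, 0 ≤ C ∧ 0 < δ₁ ∧ ∀ δ t u, 0 ≤ δ → δ < δ₁ → |u| ≤ c.l / 2 →
    |c.regPart δ t u| ≤ C := by
  obtain ⟨M, hM, hk, he⟩ := c.exists_expansions
  obtain ⟨c₁, δ₁, hc₁, hc₁', hδ₁, hδ₁', hD⟩ := c.exists_sqDist_lower_bound
  have hM0 : 0 < M := by linarith
  refine ⟨(1 + M) * (5 * M ^ 2) / c₁ ^ 2, δ₁, by positivity, hδ₁, fun δ t u hδ hδ' hu => ?_⟩
  obtain ⟨hA, hB, hAB, -, hC, -⟩ := he t u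
  have hD' := hD δ t u hδ hδ' hu
  rw [regPart]
  set A := ((c.γ t - c.γ (t + u)) * (starRingEnd ℂ) (c.T (t + u))).im
  set B := ((c.γ t - c.γ (t + u)) * (starRingEnd ℂ) (c.T t)).im
  set C := (c.T t * (starRingEnd ℂ) (c.T (t + u))).re
  have hC1 : |C| ≤ 1 := by
    refine (Complex.abs_re_le_norm _).trans ?_
    rw [norm_mul, RCLike.norm_conj, c.norm_T, c.norm_T, mul_one]
  have hu0 := abs_nonneg u
  have hMM : M ≤ M ^ 2 := by nlinarith
  set E := u ^ 2 + δ ^ 2 with hE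
  have hE0 : 0 ≤ E := by positivity
  by_cases hEz : E = 0
  · have hu1 : u = 0 := by nlinarith [sq_nonneg u, sq_nonneg δ]
    have hδ1 : δ = 0 := by nlinarith [sq_nonneg u, sq_nonneg δ]
    have : c.sqDist δ t u = 0 := by simp [sqDist, hu1, hδ1]
    rw [this]
    simp
    positivity
  have hEp : 0 < E := lt_of_le_of_ne hE0 (Ne.symm hEz)
  have q1 : |u| ^ 2 ≤ E := by rw [sq_abs, hE]; nlinarith [sq_nonneg δ]
  have q2 : δ * |u| ≤ E := by rw [hE, ← sq_abs u]; nlinarith [sq_nonneg (δ - |u|), sq_nonneg δ, sq_nonneg |u|]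
  have q3 : δ ^ 2 ≤ E := by rw [hE]; nlinarith [sq_nonneg u]
  have n1 : |A * B| ≤ M ^ 2 * E ^ 2 := by
    rw [abs_mul]
    calc |A| * |B| ≤ (M * |u| ^ 2) * (M * |u| ^ 2) := by gcongr
      _ ≤ (M * E) * (M * E) := by gcongr
      _ = _ := by ring
  have n2 : |δ * (A + B * C)| ≤ (3 * M ^ 2) * E ^ 2 := by
    have e : A + B * C = (A + B) + B * (C - 1) := by ring
    have h1 : |A + B * C| ≤ M * |u| ^ 3 + (M * |u| ^ 2) * (M * |u| ^ 2) := by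
      rw [e]
      refine (abs_add_le _ _).trans (add_le_add hAB ?_)
      rw [abs_mul]
      gcongr
    rw [abs_mul, abs_of_nonneg hδ]
    calc δ * |A + B * C| ≤ δ * (M * |u| ^ 3 + (M * |u| ^ 2) * (M * |u| ^ 2)) := by gcongr
      _ = M * ((δ * |u|) * |u| ^ 2) + δ * (M ^ 2 * (|u| ^ 2) ^ 2) := by ring
      _ ≤ M * (E * E) + 1 * (M ^ 2 * E ^ 2) := by
          gcongr
          linarith
      _ ≤ 3 * M ^ 2 * E ^ 2 := by nlinarith [mul_le_mul_of_nonneg_right hMM (sq_nonneg E)]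
  have n3 : |δ ^ 2 * (C - 1)| ≤ M ^ 2 * E ^ 2 := by
    rw [abs_mul, abs_of_nonneg (sq_nonneg δ)]
    calc δ ^ 2 * |C - 1| ≤ E * (M * |u| ^ 2) := by gcongr
      _ ≤ E * (M * E) := by gcongr
      _ ≤ M ^ 2 * E ^ 2 := by nlinarith [mul_le_mul_of_nonneg_right hMM (sq_nonneg E)]
  have n4 : |1 - δ * c.κ t| ≤ 1 + M := by
    refine (abs_sub _ _).trans ?_
    rw [abs_one, abs_mul, abs_of_nonneg hδ]
    have := mul_le_mul (hδ'.le.trans hδ₁') (hk t) (abs_nonneg _) zero_le_one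
    linarith
  have hDp : 0 < c.sqDist δ t u := lt_of_lt_of_le (by positivity) hD'
  rw [abs_div, abs_of_pos (pow_pos hDp 2), abs_mul, div_le_div_iff₀ (by positivity) (by positivity)]
  have n5 : |A * B + δ * (A + B * C) + δ ^ 2 * (C - 1)| ≤ 5 * M ^ 2 * E ^ 2 := by
    refine (abs_add_three _ _ _).trans ?_
    linarith
  have n6 : (c₁ * E) ^ 2 ≤ c.sqDist δ t u ^ 2 := by gcongr
  calc |1 - δ * c.κ t| * |A * B + δ * (A + B * C) + δ ^ 2 * (C - 1)| * c₁ ^ 2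
      ≤ (1 + M) * (5 * M ^ 2 * E ^ 2) * c₁ ^ 2 := by gcongr
    _ = (1 + M) * (5 * M ^ 2) * (c₁ * E) ^ 2 := by ring
    _ ≤ _ := by gcongr

end ArcLoop

namespace ArcLoop

variable (c : ArcLoop)

theorem tendsto_sqDist (t u : ℝ) :
    Tendsto (fun δ => c.sqDist δ t u) (𝓝[>] 0) (𝓝 (c.sqDist 0 t u)) := by
  have : Continuous fun δ => c.sqDist δ t u := by unfold sqDist; fun_prop
  exact this.continuousAt.tendsto.mono_left nhdsWithin_le_nhds

theorem regPart_self (δ t : ℝ) : c.regPart δ t 0 = 0 := by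
  have re1 : (c.T t).re * (c.T t).re + (c.T t).im * (c.T t).im = 1 := by
    simpa using congrArg Complex.re (c.T_mul_conj_T t)
  simp [regPart, re1]

theorem tendsto_regPart {t u : ℝ} (hu : |u| ≤ c.l / 2) :
    Tendsto (fun δ => c.regPart δ t u) (𝓝[>] 0) (𝓝 (c.regPart 0 t u)) := by
  by_cases h : u = 0
  · subst h
    simp only [regPart_self]
    exact tendsto_const_nhds
  have hD : c.sqDist 0 t u ≠ 0 := by
    have : c.γ t - c.γ (t + u) ≠ 0 :=
      sub_ne_zero.2 (c.γ_add_ne h (by linarith [c.l_pos])).symm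
    simpa [sqDist] using this
  unfold regPart
  refine Tendsto.div ?_ ((c.tendsto_sqDist t u).pow 2) (pow_ne_zero 2 hD)
  refine Tendsto.mono_left (Continuous.tendsto ?_ 0) nhdsWithin_le_nhds
  fun_prop

theorem tendsto_integral_regPart :
    Tendsto (fun δ => ∫ x in Ioc 0 c.l ×ˢ Ioc (-(c.l / 2)) (c.l / 2), c.regPart δ x.1 x.2)
      (𝓝[>] 0) (𝓝 (∫ x in Ioc 0 c.l ×ˢ Ioc (-(c.l / 2)) (c.l / 2), c.regPart 0 x.1 x.2)) := by
  obtain ⟨C, δ₁, hC, hδ₁, hb⟩ := c.exists_regPart_bound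
  have hm : MeasurableSet (Ioc 0 c.l ×ˢ Ioc (-(c.l / 2)) (c.l / 2)) :=
    measurableSet_Ioc.prod measurableSet_Ioc
  have hfin : volume (Ioc 0 c.l ×ˢ Ioc (-(c.l / 2)) (c.l / 2)) ≠ ⊤ := by
    rw [Measure.volume_eq_prod, Measure.prod_prod]
    exact ENNReal.mul_ne_top measure_Ioc_lt_top.ne measure_Ioc_lt_top.ne
  have habs : ∀ x ∈ Ioc 0 c.l ×ˢ Ioc (-(c.l / 2)) (c.l / 2), |x.2| ≤ c.l / 2 := fun x hx =>
    abs_le.2 ⟨hx.2.1.le, hx.2.2⟩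
  refine tendsto_integral_filter_of_dominated_convergence (fun _ => C) ?_ ?_ ?_ ?_
  · exact .of_forall fun δ => (c.measurable_regPart δ).aestronglyMeasurable
  · filter_upwards [Ioo_mem_nhdsGT hδ₁] with δ hδ
    filter_upwards [ae_restrict_mem hm] with x hx
    exact hb δ x.1 x.2 hδ.1.le hδ.2 (habs x hx)
  · exact integrableOn_const hfin
  · filter_upwards [ae_restrict_mem hm] with x hx
    exact c.tendsto_regPart (habs x hx)

/-- The rescaled singular part, with its leading term subtracted. -/
noncomputable def scaled (δ t x : ℝ) : ℝ :=
  ((Ioc (-(c.l / 2)) (c.l / 2)).indicator (fun u => δ ^ 2 * c.singPart δ t u) (δ * x) -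
    1 / (1 + x ^ 2) ^ 2) / δ

/-- The relative error of `|ζ|²` after rescaling. -/
noncomputable def scaledErr (δ t x : ℝ) : ℝ := (1 + x ^ 2 - c.sqDist δ t (δ * x) / δ ^ 2) / δ

theorem scaled_of_mem {δ t x : ℝ} (hδ : 0 < δ) (hD : 0 < c.sqDist δ t (δ * x))
    (hx : δ * x ∈ Ioc (-(c.l / 2)) (c.l / 2)) : c.scaled δ t x =
      -c.κ t / (c.sqDist δ t (δ * x) / δ ^ 2) ^ 2 + c.scaledErr δ t x *
        (1 / (c.sqDist δ t (δ * x) / δ ^ 2 * (1 + x ^ 2) ^ 2) +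
          1 / ((c.sqDist δ t (δ * x) / δ ^ 2) ^ 2 * (1 + x ^ 2))) := by
  have hE : 1 + x ^ 2 ≠ 0 := by positivity
  rw [scaled, indicator_of_mem hx, scaledErr, singPart]
  have := hD.ne'
  have := hδ.ne'
  generalize c.sqDist δ t (δ * x) = D at *
  field_simp
  ring

theorem exists_scaledErr_bound : ∃ M, 1 ≤ M ∧ (∀ t, |c.κ t| ≤ M) ∧ ∀ δ t x, 0 < δ →
    |c.scaledErr δ t x| ≤ M * (δ * x ^ 4 + 2 * x ^ 2) ∧
    |c.scaledErr δ t x - c.κ t * x ^ 2| ≤ M * (δ * x ^ 4 + 2 * (δ * |x| ^ 3)) := by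
  obtain ⟨M, hM, hk, he⟩ := c.exists_expansions
  refine ⟨M, hM, hk, fun δ t x hδ => ?_⟩
  obtain ⟨-, hB, -, hB', -, hQ, -⟩ := he t (δ * x)
  set Q := ‖c.γ t - c.γ (t + δ * x)‖ ^ 2 with hQd
  set B := ((c.γ t - c.γ (t + δ * x)) * (starRingEnd ℂ) (c.T t)).im with hBd
  have e : c.scaledErr δ t x = ((δ * x) ^ 2 - Q) / δ ^ 3 - 2 * B / δ ^ 2 := by
    rw [scaledErr, sqDist, ← hQd, ← hBd]
    field_simp
    ring
  have e' : c.scaledErr δ t x - c.κ t * x ^ 2 =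
      ((δ * x) ^ 2 - Q) / δ ^ 3 - 2 * (B + c.κ t * (δ * x) ^ 2 / 2) / δ ^ 2 := by
    rw [e]
    field_simp
    ring
  have h1 : |((δ * x) ^ 2 - Q) / δ ^ 3| ≤ M * (δ * x ^ 4) := by
    rw [abs_div, abs_of_pos (pow_pos hδ 3), div_le_iff₀ (pow_pos hδ 3)]
    refine hQ.trans (le_of_eq ?_)
    ring
  constructor
  · have h2 : |2 * B / δ ^ 2| ≤ M * (2 * x ^ 2) := by
      rw [abs_div, abs_of_pos (pow_pos hδ 2), div_le_iff₀ (pow_pos hδ 2), abs_mul, abs_two]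
      rw [sq_abs] at hB
      calc 2 * |B| ≤ 2 * (M * (δ * x) ^ 2) := by gcongr
        _ = _ := by ring
    rw [e]
    exact (abs_sub _ _).trans ((add_le_add h1 h2).trans (le_of_eq (by ring)))
  · have h2 : |2 * (B + c.κ t * (δ * x) ^ 2 / 2) / δ ^ 2| ≤ M * (2 * (δ * |x| ^ 3)) := by
      rw [abs_div, abs_of_pos (pow_pos hδ 2), div_le_iff₀ (pow_pos hδ 2), abs_mul, abs_two]
      rw [abs_mul δ x, abs_of_pos hδ] at hB'
      calc 2 * |B + c.κ t * (δ * x) ^ 2 / 2| ≤ 2 * (M * (δ * |x|) ^ 3) := by gcongr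
        _ = _ := by ring
    rw [e']
    exact (abs_sub _ _).trans ((add_le_add h1 h2).trans (le_of_eq (by ring)))

theorem exists_scaled_bound : ∃ C δ₁, 0 < δ₁ ∧ ∀ δ t x, 0 < δ → δ < δ₁ →
    |c.scaled δ t x| ≤ C * (1 + x ^ 2)⁻¹ := by
  obtain ⟨M, hM, hk, he⟩ := c.exists_scaledErr_bound
  obtain ⟨c₁, δ₁, hc₁, hc₁', hδ₁, hδ₁', hD⟩ := c.exists_sqDist_lower_bound
  have hM0 : 0 < M := by linarith
  have hl := c.l_pos
  refine ⟨2 / c.l + (M / c₁ ^ 2 + M * (c.l / 2 + 2) * (2 / c₁ ^ 2)), δ₁, hδ₁,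
    fun δ t x hδ hδ' => ?_⟩
  set E := 1 + x ^ 2 with hE
  have hE1 : 1 ≤ E := by rw [hE]; nlinarith [sq_nonneg x]
  have hE0 : 0 < E := by linarith
  have hxE : |x| ≤ E := by rw [hE, ← sq_abs]; nlinarith [sq_nonneg (|x| - 1), abs_nonneg x]
  have hC2 : 0 ≤ M / c₁ ^ 2 + M * (c.l / 2 + 2) * (2 / c₁ ^ 2) := by positivity
  have hEi : 0 < E⁻¹ := by positivity
  by_cases hx : δ * x ∈ Ioc (-(c.l / 2)) (c.l / 2)
  · have hu : |δ * x| ≤ c.l / 2 := abs_le.2 ⟨hx.1.le, hx.2⟩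
    have hDl := hD δ t (δ * x) hδ.le hδ' hu
    have hd : c₁ * E ≤ c.sqDist δ t (δ * x) / δ ^ 2 := by
      rw [le_div_iff₀ (pow_pos hδ 2)]
      refine le_trans (le_of_eq ?_) hDl
      rw [hE]; ring
    have hDp : 0 < c.sqDist δ t (δ * x) := lt_of_lt_of_le (by positivity) hDl
    rw [c.scaled_of_mem hδ hDp hx, ← hE]
    set d := c.sqDist δ t (δ * x) / δ ^ 2
    have hd0 : 0 < d := lt_of_lt_of_le (by positivity) hd
    have p1 : |-c.κ t / d ^ 2| ≤ M / c₁ ^ 2 * E⁻¹ := by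
      rw [abs_div, abs_neg, abs_of_pos (pow_pos hd0 2)]
      have : c₁ ^ 2 * E ≤ d ^ 2 := by
        calc c₁ ^ 2 * E ≤ c₁ ^ 2 * E ^ 2 := by gcongr; nlinarith
          _ = (c₁ * E) ^ 2 := by ring
          _ ≤ d ^ 2 := by gcongr
      rw [div_mul_eq_mul_div, ← div_eq_mul_inv, div_div, mul_comm E]
      exact div_le_div₀ hM0.le (hk t) (by positivity) this
    have p2 : |c.scaledErr δ t x| ≤ M * (c.l / 2 + 2) * E ^ 2 := by
      refine (he δ t x hδ).1.trans ?_
      rw [mul_assoc]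
      refine mul_le_mul_of_nonneg_left ?_ hM0.le
      rw [abs_mul, abs_of_pos hδ] at hu
      have h1 : x ^ 4 = |x| * |x| ^ 3 := by
        have h : |x| ^ 4 = x ^ 4 := by
          rw [show (4 : ℕ) = 2 * 2 by norm_num, pow_mul, pow_mul, sq_abs]
        rw [← h]; ring
      have h2 : δ * x ^ 4 ≤ c.l / 2 * |x| ^ 3 := by
        rw [h1, ← mul_assoc]; gcongr
      have h3 : |x| ^ 3 ≤ E ^ 2 := by
        have : |x| ^ 2 ≤ E := by rw [hE, sq_abs]; linarith
        calc |x| ^ 3 = |x| * |x| ^ 2 := by ring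
          _ ≤ E * E := by gcongr
          _ = E ^ 2 := by ring
      have h4 : x ^ 2 ≤ E ^ 2 := by
        have : x ^ 2 ≤ E := by rw [hE]; linarith
        nlinarith
      have : c.l / 2 * |x| ^ 3 ≤ c.l / 2 * E ^ 2 := by gcongr
      linarith
    have p3 : 1 / (d * E ^ 2) + 1 / (d ^ 2 * E) ≤ 2 / c₁ ^ 2 * (E ^ 3)⁻¹ := by
      have h1 : 1 / (d * E ^ 2) ≤ 1 / (c₁ ^ 2 * E ^ 3) := by
        refine one_div_le_one_div_of_le (by positivity) ?_
        calc c₁ ^ 2 * E ^ 3 = (c₁ * E) * (c₁ * E ^ 2) := by ring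
          _ ≤ d * (1 * E ^ 2) := by gcongr
          _ = _ := by ring
      have h2 : 1 / (d ^ 2 * E) ≤ 1 / (c₁ ^ 2 * E ^ 3) := by
        refine one_div_le_one_div_of_le (by positivity) ?_
        calc c₁ ^ 2 * E ^ 3 = (c₁ * E) ^ 2 * E := by ring
          _ ≤ d ^ 2 * E := by gcongr
      refine (add_le_add h1 h2).trans (le_of_eq ?_)
      field_simp
      norm_num
    have p4 : |c.scaledErr δ t x * (1 / (d * E ^ 2) + 1 / (d ^ 2 * E))| ≤
        M * (c.l / 2 + 2) * (2 / c₁ ^ 2) * E⁻¹ := by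
      rw [abs_mul, abs_of_pos (by positivity : 0 < 1 / (d * E ^ 2) + 1 / (d ^ 2 * E))]
      refine (mul_le_mul p2 p3 (by positivity) (by positivity)).trans (le_of_eq ?_)
      field_simp
    refine (abs_add_le _ _).trans ((add_le_add p1 p4).trans ?_)
    have : 0 ≤ 2 / c.l * E⁻¹ := by positivity
    linarith
  · have hu : c.l / 2 ≤ δ * |x| := by
      by_contra hn
      rw [not_le, ← abs_of_pos hδ, ← abs_mul, abs_lt] at hn
      exact hx ⟨hn.1, hn.2.le⟩
    rw [scaled, indicator_of_notMem hx, zero_sub, abs_div, abs_neg, abs_of_pos hδ,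
      abs_of_pos (by positivity), ← hE]
    have h1 : 1 / E ^ 2 / δ ≤ 2 / c.l * E⁻¹ := by
      rw [div_div, div_le_iff₀ (by positivity)]
      have : 1 ≤ 2 / c.l * (δ * E) := by
        rw [div_mul_eq_mul_div, le_div_iff₀ hl]
        nlinarith
      calc 1 ≤ 2 / c.l * (δ * E) := this
        _ = _ := by field_simp
    have : 0 ≤ (M / c₁ ^ 2 + M * (c.l / 2 + 2) * (2 / c₁ ^ 2)) * E⁻¹ := by positivity
    linarith

theorem tendsto_scaled (t x : ℝ) : Tendsto (fun δ => c.scaled δ t x) (𝓝[>] 0)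
    (𝓝 (c.κ t * ((x ^ 2 - 1) / (1 + x ^ 2) ^ 3))) := by
  obtain ⟨M, hM, hk, he⟩ := c.exists_scaledErr_bound
  obtain ⟨c₁, δ₁, hc₁, hc₁', hδ₁, hδ₁', hD⟩ := c.exists_sqDist_lower_bound
  have hE0 : 0 < 1 + x ^ 2 := by positivity
  have hid : Tendsto (fun δ : ℝ => δ) (𝓝[>] 0) (𝓝 0) := tendsto_id.mono_left nhdsWithin_le_nhds
  have herr : Tendsto (fun δ => c.scaledErr δ t x) (𝓝[>] 0) (𝓝 (c.κ t * x ^ 2)) := by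
    rw [tendsto_iff_norm_sub_tendsto_zero]
    have hb : Tendsto (fun δ : ℝ => M * (δ * x ^ 4 + 2 * (δ * |x| ^ 3))) (𝓝[>] 0) (𝓝 0) := by
      have : Continuous fun δ : ℝ => M * (δ * x ^ 4 + 2 * (δ * |x| ^ 3)) := by fun_prop
      have := (this.tendsto 0).mono_left (nhdsWithin_le_nhds (s := Ioi 0))
      simpa using this
    refine squeeze_zero' (.of_forall fun _ => norm_nonneg _) ?_ hb
    filter_upwards [self_mem_nhdsWithin] with δ hδ
    exact (he δ t x hδ).2
  have hd : Tendsto (fun δ => c.sqDist δ t (δ * x) / δ ^ 2) (𝓝[>] 0) (𝓝 (1 + x ^ 2)) := by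
    have h1 : Tendsto (fun δ => 1 + x ^ 2 - δ * c.scaledErr δ t x) (𝓝[>] 0)
        (𝓝 (1 + x ^ 2 - 0 * (c.κ t * x ^ 2))) := tendsto_const_nhds.sub (hid.mul herr)
    rw [zero_mul, sub_zero] at h1
    refine h1.congr' ?_
    filter_upwards [self_mem_nhdsWithin] with δ hδ
    have : δ ≠ 0 := (mem_Ioi.1 hδ).ne'
    rw [scaledErr]
    field_simp
    ring
  have hlim : Tendsto (fun δ => -c.κ t / (c.sqDist δ t (δ * x) / δ ^ 2) ^ 2 +
      c.scaledErr δ t x * (1 / (c.sqDist δ t (δ * x) / δ ^ 2 * (1 + x ^ 2) ^ 2) +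
        1 / ((c.sqDist δ t (δ * x) / δ ^ 2) ^ 2 * (1 + x ^ 2)))) (𝓝[>] 0)
      (𝓝 (-c.κ t / (1 + x ^ 2) ^ 2 + c.κ t * x ^ 2 * (1 / ((1 + x ^ 2) * (1 + x ^ 2) ^ 2) +
        1 / ((1 + x ^ 2) ^ 2 * (1 + x ^ 2))))) := by
    refine (tendsto_const_nhds.div (hd.pow 2) (by positivity)).add (herr.mul
      ((tendsto_const_nhds.div (hd.mul tendsto_const_nhds) (by positivity)).add
      (tendsto_const_nhds.div ((hd.pow 2).mul tendsto_const_nhds) (by positivity))))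
  have hval : -c.κ t / (1 + x ^ 2) ^ 2 + c.κ t * x ^ 2 * (1 / ((1 + x ^ 2) * (1 + x ^ 2) ^ 2) +
        1 / ((1 + x ^ 2) ^ 2 * (1 + x ^ 2))) = c.κ t * ((x ^ 2 - 1) / (1 + x ^ 2) ^ 3) := by
    field_simp
    ring
  rw [hval] at hlim
  refine hlim.congr' ?_
  have hx0 : Tendsto (fun δ : ℝ => δ * x) (𝓝[>] 0) (𝓝 0) := by simpa using hid.mul_const x
  filter_upwards [Ioo_mem_nhdsGT hδ₁, hx0.eventually
    (Ioo_mem_nhds (neg_lt_zero.2 (half_pos c.l_pos)) (half_pos c.l_pos))] with δ hδ hx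
  have hu : |δ * x| ≤ c.l / 2 := abs_le.2 ⟨hx.1.le, hx.2.le⟩
  have hDl := hD δ t (δ * x) hδ.1.le hδ.2 hu
  have hδ0 : 0 < δ := hδ.1
  exact (c.scaled_of_mem hδ.1 (lt_of_lt_of_le (by positivity) hDl) ⟨hx.1, hx.2.le⟩).symm

theorem measurable_scaled (δ : ℝ) : Measurable fun x : ℝ × ℝ => c.scaled δ x.1 x.2 := by
  unfold scaled
  refine Measurable.div_const (Measurable.sub ?_ (by fun_prop)) _
  have h1 : Measurable fun x : ℝ × ℝ => δ ^ 2 * c.singPart δ x.1 (δ * x.2) :=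
    ((c.measurable_singPart δ).comp
      (by fun_prop : Measurable fun x : ℝ × ℝ => (x.1, δ * x.2))).const_mul _
  have h2 : MeasurableSet {x : ℝ × ℝ | δ * x.2 ∈ Ioc (-(c.l / 2)) (c.l / 2)} :=
    (by fun_prop : Measurable fun x : ℝ × ℝ => δ * x.2) measurableSet_Ioc
  convert! h1.indicator h2 using 1

theorem exists_singPart_bound : ∃ δ₁, 0 < δ₁ ∧ ∀ δ, 0 < δ → δ < δ₁ → ∃ C, ∀ t u, |u| ≤ c.l / 2 →
    |c.singPart δ t u| ≤ C := by
  obtain ⟨M, hM, hk, -⟩ := c.exists_expansions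
  obtain ⟨c₁, δ₁, hc₁, hc₁', hδ₁, hδ₁', hD⟩ := c.exists_sqDist_lower_bound
  refine ⟨δ₁, hδ₁, fun δ hδ hδ' => ⟨(1 + M) * δ ^ 2 / (c₁ * δ ^ 2) ^ 2, fun t u hu => ?_⟩⟩
  have hDl := hD δ t u hδ.le hδ' hu
  have h1 : c₁ * δ ^ 2 ≤ c.sqDist δ t u := by nlinarith [sq_nonneg u]
  have n4 : |1 - δ * c.κ t| ≤ 1 + M := by
    refine (abs_sub _ _).trans ?_
    rw [abs_one, abs_mul, abs_of_pos hδ]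
    have := mul_le_mul (hδ'.le.trans hδ₁') (hk t) (abs_nonneg _) zero_le_one
    linarith
  have h0 : 0 < c₁ * δ ^ 2 := by positivity
  rw [singPart, abs_div, abs_mul, abs_of_pos (pow_pos hδ 2),
    abs_of_pos (pow_pos (h0.trans_le h1) 2)]
  gcongr

theorem integral_scaled {δ : ℝ} (hδ : 0 < δ) (t : ℝ)
    (hi : IntegrableOn (c.singPart δ t) (Ioc (-(c.l / 2)) (c.l / 2))) :
    ∫ x, c.scaled δ t x =
      (∫ u in Ioc (-(c.l / 2)) (c.l / 2), c.singPart δ t u) - Real.pi / (2 * δ) := by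
  have h1 : Integrable ((Ioc (-(c.l / 2)) (c.l / 2)).indicator
      fun u => δ ^ 2 * c.singPart δ t u) :=
    (integrable_indicator_iff measurableSet_Ioc).2 (hi.const_mul _)
  unfold scaled
  rw [integral_div, integral_sub (h1.comp_mul_left' hδ.ne') integral_inv_sq.1,
    integral_inv_sq.2, Measure.integral_comp_mul_left, integral_indicator measurableSet_Ioc,
    integral_const_mul, abs_of_pos (inv_pos.2 hδ), smul_eq_mul]
  field_simp

theorem tendsto_integral_singPart :
    Tendsto (fun δ => (∫ x in Ioc 0 c.l ×ˢ Ioc (-(c.l / 2)) (c.l / 2), c.singPart δ x.1 x.2) -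
      Real.pi / (2 * δ) * c.l) (𝓝[>] 0) (𝓝 (-(Real.pi / 4) * ∫ t in 0..c.l, c.κ t)) := by
  obtain ⟨C, δ₁, hδ₁, hb⟩ := c.exists_scaled_bound
  obtain ⟨δ₂, hδ₂, hs⟩ := c.exists_singPart_bound
  have hbi : Integrable (fun x : ℝ × ℝ => (1 : ℝ) * (C * (1 + x.2 ^ 2)⁻¹))
      ((volume.restrict (Ioc 0 c.l)).prod volume) :=
    Integrable.mul_prod (f := fun _ : ℝ => (1 : ℝ)) (g := fun x : ℝ => C * (1 + x ^ 2)⁻¹)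
      (integrable_const _) (integrable_inv_one_add_sq.const_mul _)
  have hlim : Tendsto (fun δ => ∫ x, c.scaled δ x.1 x.2
      ∂((volume.restrict (Ioc 0 c.l)).prod volume)) (𝓝[>] 0)
      (𝓝 (∫ x, c.κ x.1 * ((x.2 ^ 2 - 1) / (1 + x.2 ^ 2) ^ 3)
        ∂((volume.restrict (Ioc 0 c.l)).prod (volume : Measure ℝ)))) := by
    refine tendsto_integral_filter_of_dominated_convergence _ ?_ ?_ hbi ?_
    · exact .of_forall fun δ => (c.measurable_scaled δ).aestronglyMeasurable
    · filter_upwards [Ioo_mem_nhdsGT hδ₁] with δ hδ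
      refine .of_forall fun x => ?_
      rw [one_mul]
      exact hb δ x.1 x.2 hδ.1 hδ.2
    · exact .of_forall fun x => c.tendsto_scaled x.1 x.2
  rw [integral_prod_mul (fun t => c.κ t) (fun x : ℝ => (x ^ 2 - 1) / (1 + x ^ 2) ^ 3),
    integral_sub_div_cube.2, ← c.interval_eq, mul_comm] at hlim
  refine hlim.congr' ?_
  filter_upwards [Ioo_mem_nhdsGT hδ₁, Ioo_mem_nhdsGT hδ₂] with δ hδ hδ'
  obtain ⟨C', hC'⟩ := hs δ hδ'.1 hδ'.2
  have hm : MeasurableSet (Ioc 0 c.l ×ˢ Ioc (-(c.l / 2)) (c.l / 2)) :=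
    measurableSet_Ioc.prod measurableSet_Ioc
  have hfin : volume (Ioc 0 c.l ×ˢ Ioc (-(c.l / 2)) (c.l / 2)) ≠ ⊤ := by
    rw [Measure.volume_eq_prod, Measure.prod_prod]
    exact ENNReal.mul_ne_top measure_Ioc_lt_top.ne measure_Ioc_lt_top.ne
  have hsi : IntegrableOn (fun x : ℝ × ℝ => c.singPart δ x.1 x.2)
      (Ioc 0 c.l ×ˢ Ioc (-(c.l / 2)) (c.l / 2)) := by
    refine Integrable.mono' (integrableOn_const hfin (C := C'))
      (c.measurable_singPart δ).aestronglyMeasurable ?_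
    filter_upwards [ae_restrict_mem hm] with x hx
    exact hC' x.1 x.2 (abs_le.2 ⟨hx.2.1.le, hx.2.2⟩)
  have hst : ∀ t, IntegrableOn (c.singPart δ t) (Ioc (-(c.l / 2)) (c.l / 2)) := fun t => by
    refine Integrable.mono' (integrableOn_const measure_Ioc_lt_top.ne (C := C'))
      ((c.measurable_singPart δ).comp measurable_prodMk_left).aestronglyMeasurable ?_
    filter_upwards [ae_restrict_mem measurableSet_Ioc] with u hu
    exact hC' t u (abs_le.2 ⟨hu.1.le, hu.2⟩)
  have hgi : Integrable (fun x : ℝ × ℝ => c.scaled δ x.1 x.2)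
      ((volume.restrict (Ioc 0 c.l)).prod volume) := by
    refine hbi.mono' (c.measurable_scaled δ).aestronglyMeasurable (.of_forall fun x => ?_)
    rw [one_mul]
    exact hb δ x.1 x.2 hδ.1 hδ.2
  rw [integral_prod _ hgi]
  simp only [c.integral_scaled hδ.1 _ (hst _)]
  rw [Measure.volume_eq_prod, setIntegral_prod _ hsi]
  have hout : IntegrableOn (fun t => ∫ u in Ioc (-(c.l / 2)) (c.l / 2), c.singPart δ t u)
      (Ioc 0 c.l) := by
    rw [IntegrableOn, Measure.volume_eq_prod, ← Measure.prod_restrict] at hsi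
    exact hsi.integral_prod_left
  rw [integral_sub hout (integrable_const _), setIntegral_const]
  simp [c.l_pos.le]
  ring

end ArcLoop

theorem integral_prod_shift {l : ℝ} (hl : 0 < l) {f : ℝ × ℝ → ℝ} (hf : Measurable f) {C : ℝ}
    (hb : ∀ x, |f x| ≤ C) (hp : ∀ s t, f (s + l, t) = f (s, t)) :
    ∫ x in Ioc 0 l ×ˢ Ioc 0 l, f x =
      ∫ x in Ioc 0 l ×ˢ Ioc (-(l / 2)) (l / 2), f (x.1 + x.2, x.1) := by
  have hfin : ∀ a b a' b' : ℝ, volume (Ioc a b ×ˢ Ioc a' b') ≠ ⊤ := fun a b a' b' => by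
    rw [Measure.volume_eq_prod, Measure.prod_prod]
    exact ENNReal.mul_ne_top measure_Ioc_lt_top.ne measure_Ioc_lt_top.ne
  have h1 : IntegrableOn f (Ioc 0 l ×ˢ Ioc 0 l) :=
    (integrableOn_const (hfin _ _ _ _) (C := C)).mono' hf.aestronglyMeasurable (.of_forall hb)
  have h2 : IntegrableOn (fun x : ℝ × ℝ => f (x.1 + x.2, x.1))
      (Ioc 0 l ×ˢ Ioc (-(l / 2)) (l / 2)) :=
    (integrableOn_const (hfin _ _ _ _) (C := C)).mono'
      (hf.comp (by fun_prop : Measurable fun x : ℝ × ℝ => (x.1 + x.2, x.1))).aestronglyMeasurable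
      (.of_forall fun x => hb _)
  rw [Measure.volume_eq_prod, setIntegral_prod _ h2, ← Measure.prod_restrict, integral_prod_symm]
  · congr 1
    funext t
    have hper : Function.Periodic (fun s => f (s, t)) l := fun s => hp s t
    have e1 := hper.intervalIntegral_add_eq 0 (t - l / 2)
    rw [zero_add] at e1
    rw [← intervalIntegral.integral_of_le hl.le, e1,
      ← intervalIntegral.integral_of_le (by linarith)]
    rw [intervalIntegral.integral_comp_add_left (fun s => f (s, t))]
    congr 1
    ring
  · rw [Measure.prod_restrict]; exact h1

namespace ArcLoop

variable (c d : ArcLoop)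

theorem dens_congr {s s' t t' : ℝ} (δ : ℝ) (hs : c.γ s = c.γ s') (ht : d.γ t = d.γ t') :
    c.dens d δ s t = c.dens d δ s' t' := by
  rw [dens, dens, hs, c.T_eq_of_γ_eq hs, d.T_eq_of_γ_eq ht, d.tube_eq_of_γ_eq ht, jac, jac,
    d.κ_eq_of_γ_eq ht]

theorem measurable_dens (δ : ℝ) : Measurable fun x : ℝ × ℝ => c.dens d δ x.1 x.2 := by
  have h1 := c.continuous_γ
  have h2 := c.continuous_T
  have h1' := d.continuous_γ
  have h2' := d.continuous_T
  have h3 := d.continuous_κ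
  unfold dens jac tube
  refine Measurable.div (Continuous.measurable ?_) (Continuous.measurable ?_) <;> fun_prop

theorem continuousOn_dens {D : Set (ℝ × ℝ × ℝ)}
    (h : ∀ x ∈ D, d.tube x.2.2 x.1 ≠ c.γ x.2.1) :
    ContinuousOn (fun x : ℝ × ℝ × ℝ => c.dens d x.1 x.2.1 x.2.2) D := by
  have h1 := c.continuous_γ
  have h2 := c.continuous_T
  have h1' := d.continuous_γ
  have h2' := d.continuous_T
  have h3 := d.continuous_κ
  unfold dens
  refine ContinuousOn.div (Continuous.continuousOn ?_) (Continuous.continuousOn ?_)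
    fun x hx => pow_ne_zero 4 (norm_ne_zero_iff.2 (sub_ne_zero.2 (h x hx)))
  all_goals unfold tube
  · unfold jac; fun_prop
  · fun_prop

theorem continuous_dens {δ : ℝ} (h : ∀ s t, d.tube t δ ≠ c.γ s) :
    Continuous fun x : ℝ × ℝ => c.dens d δ x.1 x.2 :=
  (c.continuousOn_dens d (D := {x | x.1 = δ}) (fun x hx => by rw [hx]; exact h _ _)).comp_continuous
    (by fun_prop : Continuous fun x : ℝ × ℝ => (δ, x)) fun x => rfl

theorem integrableOn_dens {δ : ℝ} (h : ∀ s t, d.tube t δ ≠ c.γ s) :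
    IntegrableOn (fun x : ℝ × ℝ => c.dens d δ x.1 x.2) (Ioc 0 c.l ×ˢ Ioc 0 d.l) :=
  ((c.continuous_dens d h).continuousOn.integrableOn_compact
    (isCompact_Icc.prod isCompact_Icc)).mono_set
    (prod_mono Ioc_subset_Icc_self Ioc_subset_Icc_self)

theorem exists_dens_bound {a b : ℝ}
    (h : ∀ δ ∈ Icc a b, ∀ s t, d.tube t δ ≠ c.γ s) :
    ∃ C, ∀ δ ∈ Icc a b, ∀ s t, |c.dens d δ s t| ≤ C := by
  obtain ⟨C, hC⟩ := (isCompact_Icc.prod (isCompact_Icc.prod isCompact_Icc)).exists_bound_of_continuousOn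
    (c.continuousOn_dens d (D := Icc a b ×ˢ Icc 0 c.l ×ˢ Icc 0 d.l) fun x hx => h _ hx.1 _ _)
  refine ⟨C, fun δ hδ s t => ?_⟩
  obtain ⟨s', hs', es⟩ := c.exists_mem_Ico s
  obtain ⟨t', ht', et⟩ := d.exists_mem_Ico t
  rw [← c.dens_congr d δ es et]
  exact hC (δ, s', t') ⟨hδ, Ico_subset_Icc_self hs', Ico_subset_Icc_self ht'⟩

theorem exists_dens_zero_bound : ∃ C, ∀ s t, |c.dens c 0 s t| ≤ C := by
  obtain ⟨C, δ₁, hC, hδ₁, hb⟩ := c.exists_regPart_bound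
  refine ⟨C, fun s t => ?_⟩
  obtain ⟨u, hu, e⟩ := c.exists_γ_eq_add t s
  rw [c.dens_congr c 0 e rfl, dens_zero_eq]
  exact hb 0 t u le_rfl hδ₁ hu

theorem tendsto_integral_dens_self {δ₀ : ℝ} (hδ₀ : 0 < δ₀)
    (h : ∀ δ, 0 < δ → δ < δ₀ → ∀ s t, c.tube t δ ≠ c.γ s) :
    Tendsto (fun δ => (∫ x in Ioc 0 c.l ×ˢ Ioc 0 c.l, c.dens c δ x.1 x.2) -
      Real.pi / (2 * δ) * c.l) (𝓝[>] 0)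
      (𝓝 ((∫ x in Ioc 0 c.l ×ˢ Ioc 0 c.l, c.dens c 0 x.1 x.2) -
        Real.pi / 4 * ∫ t in 0..c.l, c.κ t)) := by
  have hper : ∀ δ s t, c.dens c δ (s + c.l) t = c.dens c δ s t := fun δ s t =>
    c.dens_congr c δ (c.periodic s) rfl
  obtain ⟨C₀, hC₀⟩ := c.exists_dens_zero_bound
  have e0 := integral_prod_shift c.l_pos (c.measurable_dens c 0) (fun x => hC₀ x.1 x.2)
    (hper 0)
  simp only [dens_zero_eq] at e0
  rw [e0, sub_eq_add_neg, ← neg_mul]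
  refine (c.tendsto_integral_regPart.add c.tendsto_integral_singPart).congr' ?_
  obtain ⟨C₁, δ₁, hC₁, hδ₁, hb₁⟩ := c.exists_regPart_bound
  obtain ⟨δ₂, hδ₂, hb₂⟩ := c.exists_singPart_bound
  filter_upwards [Ioo_mem_nhdsGT hδ₀, Ioo_mem_nhdsGT hδ₁, Ioo_mem_nhdsGT hδ₂] with δ h0 h1 h2
  obtain ⟨C, hC⟩ := c.exists_dens_bound c (a := δ) (b := δ) fun δ' hδ' => by
    rw [Icc_self, mem_singleton_iff] at hδ'
    rw [hδ']
    exact h δ h0.1 h0.2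
  obtain ⟨C₂, hC₂⟩ := hb₂ δ h2.1 h2.2
  rw [integral_prod_shift c.l_pos (c.measurable_dens c δ)
    (fun x => hC δ (left_mem_Icc.2 le_rfl) x.1 x.2) (hper δ)]
  simp only [dens_eq_add]
  have hm : MeasurableSet (Ioc 0 c.l ×ˢ Ioc (-(c.l / 2)) (c.l / 2)) :=
    measurableSet_Ioc.prod measurableSet_Ioc
  have hfin : volume (Ioc 0 c.l ×ˢ Ioc (-(c.l / 2)) (c.l / 2)) ≠ ⊤ := by
    rw [Measure.volume_eq_prod, Measure.prod_prod]
    exact ENNReal.mul_ne_top measure_Ioc_lt_top.ne measure_Ioc_lt_top.ne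
  rw [integral_add]
  · ring
  · refine (integrableOn_const hfin (C := C₁)).mono' (c.measurable_regPart δ).aestronglyMeasurable ?_
    filter_upwards [ae_restrict_mem hm] with x hx
    exact hb₁ δ x.1 x.2 h1.1.le h1.2 (abs_le.2 ⟨hx.2.1.le, hx.2.2⟩)
  · refine (integrableOn_const hfin (C := C₂)).mono' (c.measurable_singPart δ).aestronglyMeasurable ?_
    filter_upwards [ae_restrict_mem hm] with x hx
    exact hC₂ x.1 x.2 (abs_le.2 ⟨hx.2.1.le, hx.2.2⟩)

theorem tendsto_integral_dens {δ₀ : ℝ} (hδ₀ : 0 < δ₀)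
    (h : ∀ δ, 0 ≤ δ → δ < δ₀ → ∀ s t, d.tube t δ ≠ c.γ s) :
    Tendsto (fun δ => ∫ x in Ioc 0 c.l ×ˢ Ioc 0 d.l, c.dens d δ x.1 x.2) (𝓝[>] 0)
      (𝓝 (∫ x in Ioc 0 c.l ×ˢ Ioc 0 d.l, c.dens d 0 x.1 x.2)) := by
  have hI : ∀ δ ∈ Icc 0 (δ₀ / 2), ∀ s t, d.tube t δ ≠ c.γ s := fun δ hδ =>
    h δ hδ.1 (by linarith [hδ.2])
  obtain ⟨C, hC⟩ := c.exists_dens_bound d hI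
  have hfin : volume (Ioc 0 c.l ×ˢ Ioc 0 d.l) ≠ ⊤ := by
    rw [Measure.volume_eq_prod, Measure.prod_prod]
    exact ENNReal.mul_ne_top measure_Ioc_lt_top.ne measure_Ioc_lt_top.ne
  have hmem : ∀ᶠ δ in 𝓝[>] (0 : ℝ), δ ∈ Icc 0 (δ₀ / 2) := by
    filter_upwards [Ioo_mem_nhdsGT (half_pos hδ₀)] with δ hδ using Ioo_subset_Icc_self hδ
  refine tendsto_integral_filter_of_dominated_convergence (fun _ => C)
    (.of_forall fun δ => (c.measurable_dens d δ).aestronglyMeasurable) ?_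
    (integrableOn_const hfin) (.of_forall fun x => ?_)
  · filter_upwards [hmem] with δ hδ
    exact .of_forall fun x => hC δ hδ x.1 x.2
  · have hc := (c.continuousOn_dens d (D := Icc 0 (δ₀ / 2) ×ˢ univ) fun y hy => hI _ hy.1 _ _)
      (0, x) ⟨⟨le_rfl, by positivity⟩, mem_univ _⟩
    have ht : Tendsto (fun δ : ℝ => (δ, x)) (𝓝[>] 0)
        (𝓝[Icc 0 (δ₀ / 2) ×ˢ univ] ((0 : ℝ), x)) := by
      refine tendsto_nhdsWithin_iff.2 ⟨?_, hmem.mono fun δ hδ => ⟨hδ, mem_univ _⟩⟩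
      exact ((by fun_prop : Continuous fun δ : ℝ => (δ, x)).tendsto 0).mono_left nhdsWithin_le_nhds
    exact hc.tendsto.comp ht

end ArcLoop

namespace SmoothBoundary

variable {Ω : Set ℂ} {K : SmoothBoundary Ω} {δ₀ : ℝ}

theorem IsTubular.tube_ne (h : K.IsTubular δ₀) (i j : Fin K.k) {δ : ℝ} (hδ : 0 < δ)
    (hδ' : δ < δ₀) (s t : ℝ) : (K.loop j).tube t δ ≠ (K.loop i).γ s := fun e =>
  h.tube_notMem_frontier j t (by rwa [abs_of_pos hδ]) hδ.ne' (K.mem_frontier_iff.2 ⟨i, s, e.symm⟩)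

theorem IsTubular.truncatedEnergy_eq (h : K.IsTubular δ₀) (hΩ : IsClosed Ω) {δ : ℝ} (hδ : 0 < δ)
    (hδ' : δ < δ₀) : K.truncatedEnergy δ = Real.pi / (4 * δ) * K.length -
      1 / 2 * ∑ i, ∑ j, ∫ x in K.pairs i j, (K.loop i).dens (K.loop j) δ x.1 x.2 := by
  have hi := fun i j => (K.loop i).integrableOn_dens (K.loop j) (h.tube_ne i j hδ hδ')
  rw [truncatedEnergy, (h.integrableOn_renormalizedPotential hΩ hδ).2]
  have e1 : ∀ i, ∫ s in 0..(K.loop i).l, ∫ w in innerDomain Ω δ,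
      fderiv ℝ (newton ((K.loop i).γ s)) w ((K.loop i).N s) =
      -2 * ∑ j, ∫ x in K.pairs i j, (K.loop i).dens (K.loop j) δ x.1 x.2 := fun i => by
    have e2 : ∀ s, ∫ w in innerDomain Ω δ,
        fderiv ℝ (newton ((K.loop i).γ s)) w ((K.loop i).N s) =
        -2 * ∑ j, ∫ t in Ioc 0 (K.loop j).l, (K.loop i).dens (K.loop j) δ s t := fun s => by
      rw [h.setIntegral_fderiv_newton hΩ hδ hδ' (K.mem_frontier_iff.2 ⟨i, s, rfl⟩), Finset.mul_sum,
        ← Finset.sum_neg_distrib]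
      refine Finset.sum_congr rfl fun j _ => ?_
      rw [ArcLoop.integral_newton_eq _ _ (h.tube_ne i j hδ hδ' s), ArcLoop.interval_eq]
      ring
    simp only [e2]
    rw [ArcLoop.interval_eq, integral_const_mul, integral_finsetSum]
    · congr 1
      refine Finset.sum_congr rfl fun j _ => ?_
      exact (setIntegral_prod _ (hi i j)).symm
    · intro j _
      have := hi i j
      rw [IntegrableOn, Measure.volume_eq_prod, ← Measure.prod_restrict] at this
      exact this.integral_prod_left
  simp only [e1]
  rw [← Finset.mul_sum]
  ring

theorem sinDensity_eq (i j : Fin K.k) (x : ℝ × ℝ) :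
    K.sinDensity i j x = (K.loop i).dens (K.loop j) 0 x.1 x.2 := by
  have hsin : ∀ T v : ℂ, ‖T‖ = 1 → Real.sin (orientedAngle T v) =
      (v * (starRingEnd ℂ) T).im / ‖v‖ := fun T v hT => by
    rw [orientedAngle, Complex.sin_arg, norm_div, hT, div_one]
    congr 2
    have : T * (starRingEnd ℂ) T = 1 := by
      rw [Complex.mul_conj, Complex.normSq_eq_norm_sq, hT]; norm_num
    rw [div_eq_iff (by rintro rfl; simp at hT), mul_assoc, mul_comm _ T, this, mul_one]
  rw [sinDensity, angleP, angleQ, hsin _ _ (K.unit_speed _ _), hsin _ _ (K.unit_speed _ _),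
    ArcLoop.dens, ArcLoop.jac, ArcLoop.tube_zero]
  change (K.chord i j x * (starRingEnd ℂ) (deriv (K.γ i) x.1)).im / ‖K.chord i j x‖ *
    ((K.chord i j x * (starRingEnd ℂ) (deriv (K.γ j) x.2)).im / ‖K.chord i j x‖) /
    ‖K.chord i j x‖ ^ 2 = (1 - 0 * _) * ((K.chord i j x * (starRingEnd ℂ) (deriv (K.γ i) x.1)).im *
    (K.chord i j x * (starRingEnd ℂ) (deriv (K.γ j) x.2)).im) / ‖K.chord i j x‖ ^ 4
  rw [zero_mul, sub_zero, one_mul, div_mul_div_comm, div_div]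
  ring

theorem integrableOn_sinDensity (i j : Fin K.k) : IntegrableOn (K.sinDensity i j) (K.pairs i j) := by
  have e : K.sinDensity i j = fun x => (K.loop i).dens (K.loop j) 0 x.1 x.2 :=
    funext fun x => sinDensity_eq i j x
  rw [e]
  by_cases hij : i = j
  · subst hij
    obtain ⟨C, hC⟩ := (K.loop i).exists_dens_zero_bound
    refine (integrableOn_const (C := C) ?_).mono'
      ((K.loop i).measurable_dens _ 0).aestronglyMeasurable (.of_forall fun x => hC _ _)
    rw [pairs, Measure.volume_eq_prod, Measure.prod_prod]
    exact ENNReal.mul_ne_top measure_Ioc_lt_top.ne measure_Ioc_lt_top.ne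
  · refine (K.loop i).integrableOn_dens (K.loop j) fun s t => ?_
    rw [ArcLoop.tube_zero]
    exact (K.γ_ne hij s t).symm

theorem tendsto_truncatedEnergy (K : SmoothBoundary Ω) (hΩ : IsClosed Ω) :
    Tendsto K.truncatedEnergy (𝓝[>] 0)
      (𝓝 (-(1 / 2) * K.sinIntegral + Real.pi / 8 * K.totalCurvature)) := by
  obtain ⟨δ₀, h⟩ := K.exists_isTubular
  have key : ∀ i j, Tendsto (fun δ =>
      (∫ x in K.pairs i j, (K.loop i).dens (K.loop j) δ x.1 x.2) -
        if i = j then Real.pi / (2 * δ) * K.len i else 0) (𝓝[>] 0)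
      (𝓝 ((∫ x in K.pairs i j, K.sinDensity i j x) -
        if i = j then Real.pi / 4 * ∫ s in 0..K.len i, K.curvature i s else 0)) := fun i j => by
    simp only [sinDensity_eq]
    by_cases hij : i = j
    · subst hij
      simp only [if_true]
      exact (K.loop i).tendsto_integral_dens_self h.pos fun δ hδ hδ' s t => h.tube_ne i i hδ hδ' s t
    · simp only [if_neg hij, sub_zero]
      refine (K.loop i).tendsto_integral_dens (K.loop j) h.pos fun δ hδ hδ' s t => ?_
      rcases hδ.eq_or_lt with rfl | hδ
      · rw [ArcLoop.tube_zero]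
        exact (K.γ_ne hij s t).symm
      · exact h.tube_ne i j hδ hδ' s t
  have hsum := (tendsto_finsetSum Finset.univ fun i _ =>
    tendsto_finsetSum Finset.univ fun j _ => key i j).const_mul (-(1 / 2))
  have elim : -(1 / 2) * ∑ i, ∑ j, ((∫ x in K.pairs i j, K.sinDensity i j x) -
      if i = j then Real.pi / 4 * ∫ s in 0..K.len i, K.curvature i s else 0) =
      -(1 / 2) * K.sinIntegral + Real.pi / 8 * K.totalCurvature := by
    simp only [Finset.sum_sub_distrib, Finset.sum_ite_eq, Finset.mem_univ, if_true, sinIntegral,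
      totalCurvature, ← Finset.mul_sum]
    ring
  rw [elim] at hsum
  refine hsum.congr' ?_
  filter_upwards [Ioo_mem_nhdsGT h.pos] with δ hδ
  have hδ0 : δ ≠ 0 := hδ.1.ne'
  rw [h.truncatedEnergy_eq hΩ hδ.1 hδ.2]
  simp only [Finset.sum_sub_distrib, Finset.sum_ite_eq, Finset.mem_univ, if_true, length,
    ← Finset.mul_sum]
  field_simp
  ring

end SmoothBoundary

namespace ArcLoop

/-- The real part of the holomorphic density `dp dq / (q - p)²`. -/
noncomputable def holDens (c d : ArcLoop) (s t : ℝ) : ℝ :=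
  (c.T s * d.T t / (d.γ t - c.γ s) ^ 2).re

variable (c d : ArcLoop)

theorem abs_holDens_le (s t : ℝ) : |c.holDens d s t| ≤ 1 / ‖d.γ t - c.γ s‖ ^ 2 := by
  refine (Complex.abs_re_le_norm _).trans ?_
  rw [norm_div, norm_mul, c.norm_T, d.norm_T, norm_pow, one_mul]

theorem measurable_holDens : Measurable fun x : ℝ × ℝ => c.holDens d x.1 x.2 := by
  have h1 := c.continuous_γ
  have h2 := c.continuous_T
  have h1' := d.continuous_γ
  have h2' := d.continuous_T
  unfold holDens
  refine Complex.measurable_re.comp (Measurable.div (Continuous.measurable ?_)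
    (Continuous.measurable ?_)) <;> fun_prop

theorem hasDerivAt_re_div {s t : ℝ} (h : d.γ t ≠ c.γ s) :
    HasDerivAt (fun t => -(c.T s / (d.γ t - c.γ s)).re) (c.holDens d s t) t := by
  have h1 := ((((d.hasDerivAt_γ t).sub_const (c.γ s)).inv (sub_ne_zero.2 h)).const_mul (c.T s)).neg
  have h2 := Complex.reCLM.hasFDerivAt.comp_hasDerivAt t h1
  convert! h2 using 1
  simp only [holDens, Complex.reCLM_apply]
  congr 1
  ring

theorem continuousOn_holDens {s : ℝ} {D : Set ℝ} (h : ∀ t ∈ D, d.γ t ≠ c.γ s) :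
    ContinuousOn (fun t => c.holDens d s t) D := by
  have h1' := d.continuous_γ
  have h2' := d.continuous_T
  unfold holDens
  refine Complex.continuous_re.comp_continuousOn (ContinuousOn.div (Continuous.continuousOn ?_)
    (Continuous.continuousOn ?_) fun t ht => pow_ne_zero 2 (sub_ne_zero.2 (h t ht))) <;> fun_prop

theorem integral_holDens {s a b : ℝ} (h : ∀ t ∈ uIcc a b, d.γ t ≠ c.γ s) :
    ∫ t in a..b, c.holDens d s t =
      (c.T s / (d.γ a - c.γ s)).re - (c.T s / (d.γ b - c.γ s)).re := by
  rw [intervalIntegral.integral_eq_sub_of_hasDerivAt (fun t ht => c.hasDerivAt_re_div d (h t ht))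
    (c.continuousOn_holDens d h).intervalIntegrable]
  ring

theorem exists_re_div_bound : ∃ C, 0 ≤ C ∧ ∀ t u, u ≠ 0 → |u| ≤ c.l / 2 →
    |(c.T t / (c.γ (t + u) - c.γ t)).re - 1 / u| ≤ C * |u| := by
  obtain ⟨M, hM, -, he⟩ := c.exists_expansions
  obtain ⟨c₀, hc₀, hc₀', hlow⟩ := c.exists_chord_lower_bound
  refine ⟨2 * M / c₀ ^ 2, by positivity, fun t u hu hu' => ?_⟩
  obtain ⟨-, -, -, -, -, hQ, hR⟩ := he t u
  have hl := hlow t u hu'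
  set z := c.γ (t + u) - c.γ t
  have hz : c.γ t - c.γ (t + u) = -z := by simp [z]
  rw [hz] at hQ hR
  rw [norm_neg] at hQ
  have hup : 0 < |u| := abs_pos.2 hu
  have hzp : 0 < ‖z‖ := lt_of_lt_of_le (by positivity) hl
  have hz0 : z ≠ 0 := norm_pos_iff.1 hzp
  set R := (z * (starRingEnd ℂ) (c.T t)).re with hRdef
  have hR' : |u - R| ≤ M * |u| ^ 3 := by
    rw [neg_mul, Complex.neg_re, neg_add_eq_sub] at hR
    exact hR
  have e : (c.T t / z).re = R / ‖z‖ ^ 2 := by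
    rw [Complex.div_re, ← Complex.normSq_eq_norm_sq, hRdef, ← add_div]
    congr 1
    simp
    ring
  have e2 : R / ‖z‖ ^ 2 - 1 / u = ((u ^ 2 - ‖z‖ ^ 2) - u * (u - R)) / (u * ‖z‖ ^ 2) := by
    field_simp
    ring
  rw [e, e2, abs_div, abs_mul, abs_of_pos (pow_pos hzp 2), div_le_iff₀ (by positivity)]
  have h4 : u ^ 4 = |u| ^ 4 := (Even.pow_abs (by decide) u).symm
  have n1 : |u ^ 2 - ‖z‖ ^ 2 - u * (u - R)| ≤ 2 * M * |u| ^ 4 := by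
    refine (abs_sub _ _).trans ?_
    rw [abs_mul]
    rw [h4] at hQ
    have := mul_le_mul_of_nonneg_left hR' hup.le
    nlinarith
  refine n1.trans ?_
  have n2 : (c₀ * |u|) ^ 2 ≤ ‖z‖ ^ 2 := by gcongr
  calc 2 * M * |u| ^ 4 = 2 * M / c₀ ^ 2 * |u| * (|u| * (c₀ * |u|) ^ 2) := by field_simp
    _ ≤ _ := by gcongr

theorem integral_holDens_outer {ε : ℝ} (hε : 0 < ε) (hε' : ε < c.l / 2) (t : ℝ) :
    IntegrableOn (fun u => c.holDens c t (t + u)) (Ioo (-(c.l / 2)) (-ε) ∪ Ioc ε (c.l / 2)) ∧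
    ∫ u in Ioo (-(c.l / 2)) (-ε) ∪ Ioc ε (c.l / 2), c.holDens c t (t + u) =
      (c.T t / (c.γ (t + ε) - c.γ t)).re - (c.T t / (c.γ (t + -ε) - c.γ t)).re := by
  have hl := c.l_pos
  have hne1 : ∀ x ∈ uIcc (t + -(c.l / 2)) (t + -ε), c.γ x ≠ c.γ t := fun x hx => by
    rw [uIcc_of_le (by linarith)] at hx
    have := c.γ_add_ne (s := t) (u := x - t) (by linarith [hx.2]) (by
      rw [abs_lt]; constructor <;> linarith [hx.1, hx.2])
    rwa [add_sub_cancel] at this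
  have hne2 : ∀ x ∈ uIcc (t + ε) (t + c.l / 2), c.γ x ≠ c.γ t := fun x hx => by
    rw [uIcc_of_le (by linarith)] at hx
    have := c.γ_add_ne (s := t) (u := x - t) (by linarith [hx.1]) (by
      rw [abs_lt]; constructor <;> linarith [hx.1, hx.2])
    rwa [add_sub_cancel] at this
  have i1 := (c.continuousOn_holDens c hne1).intervalIntegrable.comp_add_left t (a := t + -(c.l / 2)) (b := t + -ε)
  have i2 := (c.continuousOn_holDens c hne2).intervalIntegrable.comp_add_left t (a := t + ε) (b := t + c.l / 2)
  simp only [add_sub_cancel_left] at i1 i2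
  have j1 : IntegrableOn (fun u => c.holDens c t (t + u)) (Ioo (-(c.l / 2)) (-ε)) :=
    ((intervalIntegrable_iff_integrableOn_Ioc_of_le (by linarith)).1 i1).mono_set Ioo_subset_Ioc_self
  have j2 : IntegrableOn (fun u => c.holDens c t (t + u)) (Ioc ε (c.l / 2)) :=
    (intervalIntegrable_iff_integrableOn_Ioc_of_le (by linarith)).1 i2
  refine ⟨j1.union j2, ?_⟩
  rw [setIntegral_union ?_ measurableSet_Ioc j1 j2, ← integral_Ioc_eq_integral_Ioo,
    ← intervalIntegral.integral_of_le (by linarith), ← intervalIntegral.integral_of_le (by linarith),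
    intervalIntegral.integral_comp_add_left (fun x => c.holDens c t x),
    intervalIntegral.integral_comp_add_left (fun x => c.holDens c t x),
    c.integral_holDens c hne1, c.integral_holDens c hne2]
  · have : c.γ (t + c.l / 2) = c.γ (t + -(c.l / 2)) := by
      rw [← c.periodic (t + -(c.l / 2))]
      congr 1
      ring
    rw [this]
    ring
  · rw [Set.disjoint_left]
    intro x hx hx'
    linarith [hx.2, hx'.1]

/-- The integral over `{u : |γ (t + u) - γ t| > ε}` is `2 / ε + O(ε)`. -/
theorem exists_integral_holDens_bound : ∃ C ε₀, 0 ≤ C ∧ 0 < ε₀ ∧ ∀ ε t, 0 < ε → ε < ε₀ →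
    |(∫ u in Ioc (-(c.l / 2)) (c.l / 2), {u | ε < ‖c.γ (t + u) - c.γ t‖}.indicator
      (fun u => c.holDens c t (t + u)) u) - 2 / ε| ≤ C * ε := by
  obtain ⟨C, hC, hb⟩ := c.exists_re_div_bound
  obtain ⟨M, hM, -, he⟩ := c.exists_expansions
  obtain ⟨c₀, hc₀, hc₀', hlow⟩ := c.exists_chord_lower_bound
  have hl := c.l_pos
  refine ⟨2 * C + 2 * (M / c₀ ^ 4) / c₀ ^ 2, c.l / 2, by positivity, by positivity,
    fun ε t hε hε' => ?_⟩
  obtain ⟨io, eo⟩ := c.integral_holDens_outer hε hε' t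
  set h := fun u => c.holDens c t (t + u) with hh
  set I := Ioc (-(c.l / 2)) (c.l / 2)
  set A := {u : ℝ | ε < ‖c.γ (t + u) - c.γ t‖}
  set B := {u : ℝ | ε < |u|}
  have hγ := c.continuous_γ
  have hA : MeasurableSet A := (isOpen_lt continuous_const (by fun_prop)).measurableSet
  have hB : MeasurableSet B := (isOpen_lt continuous_const continuous_abs).measurableSet
  have hAB : A ⊆ B := fun u hu => lt_of_lt_of_le hu (c.norm_chord_le t u)
  have hIB : I ∩ B = Ioo (-(c.l / 2)) (-ε) ∪ Ioc ε (c.l / 2) := by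
    ext u
    simp only [I, B, mem_inter_iff, mem_Ioc, mem_ofPred_eq, lt_abs, mem_union, mem_Ioo]
    constructor
    · rintro ⟨⟨h1, h2⟩, h3 | h3⟩
      · exact Or.inr ⟨h3, h2⟩
      · exact Or.inl ⟨h1, by linarith⟩
    · rintro (⟨h1, h2⟩ | ⟨h1, h2⟩)
      · exact ⟨⟨h1, by linarith⟩, Or.inr (by linarith)⟩
      · exact ⟨⟨by linarith, h2⟩, Or.inl h1⟩
  have iB : IntegrableOn (B.indicator h) I := by
    rw [IntegrableOn, integrable_indicator_iff hB, IntegrableOn, Measure.restrict_restrict hB,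
      inter_comm, hIB]
    exact io
  have iA : IntegrableOn (A.indicator h) I := by
    have : A.indicator h = A.indicator (B.indicator h) := by
      rw [indicator_indicator, inter_eq_left.2 hAB]
    rw [this]
    exact iB.indicator hA
  have eB : ∫ u in I, B.indicator h u =
      (c.T t / (c.γ (t + ε) - c.γ t)).re - (c.T t / (c.γ (t + -ε) - c.γ t)).re := by
    rw [setIntegral_indicator hB, hIB, eo]
  have b1 : |(∫ u in I, B.indicator h u) - 2 / ε| ≤ 2 * C * ε := by
    have h1 := hb t ε hε.ne' (by rw [abs_of_pos hε]; exact hε'.le)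
    have h2 := hb t (-ε) (neg_ne_zero.2 hε.ne') (by rw [abs_neg, abs_of_pos hε]; exact hε'.le)
    rw [abs_neg] at h2
    rw [abs_of_pos hε] at h1 h2
    rw [eB]
    refine (le_of_eq ?_).trans ((abs_sub _ _).trans ((add_le_add h1 h2).trans (le_of_eq (by ring))))
    congr 1
    field_simp
    ring
  have b2 : |(∫ u in I, A.indicator h u) - ∫ u in I, B.indicator h u| ≤
      2 * (M / c₀ ^ 4) / c₀ ^ 2 * ε := by
    set b := ε + M / c₀ ^ 4 * ε ^ 3
    have hbε : 0 ≤ M / c₀ ^ 4 * ε ^ 3 := by positivity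
    have hdom : ∀ u ∈ I, ‖A.indicator h u - B.indicator h u‖ ≤
        (Icc (-b) (-ε) ∪ Icc ε b).indicator (fun _ => 1 / (c₀ * ε) ^ 2) u := fun u hu => by
      have hnn : 0 ≤ (Icc (-b) (-ε) ∪ Icc ε b).indicator (fun _ => 1 / (c₀ * ε) ^ 2) u :=
        indicator_nonneg (fun _ _ => by positivity) _
      by_cases hA' : u ∈ A
      · rw [indicator_of_mem hA', indicator_of_mem (hAB hA'), sub_self, norm_zero]
        exact hnn
      rw [indicator_of_notMem hA', zero_sub, norm_neg]
      by_cases hB' : u ∈ B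
      · have hub : |u| ≤ c.l / 2 := abs_le.2 ⟨hu.1.le, hu.2⟩
        have hlu := hlow t u hub
        have hεu : ε < |u| := hB'
        have hcu : ‖c.γ (t + u) - c.γ t‖ ≤ ε := not_lt.1 hA'
        have hle : |u| ≤ b := by
          obtain ⟨-, -, -, -, -, hQ, -⟩ := he t u
          rw [norm_sub_rev] at hQ
          have hQ' := (le_abs_self _).trans hQ
          have h4 : u ^ 4 = |u| ^ 4 := (Even.pow_abs (by decide) u).symm
          rw [h4, ← sq_abs] at hQ'
          have hu1 : |u| ≤ ε / c₀ := by
            rw [le_div_iff₀ hc₀, mul_comm]; exact hlu.trans hcu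
          have hu4 : M * |u| ^ 4 ≤ M / c₀ ^ 4 * ε ^ 3 * ε := by
            calc M * |u| ^ 4 ≤ M * (ε / c₀) ^ 4 := by gcongr
              _ = _ := by field_simp
          have hsq : ‖c.γ (t + u) - c.γ t‖ ^ 2 ≤ ε ^ 2 := by gcongr
          have hx : (|u| - ε) * (|u| + ε) ≤ M / c₀ ^ 4 * ε ^ 3 * ε := by nlinarith
          have hx2 : (|u| - ε) * ε ≤ M / c₀ ^ 4 * ε ^ 3 * ε := by
            refine le_trans ?_ hx
            have : 0 ≤ |u| - ε := by linarith
            nlinarith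
          have := le_of_mul_le_mul_right hx2 hε
          linarith
        have hmem : u ∈ Icc (-b) (-ε) ∪ Icc ε b := by
          rcases le_total 0 u with h0 | h0
          · rw [abs_of_nonneg h0] at hεu hle
            exact Or.inr ⟨hεu.le, hle⟩
          · rw [abs_of_nonpos h0] at hεu hle
            exact Or.inl ⟨by linarith, by linarith⟩
        rw [indicator_of_mem hB', indicator_of_mem hmem, Real.norm_eq_abs]
        refine (c.abs_holDens_le c t (t + u)).trans ?_
        have : c₀ * ε ≤ ‖c.γ (t + u) - c.γ t‖ := le_trans (by gcongr) hlu
        gcongr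
      · rw [indicator_of_notMem hB', norm_zero]
        exact hnn
    rw [← integral_sub iA iB, ← Real.norm_eq_abs]
    have hmU : MeasurableSet (Icc (-b) (-ε) ∪ Icc ε b) := measurableSet_Icc.union measurableSet_Icc
    have hvol : volume.real (Icc (-b) (-ε) ∪ Icc ε b) ≤ 2 * (M / c₀ ^ 4 * ε ^ 3) := by
      refine (measureReal_union_le _ _).trans ?_
      rw [Real.volume_real_Icc_of_le (by linarith), Real.volume_real_Icc_of_le (by linarith)]
      linarith
    have hUfin : volume (Icc (-b) (-ε) ∪ Icc ε b) ≠ ⊤ :=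
      (measure_union_lt_top measure_Icc_lt_top measure_Icc_lt_top).ne
    have hint : Integrable ((Icc (-b) (-ε) ∪ Icc ε b).indicator fun _ => 1 / (c₀ * ε) ^ 2) :=
      (integrable_indicator_iff hmU).2 (integrableOn_const hUfin)
    refine (norm_integral_le_of_norm_le hint.integrableOn
      ((ae_restrict_mem measurableSet_Ioc).mono hdom)).trans ?_
    refine (setIntegral_le_integral hint (.of_forall fun x =>
      indicator_nonneg (fun _ _ => by positivity) _)).trans ?_
    rw [integral_indicator hmU, setIntegral_const, smul_eq_mul]
    refine (mul_le_mul_of_nonneg_right hvol (by positivity)).trans (le_of_eq ?_)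
    field_simp
  calc _ = |((∫ u in I, A.indicator h u) - ∫ u in I, B.indicator h u) +
        ((∫ u in I, B.indicator h u) - 2 / ε)| := by congr 1; ring
    _ ≤ _ := (abs_add_le _ _).trans ((add_le_add b2 b1).trans (le_of_eq (by ring)))

theorem tendsto_integral_holDens_self :
    Tendsto (fun ε => (∫ x in (Ioc 0 c.l ×ˢ Ioc 0 c.l) ∩ {x | ε < ‖c.γ x.2 - c.γ x.1‖},
      c.holDens c x.1 x.2) - 2 / ε * c.l) (𝓝[>] 0) (𝓝 0) := by
  obtain ⟨C, ε₀, hC, hε₀, hb⟩ := c.exists_integral_holDens_bound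
  have hl := c.l_pos
  have hlim : Tendsto (fun ε : ℝ => C * ε * c.l) (𝓝[>] 0) (𝓝 0) := by
    have h : Continuous fun ε : ℝ => C * ε * c.l := by fun_prop
    have := (h.tendsto 0).mono_left (nhdsWithin_le_nhds (s := Ioi 0))
    simpa using this
  refine squeeze_zero_norm' ?_ hlim
  filter_upwards [Ioo_mem_nhdsGT hε₀] with ε hε
  have hγ := c.continuous_γ
  have hS : MeasurableSet {x : ℝ × ℝ | ε < ‖c.γ x.2 - c.γ x.1‖} :=
    (isOpen_lt continuous_const (by fun_prop)).measurableSet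
  have hε0 := hε.1
  set f := {x : ℝ × ℝ | ε < ‖c.γ x.2 - c.γ x.1‖}.indicator fun x => c.holDens c x.1 x.2
  have hf : Measurable f := (c.measurable_holDens c).indicator hS
  have hfb : ∀ x, |f x| ≤ 1 / ε ^ 2 := fun x => by
    by_cases hx : ε < ‖c.γ x.2 - c.γ x.1‖
    · rw [show f x = c.holDens c x.1 x.2 from indicator_of_mem (s := {x : ℝ × ℝ | ε < ‖c.γ x.2 - c.γ x.1‖}) hx _]
      refine (c.abs_holDens_le c _ _).trans ?_
      gcongr
    · rw [show f x = 0 from indicator_of_notMem (s := {x : ℝ × ℝ | ε < ‖c.γ x.2 - c.γ x.1‖}) hx _, abs_zero]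
      positivity
  have hfp : ∀ s t, f (s + c.l, t) = f (s, t) := fun s t => by
    simp only [f, indicator, holDens, mem_ofPred_eq, c.periodic s, c.periodic_T s]
  have hfe : ∀ t u, f (t + u, t) = {u | ε < ‖c.γ (t + u) - c.γ t‖}.indicator
      (fun u => c.holDens c t (t + u)) u := fun t u => by
    simp only [f, indicator, holDens, mem_ofPred_eq, norm_sub_rev (c.γ t), mul_comm (c.T (t + u))]
    rw [← neg_sub (c.γ (t + u)), neg_sq]
  have hfin : volume (Ioc 0 c.l ×ˢ Ioc (-(c.l / 2)) (c.l / 2)) ≠ ⊤ := by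
    rw [Measure.volume_eq_prod, Measure.prod_prod]
    exact ENNReal.mul_ne_top measure_Ioc_lt_top.ne measure_Ioc_lt_top.ne
  have hfi : IntegrableOn (fun x : ℝ × ℝ => f (x.1 + x.2, x.1))
      (Ioc 0 c.l ×ˢ Ioc (-(c.l / 2)) (c.l / 2)) :=
    (integrableOn_const hfin (C := 1 / ε ^ 2)).mono'
      (hf.comp (by fun_prop : Measurable fun x : ℝ × ℝ => (x.1 + x.2, x.1))).aestronglyMeasurable
      (.of_forall fun x => hfb _)
  have hout : IntegrableOn (fun t => ∫ u in Ioc (-(c.l / 2)) (c.l / 2), f (t + u, t))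
      (Ioc 0 c.l) := by
    have := hfi
    rw [IntegrableOn, Measure.volume_eq_prod, ← Measure.prod_restrict] at this
    exact this.integral_prod_left
  have hconst : 2 / ε * c.l = ∫ t in Ioc 0 c.l, 2 / ε := by
    rw [setIntegral_const, Real.volume_real_Ioc_of_le hl.le, smul_eq_mul]; ring
  rw [← setIntegral_indicator hS, integral_prod_shift hl hf hfb hfp, Measure.volume_eq_prod,
    setIntegral_prod _ hfi, hconst, ← integral_sub hout (integrable_const _)]
  refine (norm_setIntegral_le_of_norm_le_const measure_Ioc_lt_top (C := C * ε) fun t _ => ?_).trans ?_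
  · simp only [hfe]
    exact hb ε t hε.1 hε.2
  · rw [Real.volume_real_Ioc_of_le hl.le, sub_zero]

theorem integral_holDens_eq_zero (h : ∀ s t, d.γ t ≠ c.γ s) :
    IntegrableOn (fun x : ℝ × ℝ => c.holDens d x.1 x.2) (Ioc 0 c.l ×ˢ Ioc 0 d.l) ∧
    ∫ x in Ioc 0 c.l ×ˢ Ioc 0 d.l, c.holDens d x.1 x.2 = 0 := by
  have hc : Continuous fun x : ℝ × ℝ => c.holDens d x.1 x.2 := by
    have h1 := c.continuous_γ
    have h2 := c.continuous_T
    have h1' := d.continuous_γ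
    have h2' := d.continuous_T
    unfold holDens
    refine Complex.continuous_re.comp (Continuous.div (by fun_prop) (by fun_prop)
      fun x => pow_ne_zero 2 (sub_ne_zero.2 (h _ _)))
  have hi : IntegrableOn (fun x : ℝ × ℝ => c.holDens d x.1 x.2) (Ioc 0 c.l ×ˢ Ioc 0 d.l) :=
    (hc.continuousOn.integrableOn_compact (isCompact_Icc.prod isCompact_Icc)).mono_set
      (prod_mono Ioc_subset_Icc_self Ioc_subset_Icc_self)
  refine ⟨hi, ?_⟩
  rw [Measure.volume_eq_prod, setIntegral_prod _ hi]
  have e : ∀ s, ∫ t in Ioc 0 d.l, c.holDens d s t = 0 := fun s => by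
    have := d.periodic 0
    rw [zero_add] at this
    rw [← d.interval_eq, c.integral_holDens d fun t _ => h s t, this, sub_self]
  simp only [e, integral_zero]

end ArcLoop

namespace SmoothBoundary

variable {Ω : Set ℂ} {K : SmoothBoundary Ω}

theorem cosDensity_eq (i j : Fin K.k) {x : ℝ × ℝ} (hx : K.chord i j x ≠ 0) :
    K.cosDensity i j x = (K.loop i).holDens (K.loop j) x.1 x.2 + K.sinDensity i j x := by
  have key : ∀ T v : ℂ, ‖T‖ = 1 → v ≠ 0 → Real.cos (orientedAngle T v) =
      (v * (starRingEnd ℂ) T).re / ‖v‖ ∧ Real.sin (orientedAngle T v) =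
      (v * (starRingEnd ℂ) T).im / ‖v‖ := fun T v hT hv => by
    have hT0 : T ≠ 0 := by rintro rfl; simp at hT
    have e : v / T = v * (starRingEnd ℂ) T := by
      have : T * (starRingEnd ℂ) T = 1 := by
        rw [Complex.mul_conj, Complex.normSq_eq_norm_sq, hT]; norm_num
      rw [div_eq_iff hT0, mul_assoc, mul_comm _ T, this, mul_one]
    rw [orientedAngle, Complex.sin_arg, Complex.cos_arg (div_ne_zero hv hT0), norm_div, hT, div_one,
      e]
    exact ⟨rfl, rfl⟩
  obtain ⟨c1, s1⟩ := key _ _ (K.unit_speed i x.1) hx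
  obtain ⟨c2, s2⟩ := key _ _ (K.unit_speed j x.2) hx
  rw [cosDensity, sinDensity, angleP, angleQ, c1, c2, s1, s2, ArcLoop.holDens]
  change _ = (deriv (K.γ i) x.1 * deriv (K.γ j) x.2 / K.chord i j x ^ 2).re + _
  set v := K.chord i j x
  set a := deriv (K.γ i) x.1
  set b := deriv (K.γ j) x.2
  have hv : (‖v‖ : ℂ) ≠ 0 := by exact_mod_cast norm_ne_zero_iff.2 hx
  have hv' : ‖v‖ ≠ 0 := norm_ne_zero_iff.2 hx
  have e : a * b / v ^ 2 = (starRingEnd ℂ) (v * (starRingEnd ℂ) a * (v * (starRingEnd ℂ) b)) /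
      ((‖v‖ ^ 4 : ℝ) : ℂ) := by
    have h2 : v * (starRingEnd ℂ) v = (‖v‖ : ℂ) ^ 2 := by
      rw [Complex.mul_conj, Complex.normSq_eq_norm_sq]; norm_cast
    push_cast
    rw [div_eq_div_iff (pow_ne_zero 2 hx) (pow_ne_zero 4 hv)]
    simp only [map_mul, Complex.conj_conj]
    linear_combination (-a * b) * (v * (starRingEnd ℂ) v + (‖v‖ : ℂ) ^ 2) * h2
  rw [e, Complex.div_ofReal_re, Complex.conj_re, Complex.mul_re (v * (starRingEnd ℂ) a)]
  field_simp
  ring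

theorem tendsto_cosIntegral (K : SmoothBoundary Ω) :
    Tendsto (fun ε : ℝ => K.length / ε - 1 / 2 * K.cosIntegral ε) (𝓝[>] 0)
      (𝓝 (-(1 / 2) * K.sinIntegral)) := by
  obtain ⟨d, hd, hsep⟩ := K.exists_separation
  have hγ := fun i => (K.loop i).continuous_γ
  have hcont : ∀ i j, Continuous fun x : ℝ × ℝ => ‖K.chord i j x‖ := fun i j =>
    (((hγ j).comp continuous_snd).sub ((hγ i).comp continuous_fst)).norm
  have hS : ∀ i j (ε : ℝ), MeasurableSet {x : ℝ × ℝ | ε < ‖K.chord i j x‖} := fun i j ε =>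
    (isOpen_lt continuous_const (hcont i j)).measurableSet
  have hmp : ∀ i j, MeasurableSet (K.pairs i j) := fun i j =>
    measurableSet_Ioc.prod measurableSet_Ioc
  have hsin : ∀ i j, Tendsto (fun ε : ℝ => ∫ x in K.pairs i j ∩ {x | ε < ‖K.chord i j x‖},
      K.sinDensity i j x) (𝓝[>] 0) (𝓝 (∫ x in K.pairs i j, K.sinDensity i j x)) := fun i j => by
    simp only [← setIntegral_indicator (hS i j _)]
    have hi := K.integrableOn_sinDensity i j
    refine tendsto_integral_filter_of_dominated_convergence (fun x => ‖K.sinDensity i j x‖)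
      (.of_forall fun ε => hi.aestronglyMeasurable.indicator (hS i j ε))
      (.of_forall fun ε => .of_forall fun x => norm_indicator_le_norm_self _ _) hi.norm
      (.of_forall fun x => ?_)
    by_cases hx : K.chord i j x = 0
    · have h0 : K.sinDensity i j x = 0 := by simp [sinDensity, hx]
      refine tendsto_const_nhds.congr fun ε => ?_
      rw [indicator]
      split_ifs
      · rfl
      · exact h0
    · refine tendsto_const_nhds.congr' ?_
      filter_upwards [Ioo_mem_nhdsGT (norm_pos_iff.2 hx)] with ε hε
      exact (indicator_of_mem (s := {x : ℝ × ℝ | ε < ‖K.chord i j x‖}) hε.2 _).symm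
  have hhol : ∀ i j, Tendsto (fun ε : ℝ => (∫ x in K.pairs i j ∩ {x | ε < ‖K.chord i j x‖},
      (K.loop i).holDens (K.loop j) x.1 x.2) - if i = j then 2 / ε * K.len i else 0) (𝓝[>] 0)
      (𝓝 0) := fun i j => by
    by_cases hij : i = j
    · subst hij
      simp only [if_true]
      exact (K.loop i).tendsto_integral_holDens_self
    · simp only [if_neg hij, sub_zero]
      refine tendsto_const_nhds.congr' ?_
      filter_upwards [Ioo_mem_nhdsGT hd] with ε hε
      have : K.pairs i j ∩ {x | ε < ‖K.chord i j x‖} = K.pairs i j :=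
        inter_eq_left.2 fun x _ => hε.2.trans_le (hsep j i (Ne.symm hij) x.2 x.1)
      rw [this]
      exact ((K.loop i).integral_holDens_eq_zero (K.loop j)
        fun s t => (K.γ_ne hij s t).symm).2.symm
  have hholi : ∀ i j (ε : ℝ), 0 < ε → IntegrableOn
      (fun x : ℝ × ℝ => (K.loop i).holDens (K.loop j) x.1 x.2)
      (K.pairs i j ∩ {x | ε < ‖K.chord i j x‖}) := fun i j ε hε => by
    refine (integrableOn_const (C := 1 / ε ^ 2) ?_).mono'
      ((K.loop i).measurable_holDens (K.loop j)).aestronglyMeasurable ?_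
    · refine ((measure_mono inter_subset_left).trans_lt ?_).ne
      rw [pairs, Measure.volume_eq_prod, Measure.prod_prod]
      exact ENNReal.mul_lt_top measure_Ioc_lt_top measure_Ioc_lt_top
    · filter_upwards [ae_restrict_mem ((hmp i j).inter (hS i j ε))] with x hx
      refine ((K.loop i).abs_holDens_le (K.loop j) _ _).trans ?_
      have : ε < ‖(K.loop j).γ x.2 - (K.loop i).γ x.1‖ := hx.2
      gcongr
  have hsum := (tendsto_finsetSum Finset.univ fun i _ =>
    tendsto_finsetSum Finset.univ fun j _ => (hhol i j).add (hsin i j)).const_mul (-(1 / 2))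
  simp only [zero_add] at hsum
  refine hsum.congr' ?_
  filter_upwards [self_mem_nhdsWithin] with ε hε
  have hε0 : ε ≠ 0 := (mem_Ioi.1 hε).ne'
  have e : ∀ i j, ∫ x in K.pairs i j ∩ {x | ε < ‖K.chord i j x‖}, K.cosDensity i j x =
      (∫ x in K.pairs i j ∩ {x | ε < ‖K.chord i j x‖}, (K.loop i).holDens (K.loop j) x.1 x.2) +
      ∫ x in K.pairs i j ∩ {x | ε < ‖K.chord i j x‖}, K.sinDensity i j x := fun i j => by
    rw [← integral_add (hholi i j ε hε) ((K.integrableOn_sinDensity i j).mono_set inter_subset_left)]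
    refine setIntegral_congr_fun ((hmp i j).inter (hS i j ε)) fun x hx => ?_
    exact cosDensity_eq i j (norm_pos_iff.1 ((mem_Ioi.1 hε).trans hx.2))
  simp only [cosIntegral, e, Finset.sum_add_distrib, Finset.sum_sub_distrib, Finset.sum_ite_eq,
    Finset.mem_univ, if_true, length, ← Finset.mul_sum]
  field_simp
  ring

end SmoothBoundary

/-! ### Winding numbers and the total curvature -/

theorem IsPreconnected.eq_of_eventually_eq {X Y : Type*} [TopologicalSpace X] {S : Set X}
    (hS : IsPreconnected S) {f : X → Y} (h : ∀ x ∈ S, ∀ᶠ y in 𝓝[S] x, f y = f x) {x y : X}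
    (hx : x ∈ S) (hy : y ∈ S) : f x = f y := by
  have := Subtype.preconnectedSpace hS
  have hl : IsLocallyConstant fun z : S => f z := (IsLocallyConstant.iff_eventually_eq _).2 fun z => by
    have := h z z.2
    rw [nhdsWithin_eq_map_subtype_coe z.2] at this
    exact this
  exact hl.apply_eq_of_preconnectedSpace ⟨x, hx⟩ ⟨y, hy⟩

theorem HasDerivAt.arg_slitPlane {q : ℝ → ℂ} {q' : ℂ} {x : ℝ} (h : HasDerivAt q q' x)
    (hs : q x ∈ Complex.slitPlane) :
    HasDerivAt (fun x => Complex.arg (q x)) (q' / q x).im x := by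
  have := Complex.imCLM.hasFDerivAt.comp_hasDerivAt x (h.clog_real hs)
  convert! this using 1
  funext x
  simp [Complex.log_im]

theorem integral_im_div_eq_zero {q q' : ℝ → ℂ} {l : ℝ} (hq : ∀ x, HasDerivAt q (q' x) x)
    (hc : Continuous q') (hs : ∀ x, q x ∈ Complex.slitPlane) (hper : q l = q 0) :
    ∫ x in 0..l, (q' x / q x).im = 0 := by
  have hqc : Continuous q := continuous_iff_continuousAt.2 fun x => (hq x).continuousAt
  have hcont : Continuous fun x => (q' x / q x).im :=
    Complex.continuous_im.comp (hc.div hqc fun x => Complex.slitPlane_ne_zero (hs x))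
  rw [intervalIntegral.integral_eq_sub_of_hasDerivAt (fun x _ => (hq x).arg_slitPlane (hs x))
    (hcont.intervalIntegrable _ _), hper, sub_self]

theorem integral_im_div_eq {a a' b b' : ℝ → ℂ} {l : ℝ} (ha : ∀ x, HasDerivAt a (a' x) x)
    (hb : ∀ x, HasDerivAt b (b' x) x) (hac : Continuous a') (hbc : Continuous b') (hal : a l = a 0)
    (hbl : b l = b 0) (h : ∀ x, ‖a x - b x‖ < ‖b x‖) :
    ∫ x in 0..l, (a' x / a x).im = ∫ x in 0..l, (b' x / b x).im := by
  have hb0 : ∀ x, b x ≠ 0 := fun x => norm_pos_iff.1 ((norm_nonneg _).trans_lt (h x))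
  have ha0 : ∀ x, a x ≠ 0 := fun x e => by
    have := h x
    rw [e, zero_sub, norm_neg] at this
    exact lt_irrefl _ this
  have hca : Continuous a := continuous_iff_continuousAt.2 fun x => (ha x).continuousAt
  have hcb : Continuous b := continuous_iff_continuousAt.2 fun x => (hb x).continuousAt
  have key := integral_im_div_eq_zero (l := l) (fun x => (ha x).div (hb x) (hb0 x))
    ((by fun_prop : Continuous _).div (by fun_prop) fun x => pow_ne_zero 2 (hb0 x)) (fun x => by
      have : a x / b x = 1 + (a x - b x) / b x := by
        rw [eq_comm, ← div_self (hb0 x), ← add_div, add_sub_cancel]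
      change a x / b x ∈ _
      rw [this]
      refine Complex.mem_slitPlane_of_norm_lt_one ?_
      rw [norm_div, div_lt_one (norm_pos_iff.2 (hb0 x))]
      exact h x) (by simp only [Pi.div_apply, hal, hbl])
  have e : ∀ x, ((a' x * b x - a x * b' x) / b x ^ 2 / (a / b) x).im =
      (a' x / a x).im - (b' x / b x).im := fun x => by
    rw [← Complex.sub_im, Pi.div_apply]
    congr 1
    have := ha0 x
    have := hb0 x
    field_simp
  simp only [e] at key
  have ia : Continuous fun x => (a' x / a x).im := Complex.continuous_im.comp (hac.div hca ha0)
  have ib : Continuous fun x => (b' x / b x).im := Complex.continuous_im.comp (hbc.div hcb hb0)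
  rwa [intervalIntegral.integral_sub (ia.intervalIntegrable _ _) (ib.intervalIntegrable _ _),
    sub_eq_zero] at key

namespace ArcLoop

variable (c : ArcLoop)

/-- The winding number of the loop around `z`. -/
noncomputable def winding (z : ℂ) : ℝ :=
  1 / (2 * Real.pi) * ∫ s in 0..c.l, (c.T s / (c.γ s - z)).im

theorem winding_eq_of_norm_lt {z z' : ℂ} (h : ∀ s, ‖z - z'‖ < ‖c.γ s - z'‖) :
    c.winding z = c.winding z' := by
  have hp := c.periodic 0
  rw [zero_add] at hp
  rw [winding, winding, integral_im_div_eq (fun s => (c.hasDerivAt_γ s).sub_const z)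
    (fun s => (c.hasDerivAt_γ s).sub_const z') c.continuous_T c.continuous_T (by rw [hp])
    (by rw [hp]) fun s => ?_]
  rw [sub_sub_sub_cancel_left, norm_sub_rev]
  exact h s

theorem eventually_winding_eq {z' : ℂ} (h : z' ∉ range c.γ) :
    ∀ᶠ z in 𝓝 z', c.winding z = c.winding z' := by
  obtain ⟨r, hr, hb⟩ := Metric.isOpen_iff.1 c.isCompact_range.isClosed.isOpen_compl z' h
  filter_upwards [Metric.ball_mem_nhds z' hr] with z hz
  refine c.winding_eq_of_norm_lt fun s => ?_
  rw [← dist_eq_norm, ← dist_eq_norm]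
  refine (Metric.mem_ball.1 hz).trans_le (not_lt.1 fun hlt => ?_)
  exact hb (Metric.mem_ball.2 hlt) ⟨s, rfl⟩

theorem winding_eq_of_isPreconnected {S : Set ℂ} (hS : IsPreconnected S)
    (hd : ∀ z ∈ S, z ∉ range c.γ) {z z' : ℂ} (hz : z ∈ S) (hz' : z' ∈ S) :
    c.winding z = c.winding z' :=
  hS.eq_of_eventually_eq (fun x hx => (c.eventually_winding_eq (hd x hx)).filter_mono
    nhdsWithin_le_nhds) hz hz'

theorem tendsto_winding : Tendsto c.winding (cocompact ℂ) (𝓝 0) := by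
  obtain ⟨R, hR, hγ⟩ := exists_norm_le_of_periodic c.l_ne c.periodic c.continuous_γ
  have hb : Tendsto (fun z : ℂ => 1 / (2 * Real.pi) * (1 / (‖z‖ - R) * c.l)) (cocompact ℂ)
      (𝓝 (1 / (2 * Real.pi) * (0 * c.l))) := by
    refine Tendsto.const_mul _ (Tendsto.mul_const _ ?_)
    simp only [one_div]
    exact tendsto_inv_atTop_zero.comp
      (tendsto_atTop_add_const_right _ _ (tendsto_norm_cocompact_atTop (E := ℂ)))
  rw [zero_mul, mul_zero] at hb
  refine squeeze_zero_norm' ?_ hb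
  filter_upwards [(tendsto_norm_cocompact_atTop (E := ℂ)).eventually (eventually_gt_atTop R)]
    with z hz
  rw [winding, norm_mul, Real.norm_of_nonneg (by positivity)]
  refine mul_le_mul_of_nonneg_left ?_ (by positivity)
  refine (intervalIntegral.norm_integral_le_of_norm_le_const fun s _ => ?_).trans
    (le_of_eq (by rw [sub_zero, abs_of_pos c.l_pos]))
  refine (Complex.abs_im_le_norm _).trans ?_
  rw [norm_div, c.norm_T]
  refine one_div_le_one_div_of_le (by linarith) ?_
  have := norm_sub_norm_le z (c.γ s)
  rw [norm_sub_rev] at this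
  linarith [hγ s]

/-- The integrand of the winding number around a point of the curve. -/
noncomputable def turn (s t : ℝ) : ℝ := (c.T s / (c.γ s - c.γ t)).im

theorem turn_congr {s s' t t' : ℝ} (h : c.γ s = c.γ s') (h' : c.γ t = c.γ t') :
    c.turn s t = c.turn s' t' := by
  rw [turn, turn, h, h', c.T_eq_of_γ_eq h]

theorem measurable_turn : Measurable fun x : ℝ × ℝ => c.turn x.1 x.2 := by
  have h1 := c.continuous_γ
  have h2 := c.continuous_T
  unfold turn
  refine Complex.measurable_im.comp (Measurable.div (Continuous.measurable ?_)
    (Continuous.measurable ?_)) <;> fun_prop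

theorem exists_turn_bound : ∃ C, ∀ s t, |c.turn s t| ≤ C := by
  obtain ⟨M, hM, -, he⟩ := c.exists_expansions
  obtain ⟨c₀, hc₀, hc₀', hlow⟩ := c.exists_chord_lower_bound
  refine ⟨M / c₀ ^ 2, fun s t => ?_⟩
  obtain ⟨u, hu, e⟩ := c.exists_γ_eq_add t s
  rw [c.turn_congr e rfl, turn]
  by_cases h0 : u = 0
  · rw [h0, add_zero, sub_self, div_zero, Complex.zero_im, abs_zero]; positivity
  have hl := hlow t u hu
  have hup : 0 < |u| := abs_pos.2 h0
  have hA := (he t u).1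
  have e : (c.T (t + u) / (c.γ (t + u) - c.γ t)).im =
      ((c.γ t - c.γ (t + u)) * (starRingEnd ℂ) (c.T (t + u))).im /
        ‖c.γ (t + u) - c.γ t‖ ^ 2 := by
    rw [Complex.div_im, ← Complex.normSq_eq_norm_sq, ← sub_div]
    congr 1
    simp
    ring
  rw [e, abs_div, abs_of_nonneg (by positivity : 0 ≤ ‖c.γ (t + u) - c.γ t‖ ^ 2)]
  calc _ ≤ M * |u| ^ 2 / (c₀ * |u|) ^ 2 := by gcongr
    _ = _ := by field_simp

theorem integral_shift {f : ℝ → ℝ} (hf : Function.Periodic f c.l) (s : ℝ) :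
    ∫ u in 0..c.l, f (s + u) = ∫ u in 0..c.l, f u := by
  rw [intervalIntegral.integral_comp_add_left, add_zero, hf.intervalIntegral_add_eq s 0, zero_add]

theorem winding_eq_shift (s : ℝ) (z : ℂ) :
    2 * Real.pi * c.winding z = ∫ u in 0..c.l, (c.T (s + u) / (c.γ (s + u) - z)).im := by
  rw [c.integral_shift (f := fun u => (c.T u / (c.γ u - z)).im) (fun u => by
    simp only [c.periodic_T u, c.periodic u]) s, winding]
  have := Real.pi_ne_zero
  field_simp

theorem tendsto_inv_mul_chord (s : ℝ) :
    Tendsto (fun u : ℝ => (u : ℂ)⁻¹ * (c.γ (s + u) - c.γ s)) (𝓝[≠] 0) (𝓝 (c.T s)) := by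
  have := (c.hasDerivAt_γ s).tendsto_slope_zero
  simpa [Complex.real_smul] using this

theorem tendsto_sub_const_nhdsLT (l : ℝ) : Tendsto (fun u => u - l) (𝓝[<] l) (𝓝[<] 0) := by
  refine tendsto_nhdsWithin_iff.2 ⟨?_, ?_⟩
  · have : Continuous fun u => u - l := by fun_prop
    have := (this.tendsto l).mono_left (nhdsWithin_le_nhds (s := Iio l))
    rwa [sub_self] at this
  · filter_upwards [self_mem_nhdsWithin] with u hu
    exact mem_Iio.2 (sub_neg.2 hu)

theorem chord_eq_of_mem (s : ℝ) {t : ℝ} (H : ∀ τ, |τ| ≤ t → τ ≠ 0 → ∀ u, c.γ u ≠ c.tube s τ)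
    {u τ : ℝ} (hτ : |τ| ≤ t) (h : c.γ (s + u) - c.γ s = τ * (Complex.I * c.T s)) :
    c.γ (s + u) = c.γ s := by
  by_cases h0 : τ = 0
  · rw [h0, Complex.ofReal_zero, zero_mul, sub_eq_zero] at h
    exact h
  · refine (H τ hτ h0 (s + u) ?_).elim
    rw [tube, ← h]
    ring

theorem winding_jump (s : ℝ) {t : ℝ} (ht : 0 < t)
    (H : ∀ τ, |τ| ≤ t → τ ≠ 0 → ∀ u, c.γ u ≠ c.tube s τ) :
    c.winding (c.tube s t) - c.winding (c.tube s (-t)) = 1 := by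
  set d : ℝ → ℂ := fun u => c.γ (s + u) - c.γ s with hd
  set n : ℂ := t * (Complex.I * c.T s) with hn
  have hT := c.T_ne s
  have hn0 : n ≠ 0 := mul_ne_zero (by exact_mod_cast ht.ne') (mul_ne_zero Complex.I_ne_zero hT)
  have hm : ∀ u, d u - n ≠ 0 := fun u h => H t (abs_of_pos ht).le ht.ne' (s + u) (by
    rw [tube, ← hn, ← sub_eq_zero, ← h]; simp only [hd]; ring)
  have hp : ∀ u, d u + n ≠ 0 := fun u h => H (-t) (by rw [abs_neg, abs_of_pos ht])
    (neg_ne_zero.2 ht.ne') (s + u) (by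
    rw [tube, ← sub_eq_zero, ← h]; simp only [hd, hn]; push_cast; ring)
  have hdd : ∀ u, HasDerivAt d (c.T (s + u)) u := fun u =>
    ((c.hasDerivAt_γ (s + u)).comp_const_add s u).sub_const _
  have hdc : Continuous d := continuous_iff_continuousAt.2 fun u => (hdd u).continuousAt
  have hd0 : d 0 = 0 := by simp [hd]
  have hdper : ∀ u, d (u - c.l) = d u := fun u => by
    simp only [hd]
    rw [← c.periodic (s + (u - c.l))]
    congr 2
    ring
  set q : ℝ → ℂ := fun u => (d u - n) / (d u + n) with hq
  have hqc : Continuous q := (hdc.sub continuous_const).div (hdc.add continuous_const) hp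
  have hq0 : q 0 = -1 := by
    simp only [hq, hd0, zero_sub, zero_add]; rw [neg_div, div_self hn0]
  have hqper : ∀ u, q (u - c.l) = q u := fun u => by simp only [hq, hdper]
  have hqim : ∀ u, (q u).im = -(2 * t * (d u * (starRingEnd ℂ) (c.T s)).re) /
      Complex.normSq (d u + n) := fun u => by
    simp only [hq]
    rw [Complex.div_im, ← sub_div]
    congr 1
    simp [hn]
    ring
  have hqd : ∀ u, HasDerivAt q ((c.T (s + u) * (d u + n) - (d u - n) * c.T (s + u)) /
      (d u + n) ^ 2) u := fun u => ((hdd u).sub_const n).div ((hdd u).add_const n) (hp u)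
  have hslit : ∀ u ∈ Ioo 0 c.l, q u ∈ Complex.slitPlane := fun u hu => by
    by_contra hns
    rw [Complex.mem_slitPlane_iff, not_or, not_lt, not_not] at hns
    set x := -(q u).re with hx
    have hx0 : 0 ≤ x := by linarith [hns.1]
    have hqx : q u = ((-x : ℝ) : ℂ) := Complex.ext (by simp [hx]) (by simp [hns.2])
    have e1 : d u - n = ((-x : ℝ) : ℂ) * (d u + n) := by
      rw [← hqx]; simp only [hq]; rw [div_mul_cancel₀ _ (hp u)]
    have hx1 : ((1 + x : ℝ) : ℂ) ≠ 0 := by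
      exact_mod_cast (by linarith : (1 + x : ℝ) ≠ 0)
    have e2 : d u = ((t * ((1 - x) / (1 + x)) : ℝ) : ℂ) * (Complex.I * c.T s) := by
      have : d u * ((1 + x : ℝ) : ℂ) = n * ((1 - x : ℝ) : ℂ) := by
        push_cast at e1 ⊢
        linear_combination e1
      rw [← mul_left_inj' hx1, this, hn]
      push_cast at hx1 ⊢
      field_simp
    refine c.γ_add_ne hu.1.ne' (by rw [abs_of_pos hu.1]; exact hu.2) (c.chord_eq_of_mem s H ?_ e2)
    rw [abs_mul, abs_of_pos ht, abs_div, abs_of_pos (by linarith : 0 < 1 + x)]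
    refine mul_le_of_le_one_right ht.le ((div_le_one (by linarith)).2 (abs_le.2 ⟨?_, ?_⟩)) <;> linarith
  obtain ⟨M, hM, -, he⟩ := c.exists_expansions
  have hre : ∀ u, |(d u * (starRingEnd ℂ) (c.T s)).re - u| ≤ M * |u| ^ 3 := fun u => by
    have := (he s u).2.2.2.2.2.2
    have e : d u = -(c.γ s - c.γ (s + u)) := by simp [hd]
    rw [e, neg_mul, Complex.neg_re, ← abs_neg]
    convert! this using 2
    ring
  have hsmall : ∀ᶠ u : ℝ in 𝓝 0, M * u ^ 2 < 1 := by
    have : Continuous fun u : ℝ => M * u ^ 2 := by fun_prop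
    exact (this.tendsto 0).eventually_lt_const (by simp)
  have hns : ∀ u, 0 < Complex.normSq (d u + n) := fun u => Complex.normSq_pos.2 (hp u)
  have l1 : Tendsto (fun u => Complex.arg (q u)) (𝓝[>] 0) (𝓝 (-Real.pi)) := by
    refine (Complex.tendsto_arg_nhdsWithin_im_neg_of_re_neg_of_im_zero (z := -1) (by simp)
      (by simp)).comp (tendsto_nhdsWithin_iff.2 ⟨?_, ?_⟩)
    · rw [← hq0]; exact (hqc.tendsto 0).mono_left nhdsWithin_le_nhds
    · filter_upwards [self_mem_nhdsWithin, hsmall.filter_mono nhdsWithin_le_nhds] with u hu hu'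
      have hu0 : 0 < u := hu
      have h1 := (abs_le.1 (hre u)).1
      rw [abs_of_pos hu0] at h1
      have h2 : 0 < (d u * (starRingEnd ℂ) (c.T s)).re := by nlinarith
      change (q u).im < 0
      rw [hqim, neg_div, neg_lt_zero]
      exact div_pos (by positivity) (hns u)
  have l2 : Tendsto (fun u => Complex.arg (q u)) (𝓝[<] c.l) (𝓝 Real.pi) := by
    have : Tendsto (fun u => Complex.arg (q u)) (𝓝[<] 0) (𝓝 Real.pi) := by
      refine (Complex.tendsto_arg_nhdsWithin_im_nonneg_of_re_neg_of_im_zero (z := -1) (by simp)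
        (by simp)).comp (tendsto_nhdsWithin_iff.2 ⟨?_, ?_⟩)
      · rw [← hq0]; exact (hqc.tendsto 0).mono_left nhdsWithin_le_nhds
      · filter_upwards [self_mem_nhdsWithin, hsmall.filter_mono nhdsWithin_le_nhds] with u hu hu'
        have hu0 : u < 0 := hu
        have h1 := (abs_le.1 (hre u)).2
        rw [abs_of_neg hu0] at h1
        have h2 : (d u * (starRingEnd ℂ) (c.T s)).re < 0 := by nlinarith
        change 0 ≤ (q u).im
        rw [hqim]
        exact div_nonneg (by nlinarith) (hns u).le
    refine (this.comp (tendsto_sub_const_nhdsLT c.l)).congr fun u => ?_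
    simp only [Function.comp, hqper]
  have e : ∀ u, ((c.T (s + u) * (d u + n) - (d u - n) * c.T (s + u)) / (d u + n) ^ 2 / q u).im =
      (c.T (s + u) / (d u - n)).im - (c.T (s + u) / (d u + n)).im := fun u => by
    rw [← Complex.sub_im]
    congr 1
    have := hm u
    have := hp u
    simp only [hq]
    field_simp
  have hTc : Continuous fun u => c.T (s + u) := c.continuous_T.comp (by fun_prop)
  have i1 : Continuous fun u => (c.T (s + u) / (d u - n)).im :=
    Complex.continuous_im.comp (hTc.div (hdc.sub continuous_const) hm)
  have i2 : Continuous fun u => (c.T (s + u) / (d u + n)).im :=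
    Complex.continuous_im.comp (hTc.div (hdc.add continuous_const) hp)
  have key := intervalIntegral.integral_eq_sub_of_hasDerivAt_of_tendsto c.l_pos
    (fun u hu => (hqd u).arg_slitPlane (hslit u hu))
    (by simp only [e]; exact (i1.sub i2).intervalIntegrable _ _) l1 l2
  simp only [e] at key
  rw [intervalIntegral.integral_sub (i1.intervalIntegrable _ _) (i2.intervalIntegrable _ _)] at key
  have w1 := c.winding_eq_shift s (c.tube s t)
  have w2 := c.winding_eq_shift s (c.tube s (-t))
  have e1 : ∀ u, c.γ (s + u) - c.tube s t = d u - n := fun u => by simp only [tube, hd, hn]; ring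
  have e2 : ∀ u, c.γ (s + u) - c.tube s (-t) = d u + n := fun u => by
    simp only [tube, hd, hn]; push_cast; ring
  simp only [e1] at w1
  simp only [e2] at w2
  have hpi := Real.pi_pos
  have : 2 * Real.pi * (c.winding (c.tube s t) - c.winding (c.tube s (-t))) = 2 * Real.pi * 1 := by
    rw [mul_sub, w1, w2, key]; ring
  exact mul_left_cancel₀ (by positivity) this

theorem winding_add (s : ℝ) {t : ℝ} (ht : 0 < t)
    (H : ∀ τ, |τ| ≤ t → τ ≠ 0 → ∀ u, c.γ u ≠ c.tube s τ) :
    ∫ s' in 0..c.l, c.turn s' s =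
      Real.pi * (c.winding (c.tube s t) + c.winding (c.tube s (-t))) := by
  set d : ℝ → ℂ := fun u => c.γ (s + u) - c.γ s with hd
  set n : ℂ := t * (Complex.I * c.T s) with hn
  have hT := c.T_ne s
  have hm : ∀ u, d u - n ≠ 0 := fun u h => H t (abs_of_pos ht).le ht.ne' (s + u) (by
    rw [tube, ← hn, ← sub_eq_zero, ← h]; simp only [hd]; ring)
  have hp : ∀ u, d u + n ≠ 0 := fun u h => H (-t) (by rw [abs_neg, abs_of_pos ht])
    (neg_ne_zero.2 ht.ne') (s + u) (by
    rw [tube, ← sub_eq_zero, ← h]; simp only [hd, hn]; push_cast; ring)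
  have hdd : ∀ u, HasDerivAt d (c.T (s + u)) u := fun u =>
    ((c.hasDerivAt_γ (s + u)).comp_const_add s u).sub_const _
  have hdc : Continuous d := continuous_iff_continuousAt.2 fun u => (hdd u).continuousAt
  have hd0 : d 0 = 0 := by simp [hd]
  have hdper : ∀ u, d (u - c.l) = d u := fun u => by
    simp only [hd]
    rw [← c.periodic (s + (u - c.l))]
    congr 2
    ring
  have hdne : ∀ u ∈ Ioo 0 c.l, d u ≠ 0 := fun u hu =>
    sub_ne_zero.2 (c.γ_add_ne hu.1.ne' (by rw [abs_of_pos hu.1]; exact hu.2))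
  set r : ℝ → ℂ := fun u => (d u - n) * (d u + n) / d u ^ 2 with hr
  have hslit : ∀ u ∈ Ioo 0 c.l, r u ∈ Complex.slitPlane := fun u hu => by
    have hdu := hdne u hu
    by_contra hns
    rw [Complex.mem_slitPlane_iff, not_or, not_lt, not_not] at hns
    set x := -(r u).re with hx
    have hx0 : 0 ≤ x := by linarith [hns.1]
    have hrx : r u = ((-x : ℝ) : ℂ) := Complex.ext (by simp [hx]) (by simp [hns.2])
    have e1 : (d u - n) * (d u + n) = ((-x : ℝ) : ℂ) * d u ^ 2 := by
      rw [← hrx]; simp only [hr]; rw [div_mul_cancel₀ _ (pow_ne_zero 2 hdu)]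
    set y := Real.sqrt (1 + x) with hy
    have hy1 : 1 ≤ y := Real.one_le_sqrt.2 (by linarith)
    have hy2 : y ^ 2 = 1 + x := Real.sq_sqrt (by linarith)
    have e2 : (d u * (y : ℂ)) ^ 2 = n ^ 2 := by
      rw [mul_pow, ← Complex.ofReal_pow, hy2]
      push_cast at e1 ⊢
      linear_combination e1
    have hy0 : (y : ℂ) ≠ 0 := by exact_mod_cast (by linarith : y ≠ 0)
    have hle : |t / y| ≤ t := by
      rw [abs_of_nonneg (by positivity)]
      exact div_le_self ht.le hy1
    refine c.γ_add_ne (s := s) hu.1.ne' (by rw [abs_of_pos hu.1]; exact hu.2) ?_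
    rcases sq_eq_sq_iff_eq_or_eq_neg.1 e2 with h | h
    · refine c.chord_eq_of_mem s H (τ := t / y) hle ?_
      rw [← mul_left_inj' hy0]
      refine h.trans ?_
      rw [hn]; push_cast; field_simp
    · refine c.chord_eq_of_mem s H (τ := -(t / y)) (by rwa [abs_neg]) ?_
      rw [← mul_left_inj' hy0]
      refine h.trans ?_
      rw [hn]; push_cast; field_simp
  have hrd : ∀ u ∈ Ioo 0 c.l, HasDerivAt r (((c.T (s + u) * (d u + n) + (d u - n) * c.T (s + u)) *
      d u ^ 2 - (d u - n) * (d u + n) * (2 * d u * c.T (s + u))) / (d u ^ 2) ^ 2) u := fun u hu => by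
    have h2 : HasDerivAt (fun u => d u ^ 2) (2 * d u * c.T (s + u)) u := by
      convert! (hdd u).pow 2 using 1
      simp
    exact (((hdd u).sub_const n).mul ((hdd u).add_const n)).div h2 (pow_ne_zero 2 (hdne u hu))
  have l0 : Tendsto (fun u => Complex.arg (r u)) (𝓝[≠] 0) (𝓝 0) := by
    have h1 := (c.tendsto_inv_mul_chord s).inv₀ hT
    have h2 : Tendsto (fun u => (d u - n) * (d u + n)) (𝓝[≠] 0) (𝓝 ((0 - n) * (0 + n))) := by
      have : Continuous fun u => (d u - n) * (d u + n) := by fun_prop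
      have := (this.tendsto 0).mono_left (nhdsWithin_le_nhds (s := {0}ᶜ))
      rwa [hd0] at this
    have h3 := h2.mul (h1.pow 2)
    have e : (0 - n) * (0 + n) * (c.T s)⁻¹ ^ 2 = ((t ^ 2 : ℝ) : ℂ) := by
      rw [hn]
      push_cast
      field_simp
      linear_combination (-(t : ℂ) ^ 2 * c.T s ^ 2) * Complex.I_sq
    rw [e] at h3
    have h4 := (Complex.continuousAt_arg (x := ((t ^ 2 : ℝ) : ℂ))
      (Complex.ofReal_mem_slitPlane.2 (by positivity))).tendsto.comp h3
    rw [Complex.arg_ofReal_of_nonneg (by positivity)] at h4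
    refine h4.congr' ?_
    filter_upwards [self_mem_nhdsWithin] with u hu
    have hu0 : u ≠ 0 := hu
    have hu2 : 0 < u ^ 2 := by positivity
    rw [← Complex.arg_real_mul (r u) hu2]
    change Complex.arg ((d u - n) * (d u + n) * ((u : ℂ)⁻¹ * d u)⁻¹ ^ 2) = _
    simp only [hr]
    congr 1
    push_cast
    rw [mul_inv, inv_inv]
    ring_nf
  have l1 : Tendsto (fun u => Complex.arg (r u)) (𝓝[>] 0) (𝓝 0) :=
    l0.mono_left (nhdsWithin_mono _ fun u hu => (mem_Ioi.1 hu).ne')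
  have l2 : Tendsto (fun u => Complex.arg (r u)) (𝓝[<] c.l) (𝓝 0) := by
    refine ((l0.mono_left (nhdsWithin_mono _ fun u hu => (mem_Iio.1 hu).ne)).comp
      (tendsto_sub_const_nhdsLT c.l)).congr fun u => ?_
    simp only [Function.comp, hr, hdper]
  set g : ℝ → ℝ := fun u => (c.T (s + u) / (d u - n)).im + (c.T (s + u) / (d u + n)).im -
    2 * c.turn (s + u) s with hg
  have e : ∀ u ∈ Ioo 0 c.l, (((c.T (s + u) * (d u + n) + (d u - n) * c.T (s + u)) *
      d u ^ 2 - (d u - n) * (d u + n) * (2 * d u * c.T (s + u))) / (d u ^ 2) ^ 2 / r u).im = g u :=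
      fun u hu => by
    have h1 := hm u
    have h2 := hp u
    have h3 := hdne u hu
    simp only [hg, turn]
    rw [← Complex.add_im, show (2 : ℝ) * (c.T (s + u) / (c.γ (s + u) - c.γ s)).im =
      (2 * (c.T (s + u) / d u)).im by simp [hd], ← Complex.sub_im]
    congr 1
    simp only [hr]
    field_simp
  have hTc : Continuous fun u => c.T (s + u) := c.continuous_T.comp (by fun_prop)
  have i1 : Continuous fun u => (c.T (s + u) / (d u - n)).im :=
    Complex.continuous_im.comp (hTc.div (hdc.sub continuous_const) hm)
  have i2 : Continuous fun u => (c.T (s + u) / (d u + n)).im :=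
    Complex.continuous_im.comp (hTc.div (hdc.add continuous_const) hp)
  obtain ⟨C, hC⟩ := c.exists_turn_bound
  have i3 : IntervalIntegrable (fun u => c.turn (s + u) s) volume 0 c.l := by
    refine (intervalIntegrable_iff_integrableOn_Ioc_of_le c.l_pos.le).2
      ((integrableOn_const measure_Ioc_lt_top.ne (C := C)).mono' ?_ (.of_forall fun u => hC _ _))
    exact (c.measurable_turn.comp
      (by fun_prop : Measurable fun u : ℝ => (s + u, s))).aestronglyMeasurable
  have i12 := (i1.intervalIntegrable 0 c.l (μ := volume)).add (i2.intervalIntegrable 0 c.l)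
  have key := intervalIntegral.integral_eq_sub_of_hasDerivAt_of_tendsto c.l_pos
    (f := fun u => Complex.arg (r u)) (f' := g)
    (fun u hu => e u hu ▸ (hrd u hu).arg_slitPlane (hslit u hu))
    (i12.sub (i3.const_mul 2)) l1 l2
  simp only [hg] at key
  rw [intervalIntegral.integral_sub i12 (i3.const_mul 2),
    intervalIntegral.integral_add (i1.intervalIntegrable _ _) (i2.intervalIntegrable _ _),
    intervalIntegral.integral_const_mul] at key
  have w1 := c.winding_eq_shift s (c.tube s t)
  have w2 := c.winding_eq_shift s (c.tube s (-t))
  have e1 : ∀ u, c.γ (s + u) - c.tube s t = d u - n := fun u => by simp only [tube, hd, hn]; ring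
  have e2 : ∀ u, c.γ (s + u) - c.tube s (-t) = d u + n := fun u => by
    simp only [tube, hd, hn]; push_cast; ring
  simp only [e1] at w1
  simp only [e2] at w2
  rw [← w1, ← w2, c.integral_shift (f := fun u => c.turn u s) fun u =>
    c.turn_congr (c.periodic u) rfl] at key
  linarith

end ArcLoop

namespace ArcLoop

variable (c : ArcLoop)

theorem integral_turn_add_turn {u : ℝ} (hu : u ≠ 0) (hul : |u| ≤ c.l / 2) :
    ∫ t in 0..c.l, (c.turn (t + u) t + c.turn t (t + u)) = ∫ t in 0..c.l, c.κ t := by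
  set B : ℝ → ℝ := fun u => ∫ t in 0..c.l,
    ((c.T (t + u) - c.T t) / (c.γ (t + u) - c.γ t)).im with hB
  have hl := c.l_pos
  have hγ := c.continuous_γ
  have hT := c.continuous_T
  have hT' := c.continuous_T'
  have hd : ∀ u t, HasDerivAt (fun t => c.γ (t + u) - c.γ t) (c.T (t + u) - c.T t) t := fun u t =>
    ((c.hasDerivAt_γ (t + u)).comp_add_const t u).sub (c.hasDerivAt_γ t)
  have hcd : ∀ u, Continuous fun t => c.T (t + u) - c.T t := fun u => by fun_prop
  have hper : ∀ u, c.γ (c.l + u) - c.γ c.l = c.γ (0 + u) - c.γ 0 := fun u => by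
    have h1 := c.periodic u
    have h2 := c.periodic 0
    rw [zero_add] at h2 ⊢
    rw [add_comm, h1, h2]
  have hperT : c.T c.l = c.T 0 := by
    have h2 := c.periodic_T 0
    rwa [zero_add] at h2
  obtain ⟨M, hM, -, -, hM2, -⟩ := c.exists_bounds
  obtain ⟨c₀, hc₀, hc₀', hlow⟩ := c.exists_chord_lower_bound
  have small : ∀ u, u ≠ 0 → M * |u| < 1 → B u = ∫ t in 0..c.l, c.κ t := fun u hu hu' => by
    have hup : 0 < |u| := abs_pos.2 hu
    have := integral_im_div_eq (l := c.l) (hd u)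
      (fun t => (c.hasDerivAt_T' t).const_mul (u : ℂ)) (hcd u) (by fun_prop) (hper u)
      (by rw [hperT]) fun t => by
        rw [norm_mul, c.norm_T, mul_one, Complex.norm_real, Real.norm_eq_abs]
        calc _ ≤ M * |u| ^ 2 := hM2 t u
          _ < |u| := by nlinarith
    rw [hB]
    refine this.trans ?_
    congr 1
    funext t
    rw [mul_div_mul_left _ _ (by exact_mod_cast hu : (u : ℂ) ≠ 0), κ]
    congr 1
    rw [div_eq_iff (c.T_ne t)]
    linear_combination -deriv c.T t * c.conj_T_mul_T t
  have step : ∀ u₀, u₀ ≠ 0 → |u₀| ≤ c.l / 2 → ∀ᶠ u in 𝓝 u₀, B u = B u₀ := fun u₀ h0 hl0 => by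
    filter_upwards [Metric.ball_mem_nhds u₀ (mul_pos hc₀ (abs_pos.2 h0))] with u hu
    refine integral_im_div_eq (l := c.l) (hd u) (hd u₀) (hcd u) (hcd u₀) (hper u) (hper u₀)
      fun t => ?_
    rw [sub_sub_sub_cancel_right]
    have h1 := c.norm_chord_le (t + u₀) (u - u₀)
    rw [show t + u₀ + (u - u₀) = t + u by ring] at h1
    exact h1.trans_lt (lt_of_lt_of_le (by rwa [Metric.mem_ball, Real.dist_eq] at hu) (hlow t u₀ hl0))
  have hBu : B u = ∫ t in 0..c.l, c.κ t := by
    set v := min (c.l / 2) (1 / (2 * M)) with hv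
    have hv0 : 0 < v := by rw [hv]; positivity
    have hv1 : v ≤ c.l / 2 := min_le_left _ _
    have hMv : M * v < 1 := by
      calc M * v ≤ M * (1 / (2 * M)) := by gcongr; exact min_le_right _ _
        _ = 1 / 2 := by field_simp
        _ < 1 := by norm_num
    rcases hu.lt_or_gt with h | h
    · rw [abs_of_neg h] at hul
      rw [← small (-v) (by linarith) (by rwa [abs_neg, abs_of_pos hv0])]
      refine (isPreconnected_Ico (a := -(c.l / 2)) (b := 0)).eq_of_eventually_eq (fun x hx =>
        (step x hx.2.ne ?_).filter_mono nhdsWithin_le_nhds) ⟨by linarith, h⟩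
        ⟨by linarith, by linarith⟩
      rw [abs_of_neg hx.2]; linarith [hx.1]
    · rw [abs_of_pos h] at hul
      rw [← small v hv0.ne' (by rwa [abs_of_pos hv0])]
      refine (isPreconnected_Ioc (a := 0) (b := c.l / 2)).eq_of_eventually_eq (fun x hx =>
        (step x hx.1.ne' ?_).filter_mono nhdsWithin_le_nhds) ⟨h, hul⟩ ⟨hv0, hv1⟩
      rw [abs_of_pos hx.1]; exact hx.2
  rw [← hBu, hB]
  congr 1
  funext t
  simp only [turn]
  rw [← neg_sub (c.γ (t + u)) (c.γ t), div_neg, Complex.neg_im, sub_div, Complex.sub_im]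
  rfl

theorem integral_turn : 2 * ∫ x in Ioc 0 c.l ×ˢ Ioc 0 c.l, c.turn x.1 x.2 =
    c.l * ∫ t in 0..c.l, c.κ t := by
  obtain ⟨C, hC⟩ := c.exists_turn_bound
  have hl := c.l_pos
  have hm := c.measurable_turn
  have hm' : Measurable fun x : ℝ × ℝ => c.turn x.2 x.1 := hm.comp measurable_swap
  have hfin : ∀ a b a' b' : ℝ, volume (Ioc a b ×ˢ Ioc a' b') ≠ ⊤ := fun a b a' b' => by
    rw [Measure.volume_eq_prod, Measure.prod_prod]
    exact ENNReal.mul_ne_top measure_Ioc_lt_top.ne measure_Ioc_lt_top.ne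
  have i1 : ∀ a b a' b' : ℝ, ∀ f : ℝ × ℝ → ℝ, Measurable f → ∀ C', (∀ x, |f x| ≤ C') →
      IntegrableOn f (Ioc a b ×ˢ Ioc a' b') := fun a b a' b' f hf C' hb =>
    (integrableOn_const (hfin a b a' b') (C := C')).mono' hf.aestronglyMeasurable (.of_forall hb)
  have hsw : ∫ x in Ioc 0 c.l ×ˢ Ioc 0 c.l, c.turn x.2 x.1 =
      ∫ x in Ioc 0 c.l ×ˢ Ioc 0 c.l, c.turn x.1 x.2 := by
    rw [Measure.volume_eq_prod, ← setIntegral_prod_swap]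
    rfl
  have hfb : ∀ x : ℝ × ℝ, |c.turn x.1 x.2 + c.turn x.2 x.1| ≤ C + C := fun x =>
    (abs_add_le _ _).trans (add_le_add (hC _ _) (hC _ _))
  have h1 := integral_prod_shift hl (hm.add hm') (C := C + C) hfb fun s t => by
    simp only [Pi.add_apply]
    rw [c.turn_congr (c.periodic s) rfl, c.turn_congr rfl (c.periodic s)]
  simp only [Pi.add_apply] at h1
  rw [integral_add (i1 _ _ _ _ _ hm C fun x => hC _ _) (i1 _ _ _ _ _ hm' C fun x => hC _ _), hsw,
    ← two_mul] at h1
  rw [h1]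
  have hg : Measurable fun x : ℝ × ℝ => c.turn (x.1 + x.2) x.1 + c.turn x.1 (x.1 + x.2) :=
    (hm.comp (by fun_prop : Measurable fun x : ℝ × ℝ => (x.1 + x.2, x.1))).add
      (hm.comp (by fun_prop : Measurable fun x : ℝ × ℝ => (x.1, x.1 + x.2)))
  have hi := i1 0 c.l (-(c.l / 2)) (c.l / 2) _ hg (C + C)
    fun x => (abs_add_le _ _).trans (add_le_add (hC _ _) (hC _ _))
  rw [IntegrableOn, Measure.volume_eq_prod, ← Measure.prod_restrict] at hi
  rw [Measure.volume_eq_prod, ← Measure.prod_restrict, integral_prod_symm _ hi]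
  have hae : ∀ᵐ u ∂(volume.restrict (Ioc (-(c.l / 2)) (c.l / 2))),
      ∫ t in Ioc 0 c.l, (c.turn (t + u) t + c.turn t (t + u)) = ∫ t in 0..c.l, c.κ t := by
    have h0 : ∀ᵐ u : ℝ ∂(volume.restrict (Ioc (-(c.l / 2)) (c.l / 2))), u ≠ 0 :=
      ae_restrict_of_ae (by simp [ae_iff])
    filter_upwards [h0, ae_restrict_mem measurableSet_Ioc] with u hu hu'
    rw [← c.interval_eq]
    exact c.integral_turn_add_turn hu (abs_le.2 ⟨hu'.1.le, hu'.2⟩)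
  rw [integral_congr_ae hae, setIntegral_const, Real.volume_real_Ioc_of_le (by linarith), smul_eq_mul]
  ring

theorem integral_κ_eq {w : ℝ} (h : ∀ t, ∫ s in 0..c.l, c.turn s t = Real.pi * w) :
    ∫ t in 0..c.l, c.κ t = 2 * Real.pi * w := by
  obtain ⟨C, hC⟩ := c.exists_turn_bound
  have hfin : volume (Ioc 0 c.l ×ˢ Ioc 0 c.l) ≠ ⊤ := by
    rw [Measure.volume_eq_prod, Measure.prod_prod]
    exact ENNReal.mul_ne_top measure_Ioc_lt_top.ne measure_Ioc_lt_top.ne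
  have hi : IntegrableOn (fun x : ℝ × ℝ => c.turn x.1 x.2) (Ioc 0 c.l ×ˢ Ioc 0 c.l) :=
    (integrableOn_const hfin (C := C)).mono' c.measurable_turn.aestronglyMeasurable
      (.of_forall fun x => hC _ _)
  rw [IntegrableOn, Measure.volume_eq_prod, ← Measure.prod_restrict] at hi
  have key := c.integral_turn
  rw [Measure.volume_eq_prod, ← Measure.prod_restrict, integral_prod_symm _ hi] at key
  simp only [← c.interval_eq, h, intervalIntegral.integral_const] at key
  have := c.l_ne
  rw [sub_zero, smul_eq_mul] at key
  have : c.l * (∫ t in 0..c.l, c.κ t) = c.l * (2 * Real.pi * w) := by rw [← key]; ring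
  exact mul_left_cancel₀ c.l_ne this

end ArcLoop

namespace SmoothBoundary

variable {Ω : Set ℂ} {K : SmoothBoundary Ω} {δ₀ : ℝ}

/-- The winding numbers of the boundary curves around the points to the left of each of them. -/
noncomputable def windingMatrix (K : SmoothBoundary Ω) : Matrix (Fin K.k) (Fin K.k) ℝ :=
  fun j i => (K.loop i).winding ((K.loop j).tube 0 (K.exists_isTubular.choose / 2))

theorem IsTubular.γ_ne_tube (h : K.IsTubular δ₀) (i j : Fin K.k) {t : ℝ} (ht : |t| < δ₀)
    (h0 : t ≠ 0) (s u : ℝ) : (K.loop i).γ u ≠ (K.loop j).tube s t := fun e =>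
  h.tube_notMem_frontier j s ht h0 (K.mem_frontier_iff.2 ⟨i, u, e⟩)

theorem IsTubular.winding_tube_eq (h : K.IsTubular δ₀) (i j : Fin K.k) {s s' t t' : ℝ}
    (ht : |t| < δ₀) (ht' : |t'| < δ₀) (hs : 0 < t * t') :
    (K.loop i).winding ((K.loop j).tube s t) = (K.loop i).winding ((K.loop j).tube s' t') := by
  have key : ∀ I : Set ℝ, IsPreconnected I → (∀ x ∈ I, |x| < δ₀ ∧ x ≠ 0) → t ∈ I → t' ∈ I →
      (K.loop i).winding ((K.loop j).tube s t) = (K.loop i).winding ((K.loop j).tube s' t') := by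
    intro I hI hI' h1 h2
    refine (K.loop i).winding_eq_of_isPreconnected
      (S := (fun x : ℝ × ℝ => (K.loop j).tube x.1 x.2) '' (univ ×ˢ I))
      ((isPreconnected_univ.prod hI).image _ (K.loop j).continuous_tube.continuousOn) ?_
      ⟨(s, t), ⟨trivial, h1⟩, rfl⟩ ⟨(s', t'), ⟨trivial, h2⟩, rfl⟩
    rintro _ ⟨x, hx, rfl⟩ ⟨u, hu⟩
    exact h.γ_ne_tube i j (hI' _ hx.2).1 (hI' _ hx.2).2 x.1 u hu
  rcases pos_and_pos_or_neg_and_neg_of_mul_pos hs with ⟨h1, h2⟩ | ⟨h1, h2⟩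
  · exact key (Ioo 0 δ₀) isPreconnected_Ioo (fun x hx => ⟨by rw [abs_of_pos hx.1]; exact hx.2,
      hx.1.ne'⟩) ⟨h1, (abs_lt.1 ht).2⟩ ⟨h2, (abs_lt.1 ht').2⟩
  · exact key (Ioo (-δ₀) 0) isPreconnected_Ioo (fun x hx => ⟨by
      rw [abs_of_neg hx.2]; linarith [hx.1], hx.2.ne⟩) ⟨(abs_lt.1 ht).1, h1⟩ ⟨(abs_lt.1 ht').1, h2⟩

theorem IsTubular.winding_tube (h : K.IsTubular δ₀) (i j : Fin K.k) (s : ℝ) {t : ℝ} (h0 : 0 < t)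
    (ht : t < δ₀) : (K.loop i).winding ((K.loop j).tube s t) = K.windingMatrix j i := by
  have h' := K.exists_isTubular.choose_spec
  set δ' := K.exists_isTubular.choose with hδ'
  have hp := h'.pos
  set v := min t (δ' / 2) with hv
  have hv0 : 0 < v := by rw [hv]; positivity
  have hvt : v ≤ t := min_le_left _ _
  have hvd : v ≤ δ' / 2 := min_le_right _ _
  rw [windingMatrix, h.winding_tube_eq i j (s' := 0) (t' := v) (by rwa [abs_of_pos h0])
    (by rw [abs_of_pos hv0]; linarith) (by positivity),
    h'.winding_tube_eq i j (s' := 0) (t' := δ' / 2) (by rw [abs_of_pos hv0]; linarith)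
    (by rw [abs_of_pos (by positivity)]; linarith) (by positivity)]

theorem IsTubular.winding_tube_neg (h : K.IsTubular δ₀) (i j : Fin K.k) (s : ℝ) {t : ℝ}
    (h0 : t < 0) (ht : -δ₀ < t) :
    (K.loop i).winding ((K.loop j).tube s t) = K.windingMatrix j i - if i = j then 1 else 0 := by
  have h1 := h.winding_tube i j s (t := -t) (by linarith) (by linarith)
  by_cases hij : i = j
  · subst hij
    have := (K.loop i).winding_jump s (t := -t) (by linarith) fun τ hτ h0' u =>
      h.γ_ne_tube i i (by linarith) h0' s u
    rw [neg_neg, h1] at this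
    rw [if_pos rfl]
    linarith
  · rw [if_neg hij, sub_zero, ← h1]
    refine (K.loop i).winding_eq_of_isPreconnected
      (S := (fun x : ℝ => (K.loop j).tube s x) '' Ioo (-δ₀) δ₀)
      (isPreconnected_Ioo.image _ ((K.loop j).continuous_tube.comp
        (by fun_prop : Continuous fun x : ℝ => (s, x))).continuousOn) ?_
      ⟨t, ⟨ht, by linarith [h.pos]⟩, rfl⟩ ⟨-t, ⟨by linarith [h.pos], by linarith⟩, rfl⟩
    rintro _ ⟨x, hx, rfl⟩ ⟨u, hu⟩
    refine hij (h.inj i j u s 0 x (by rw [abs_zero]; exact h.pos) (abs_lt.2 hx) ?_).1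
    rw [ArcLoop.tube_zero]
    exact hu

theorem totalCurvature_eq (K : SmoothBoundary Ω) :
    K.totalCurvature = 2 * Real.pi * (2 * K.windingMatrix.trace - K.k) := by
  obtain ⟨δ₀, h⟩ := K.exists_isTubular
  have hp := h.pos
  have e : ∀ i, ∫ s in 0..K.len i, K.curvature i s =
      2 * Real.pi * (2 * K.windingMatrix i i - 1) := fun i => by
    refine (K.loop i).integral_κ_eq fun t => ?_
    rw [(K.loop i).winding_add t (t := δ₀ / 2) (by linarith) fun τ hτ h0' u =>
      h.γ_ne_tube i i (by linarith) h0' t u, h.winding_tube i i t (by linarith) (by linarith),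
      h.winding_tube_neg i i t (by linarith) (by linarith), if_pos rfl]
    ring
  simp only [totalCurvature, e, ← Finset.mul_sum, Finset.sum_sub_distrib, Matrix.trace,
    Matrix.diag_apply]
  simp

end SmoothBoundary

/-! ### Differential forms on the plane -/

theorem hasDerivAt_integral_fst {H : ℝ × ℝ → ℝ} (hH : ContDiff ℝ ∞ H) (s t : ℝ) :
    HasDerivAt (fun s => ∫ τ in 0..t, H (s, τ)) (∫ τ in 0..t, fderiv ℝ H (s, τ) (1, 0)) s := by
  have hc : Continuous fun p : ℝ × ℝ => fderiv ℝ H p (1, 0) :=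
    (hH.continuous_fderiv (by simp)).clm_apply continuous_const
  obtain ⟨C, hC⟩ := ((isCompact_Icc (a := s - 1) (b := s + 1)).prod
    (isCompact_uIcc (a := 0) (b := t))).exists_bound_of_continuousOn hc.continuousOn
  refine (intervalIntegral.hasDerivAt_integral_of_dominated_loc_of_deriv_le
    (F := fun s τ => H (s, τ)) (F' := fun s τ => fderiv ℝ H (s, τ) (1, 0)) (bound := fun _ => C)
    (Icc_mem_nhds (by linarith : s - 1 < s) (by linarith : s < s + 1)) ?_ ?_ ?_ ?_ ?_ ?_).2
  · exact .of_forall fun x => (hH.continuous.comp (by fun_prop)).aestronglyMeasurable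
  · exact (hH.continuous.comp (by fun_prop)).intervalIntegrable _ _
  · exact (hc.comp (by fun_prop : Continuous fun τ : ℝ => (s, τ))).aestronglyMeasurable
  · exact .of_forall fun τ hτ x hx => hC (x, τ) ⟨hx, uIoc_subset_uIcc hτ⟩
  · exact intervalIntegrable_const
  · refine .of_forall fun τ _ x _ => ?_
    have h1 := (hH.differentiable (by simp) (x, τ)).hasFDerivAt.comp_hasDerivAt x
      ((hasDerivAt_id x).prodMk (hasDerivAt_const x τ))
    exact h1

theorem hasFDerivAt_primitive {H : ℝ × ℝ → ℝ} (hH : ContDiff ℝ ∞ H) (p : ℝ × ℝ) :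
    HasFDerivAt (fun p : ℝ × ℝ => ∫ τ in 0..p.2, H (p.1, τ))
      ((∫ τ in 0..p.2, fderiv ℝ H (p.1, τ) (1, 0)) • ContinuousLinearMap.fst ℝ ℝ ℝ +
        H p • ContinuousLinearMap.snd ℝ ℝ ℝ) p := by
  have hc : Continuous fun p : ℝ × ℝ => fderiv ℝ H p (1, 0) :=
    (hH.continuous_fderiv (by simp)).clm_apply continuous_const
  have hpc : Continuous fun p : ℝ × ℝ => ∫ τ in 0..p.2, fderiv ℝ H (p.1, τ) (1, 0) :=
    intervalIntegral.continuous_parametric_intervalIntegral_of_continuous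
      (f := fun (p : ℝ × ℝ) τ => fderiv ℝ H (p.1, τ) (1, 0))
      (hc.comp (by fun_prop : Continuous fun q : (ℝ × ℝ) × ℝ => (q.1.1, q.2))) continuous_snd
  have key := hasStrictFDerivAt_uncurry_coprod (𝕜 := ℝ) (u := p)
    (f := fun s t => ∫ τ in 0..t, H (s, τ))
    (f₁ := fun s t => ContinuousLinearMap.toSpanSingleton ℝ
      (∫ τ in 0..t, fderiv ℝ H (s, τ) (1, 0)))
    (f₂ := fun s t => ContinuousLinearMap.toSpanSingleton ℝ (H (s, t)))
    (.of_forall fun v => (hasDerivAt_integral_fst hH v.1 v.2).hasFDerivAt)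
    (.of_forall fun v => by
      have hcs : Continuous fun τ => H (v.1, τ) := hH.continuous.comp (by fun_prop)
      exact (intervalIntegral.integral_hasDerivAt_right (hcs.intervalIntegrable _ _)
        (hcs.stronglyMeasurableAtFilter _ _) hcs.continuousAt).hasFDerivAt) ?_ ?_
  · refine key.hasFDerivAt.congr_fderiv ?_
    ext <;> simp [Function.HasUncurry.uncurry]
  · exact ((ContinuousLinearMap.toSpanSingletonCLE (𝕜 := ℝ) (E := ℝ)).continuous.comp
      hpc).continuousAt
  · exact ((ContinuousLinearMap.toSpanSingletonCLE (𝕜 := ℝ) (E := ℝ)).continuous.comp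
      hH.continuous).continuousAt

theorem contDiff_primitive {H : ℝ × ℝ → ℝ} (hH : ContDiff ℝ ∞ H) :
    ContDiff ℝ ∞ fun p : ℝ × ℝ => ∫ τ in 0..p.2, H (p.1, τ) := by
  rw [contDiff_infty]
  intro n
  induction n generalizing H with
  | zero =>
    exact contDiff_zero.2 (continuous_iff_continuousAt.2 fun p =>
      (hasFDerivAt_primitive hH p).continuousAt)
  | succ n ih =>
    refine contDiff_succ_iff_hasFDerivAt.2 ⟨_, ?_, hasFDerivAt_primitive hH⟩
    have h1 : ContDiff ℝ ∞ fun p : ℝ × ℝ => fderiv ℝ H p (1, 0) :=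
      (hH.fderiv_right (by simp)).clm_apply contDiff_const
    exact ((ih h1).smul contDiff_const).add ((hH.of_le (by exact_mod_cast le_top)).smul contDiff_const)

theorem exists_contDiff_eventuallyEq {F : Type*} [NormedAddCommGroup F] [NormedSpace ℝ F]
    {C U : Set ℂ} (hC : IsCompact C) (hU : IsOpen U) (hCU : C ⊆ U) {g : ℂ → F}
    (hg : ContDiffOn ℝ ∞ g U) : ∃ G, ContDiff ℝ ∞ G ∧ ∀ x ∈ C, G =ᶠ[𝓝 x] g := by
  obtain ⟨r, hr, hrU⟩ := hC.exists_cthickening_subset_open hU hCU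
  obtain ⟨χ, hχ, h1, h0, -⟩ := exists_contDiff_cutoff (A := Metric.cthickening (r / 3) C)
    (B := (Metric.thickening (r / 2) C)ᶜ) Metric.isClosed_cthickening
    Metric.isOpen_thickening.isClosed_compl (by
      rw [disjoint_compl_right_iff_subset]
      exact Metric.cthickening_subset_thickening' (by positivity) (by linarith) C)
  refine ⟨fun z => χ z • g z, contDiff_iff_contDiffAt.2 fun z => ?_, fun x hx => ?_⟩
  · by_cases hz : z ∈ U
    · exact hχ.contDiffAt.smul (hg.contDiffAt (hU.mem_nhds hz))
    · have hz' : z ∈ (Metric.cthickening (r / 2) C)ᶜ := fun hz' =>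
        hz (hrU (Metric.cthickening_mono (by linarith) C hz'))
      refine (contDiffAt_const (c := (0 : F))).congr_of_eventuallyEq ?_
      filter_upwards [Metric.isClosed_cthickening.isOpen_compl.mem_nhds hz'] with y hy
      rw [h0 y fun hy' => hy (Metric.thickening_subset_cthickening _ _ hy'), zero_smul]
  · filter_upwards [Metric.isOpen_thickening.mem_nhds
      (Metric.self_subset_thickening (by positivity : 0 < r / 3) C hx)] with y hy
    rw [h1 y (Metric.thickening_subset_cthickening _ _ hy), one_smul]

namespace PlaneForm

/-- The `0`-form of a function. -/
noncomputable def ofFun (f : ℂ → ℝ) : PlaneForm 0 :=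
  fun x => ContinuousAlternatingMap.constOfIsEmptyLIE ℝ ℂ ℝ (Fin 0) (f x)

/-- The function of a `0`-form. -/
noncomputable def toFun (α : PlaneForm 0) (x : ℂ) : ℝ :=
  (ContinuousAlternatingMap.constOfIsEmptyLIE ℝ ℂ ℝ (Fin 0)).symm (α x)

/-- Linear forms as alternating forms in one variable. -/
noncomputable def linearFormEquiv : (ℂ →L[ℝ] ℝ) ≃ₗᵢ[ℝ] ℂ [⋀^Fin 1]→L[ℝ] ℝ :=
  ContinuousAlternatingMap.ofSubsingletonLIE (0 : Fin 1)

/-- The `1`-form of a field of linear forms. -/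
noncomputable def ofField (A : ℂ → ℂ →L[ℝ] ℝ) : PlaneForm 1 :=
  fun x => linearFormEquiv (A x)

/-- The field of linear forms of a `1`-form. -/
noncomputable def toField (α : PlaneForm 1) (x : ℂ) : ℂ →L[ℝ] ℝ :=
  linearFormEquiv.symm (α x)

theorem ofFun_toFun (α : PlaneForm 0) : ofFun α.toFun = α :=
  funext fun x => LinearIsometryEquiv.apply_symm_apply _ (α x)

theorem toFun_ofFun (f : ℂ → ℝ) : (ofFun f).toFun = f :=
  funext fun x => LinearIsometryEquiv.symm_apply_apply _ (f x)

theorem ofField_toField (α : PlaneForm 1) : ofField α.toField = α :=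
  funext fun x => LinearIsometryEquiv.apply_symm_apply _ (α x)

theorem toField_ofField (A : ℂ → ℂ →L[ℝ] ℝ) : (ofField A).toField = A :=
  funext fun x => LinearIsometryEquiv.symm_apply_apply _ (A x)

theorem smooth_ofFun {f : ℂ → ℝ} (hf : ContDiff ℝ ∞ f) : (ofFun f).Smooth :=
  (ContinuousAlternatingMap.constOfIsEmptyLIE ℝ ℂ ℝ (Fin 0)).contDiff.comp hf

theorem Smooth.toFun {α : PlaneForm 0} (h : α.Smooth) : ContDiff ℝ ∞ α.toFun :=
  (ContinuousAlternatingMap.constOfIsEmptyLIE ℝ ℂ ℝ (Fin 0)).symm.contDiff.comp h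

theorem smooth_ofField {A : ℂ → ℂ →L[ℝ] ℝ} (hA : ContDiff ℝ ∞ A) : (ofField A).Smooth :=
  linearFormEquiv.contDiff.comp hA

theorem Smooth.toField {α : PlaneForm 1} (h : α.Smooth) : ContDiff ℝ ∞ α.toField :=
  linearFormEquiv.symm.contDiff.comp h

theorem d_ofFun (f : ℂ → ℝ) (x : ℂ) : (ofFun f).d x = ofField (fderiv ℝ f) x :=
  extDeriv_constOfIsEmpty f x

theorem ofField_eq_zero_iff {A : ℂ → ℂ →L[ℝ] ℝ} {x : ℂ} : ofField A x = 0 ↔ A x = 0 :=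
  linearFormEquiv.map_eq_zero_iff

theorem ofField_congr {A B : ℂ → ℂ →L[ℝ] ℝ} {x : ℂ} (h : A x = B x) : ofField A x = ofField B x :=
  congrArg linearFormEquiv h

theorem d_ofField_apply {A : ℂ → ℂ →L[ℝ] ℝ} {x : ℂ} (hA : DifferentiableAt ℝ A x)
    (v : Fin 2 → ℂ) :
    (ofField A).d x v = fderiv ℝ A x (v 0) (v 1) - fderiv ℝ A x (v 1) (v 0) := by
  have hd : DifferentiableAt ℝ (fun x => linearFormEquiv (A x)) x :=
    linearFormEquiv.differentiableAt.comp x hA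
  have h1 : ∀ w, fderiv ℝ (fun y => A y w) x = (fderiv ℝ A x).flip w := fun w => by
    rw [fderiv_clm_apply hA (differentiableAt_const w)]
    ext; simp
  refine (extDeriv_apply hd v).trans ?_
  rw [Fin.sum_univ_two]
  have e0 : (fun y => linearFormEquiv (A y)
      ((0 : Fin 2).removeNth v)) = fun y => A y (v 1) := rfl
  have e1 : (fun y => linearFormEquiv (A y)
      ((1 : Fin 2).removeNth v)) = fun y => A y (v 0) := rfl
  rw [e0, e1, h1, h1]
  simp
  ring

theorem d_ofField_eq_zero_iff {A : ℂ → ℂ →L[ℝ] ℝ} {x : ℂ} (hA : DifferentiableAt ℝ A x) :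
    (ofField A).d x = 0 ↔ ∀ v w, fderiv ℝ A x v w = fderiv ℝ A x w v := by
  constructor
  · intro h v w
    have := d_ofField_apply hA ![v, w]
    rw [h] at this
    exact (sub_eq_zero.1 this.symm)
  · intro h
    ext v
    rw [d_ofField_apply hA, h, sub_self]
    rfl

theorem eq_zero_of_three_le {n : ℕ} (hn : 3 ≤ n) (f : ℂ [⋀^Fin n]→L[ℝ] ℝ) : f = 0 := by
  ext v
  refine f.toAlternatingMap.map_linearDependent v fun hv => ?_
  have := hv.fintype_card_le_finrank
  rw [Fintype.card_fin, Complex.finrank_real_complex] at this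
  omega

theorem ext_two {f g : ℂ [⋀^Fin 2]→L[ℝ] ℝ} (h : f ![1, Complex.I] = g ![1, Complex.I]) :
    f = g := by
  apply ContinuousAlternatingMap.toAlternatingMap_injective
  refine Module.Basis.ext_alternating Complex.basisOneI fun v hv => ?_
  have hs : ∀ f : ℂ [⋀^Fin 2]→L[ℝ] ℝ, f ![Complex.I, 1] = -f ![1, Complex.I] := fun f => by
    have h1 := f.toAlternatingMap.map_swap ![1, Complex.I] (show (0 : Fin 2) ≠ 1 by decide)
    have h2 : ![1, Complex.I] ∘ Equiv.swap (0 : Fin 2) 1 = ![Complex.I, 1] := by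
      ext i; fin_cases i <;> simp
    rwa [h2] at h1
  have hne : v 0 ≠ v 1 := fun h => absurd (hv h) (by decide)
  have hcases : v 0 = 0 ∧ v 1 = 1 ∨ v 0 = 1 ∧ v 1 = 0 := by omega
  rcases hcases with ⟨h0, h1⟩ | ⟨h0, h1⟩
  · have e : (fun i => Complex.basisOneI (v i)) = ![1, Complex.I] := by
      ext i; fin_cases i <;> simp [h0, h1]
    rw [e]; exact h
  · have e : (fun i => Complex.basisOneI (v i)) = ![Complex.I, 1] := by
      ext i; fin_cases i <;> simp [h0, h1]
    rw [e]
    exact (hs f).trans ((congrArg Neg.neg h).trans (hs g).symm)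

theorem exists_d_eq {α : PlaneForm 2} (hα : α.Smooth) :
    ∃ β : PlaneForm 1, β.Smooth ∧ ∀ x, α x = β.d x := by
  set μ : ℂ → ℝ := fun z => (α z : ℂ [⋀^Fin 2]→L[ℝ] ℝ) ![1, Complex.I] with hμ
  have hμs : ContDiff ℝ ∞ μ :=
    (ContinuousAlternatingMap.apply ℝ ℂ ℝ ![1, Complex.I]).contDiff.comp hα
  set H : ℝ × ℝ → ℝ := fun p => μ (Complex.equivRealProdCLM.symm (p.2, p.1)) with hH
  have hHs : ContDiff ℝ ∞ H := hμs.comp (by fun_prop)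
  set L : ℂ →L[ℝ] ℝ × ℝ := Complex.imCLM.prod Complex.reCLM
  set B : ℂ → ℂ →L[ℝ] ℝ := fun z => (∫ τ in 0..z.re, H (z.im, τ)) • Complex.imCLM with hB
  have hF : ∀ z : ℂ, HasFDerivAt (fun z : ℂ => ∫ τ in 0..z.re, H (z.im, τ)) _ z := fun z =>
    (hasFDerivAt_primitive hHs (L z)).comp z L.hasFDerivAt
  have hFs : ContDiff ℝ ∞ (fun z : ℂ => ∫ τ in 0..z.re, H (z.im, τ)) :=
    (contDiff_primitive hHs).comp L.contDiff
  have hBs : ContDiff ℝ ∞ B := hFs.smul contDiff_const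
  refine ⟨ofField B, smooth_ofField hBs, fun x => ext_two ?_⟩
  refine Eq.trans ?_ (d_ofField_apply (hBs.differentiable (by simp) x) ![1, Complex.I]).symm
  have hd : fderiv ℝ B x = _ := ((hF x).smul_const Complex.imCLM).fderiv
  rw [hd]
  have hx : Complex.equivRealProdCLM.symm (x.re, x.im) = x := Complex.ext (by simp) (by simp)
  simp [L, hH, hμ, hx]

end PlaneForm

/-! ### The de Rham cohomology of a compact domain -/

theorem ArcLoop.exists_localInverse (c : ArcLoop) {s t : ℝ} (h : c.jac s t ≠ 0) :
    ∃ ψ : ℂ → ℂ, ContDiffAt ℝ ∞ ψ (c.tube s t) ∧ ψ (c.tube s t) = ⟨s, t⟩ ∧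
      ∀ᶠ z in 𝓝 (c.tube s t), c.tube (ψ z).re (ψ z).im = z := by
  set F : ℂ → ℂ := fun z => c.tube z.re z.im with hF
  have hFs : ContDiff ℝ ∞ F := c.contDiff_tube.comp
    ((Complex.reCLM.prod Complex.imCLM).contDiff)
  set z₀ : ℂ := ⟨s, t⟩
  have hdet : (c.tubeDeriv s t).det ≠ 0 := by rwa [c.det_tubeDeriv]
  have hd : HasFDerivAt F
      (((c.tubeDeriv s t).toContinuousLinearEquivOfDetNeZero hdet : ℂ ≃L[ℝ] ℂ) : ℂ →L[ℝ] ℂ) z₀ := by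
    rw [ContinuousLinearMap.coe_toContinuousLinearEquivOfDetNeZero]
    exact c.hasFDerivAt_tube z₀
  have hn : (∞ : WithTop ℕ∞) ≠ 0 := by simp
  refine ⟨hFs.contDiffAt.localInverse hd hn, hFs.contDiffAt.to_localInverse hd hn,
    hFs.contDiffAt.localInverse_apply_image hd hn, ?_⟩
  exact (hFs.contDiffAt.hasStrictFDerivAt' hd hn).eventually_right_inverse

theorem isOpen_eventually_eq {X Y : Type*} [TopologicalSpace X] (f : X → Y) :
    IsOpen {x | ∀ᶠ y in 𝓝 x, f y = f x} := by
  refine isOpen_iff_mem_nhds.2 fun x hx => ?_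
  filter_upwards [eventually_eventually_nhds.2 hx, hx] with y hy hxy
  filter_upwards [hy] with z hz
  rw [hz, hxy]

theorem eventually_eq_of_fderiv_eq_zero {f : ℂ → ℝ} (hf : Differentiable ℝ f) {z : ℂ}
    (h : ∀ᶠ y in 𝓝 z, fderiv ℝ f y = 0) : ∀ᶠ y in 𝓝 z, f y = f z := by
  obtain ⟨r, hr, hb⟩ := Metric.mem_nhds_iff.1 h
  filter_upwards [Metric.ball_mem_nhds z hr] with y hy
  have := (convex_ball z r).norm_image_sub_le_of_norm_hasFDerivWithin_le (𝕜 := ℝ) (C := 0)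
    (f' := fderiv ℝ f) (fun x _ => (hf x).hasFDerivAt.hasFDerivWithinAt)
    (fun x hx => by rw [hb hx, norm_zero]) (Metric.mem_ball_self hr) hy
  rw [zero_mul] at this
  exact sub_eq_zero.1 (norm_le_zero_iff.1 this)

namespace SmoothBoundary

variable {Ω : Set ℂ} {K : SmoothBoundary Ω} {δ₀ : ℝ}

open Classical in
/-- The function on the tubular neighbourhood with given expressions in normal coordinates. -/
noncomputable def collar (K : SmoothBoundary Ω) (δ₀ : ℝ) (a : Fin K.k → ℝ → ℝ → ℝ) (z : ℂ) : ℝ :=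
  if hz : ∃ p : Fin K.k × ℝ × ℝ, |p.2.2| < δ₀ ∧ (K.loop p.1).tube p.2.1 p.2.2 = z then
    a hz.choose.1 hz.choose.2.1 hz.choose.2.2 else 0

namespace IsTubular

theorem collar_tube (h : K.IsTubular δ₀) {a : Fin K.k → ℝ → ℝ → ℝ} {j : Fin K.k}
    (ha : ∀ s s' t, (K.loop j).γ s = (K.loop j).γ s' → a j s t = a j s' t)
    (s : ℝ) {t : ℝ} (ht : |t| < δ₀) : K.collar δ₀ a ((K.loop j).tube s t) = a j s t := by
  have hz : ∃ p : Fin K.k × ℝ × ℝ, |p.2.2| < δ₀ ∧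
      (K.loop p.1).tube p.2.1 p.2.2 = (K.loop j).tube s t := ⟨(j, s, t), ht, rfl⟩
  rw [collar, dif_pos hz]
  obtain ⟨h1, h2⟩ := hz.choose_spec
  generalize hz.choose = p at h1 h2 ⊢
  obtain ⟨i, s', t'⟩ := p
  obtain ⟨rfl, e2, rfl⟩ := h.inj i j s' s t' t h1 ht h2
  exact ha _ _ _ e2

theorem jac_ne_zero (h : K.IsTubular δ₀) (j : Fin K.k) (s : ℝ) {t : ℝ} (ht : |t| < δ₀) :
    (K.loop j).jac s t ≠ 0 := by
  have := h.jac j s t ht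
  unfold ArcLoop.jac
  linarith

theorem exists_localInverse (h : K.IsTubular δ₀) (j : Fin K.k) (s : ℝ) {t : ℝ} (ht : |t| < δ₀) :
    ∃ ψ : ℂ → ℂ, ContDiffAt ℝ ∞ ψ ((K.loop j).tube s t) ∧ ψ ((K.loop j).tube s t) = ⟨s, t⟩ ∧
      ∀ᶠ z in 𝓝 ((K.loop j).tube s t),
        (K.loop j).tube (ψ z).re (ψ z).im = z ∧ |(ψ z).im| < δ₀ := by
  obtain ⟨ψ, h1, h2, h3⟩ := (K.loop j).exists_localInverse (h.jac_ne_zero j s ht)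
  refine ⟨ψ, h1, h2, h3.and ?_⟩
  have hc : ContinuousAt (fun z => |(ψ z).im|) ((K.loop j).tube s t) :=
    (Complex.continuous_im.continuousAt.comp h1.continuousAt).abs
  exact hc.eventually (isOpen_Iio.mem_nhds (by simpa [h2] using ht))

theorem eventually_eq_tube (h : K.IsTubular δ₀) (j : Fin K.k) (s : ℝ) {t : ℝ} (ht : |t| < δ₀) :
    ∀ᶠ z in 𝓝 ((K.loop j).tube s t), ∃ s' t', |t'| < δ₀ ∧ (K.loop j).tube s' t' = z := by
  obtain ⟨ψ, -, -, h3⟩ := h.exists_localInverse j s ht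
  filter_upwards [h3] with z hz
  exact ⟨_, _, hz.2, hz.1⟩

theorem tube_mem (h : K.IsTubular δ₀) (hΩ : IsClosed Ω) (j : Fin K.k) (s : ℝ) {t : ℝ}
    (ht : 0 ≤ t) (ht' : t < δ₀) : (K.loop j).tube s t ∈ Ω := by
  rcases ht.eq_or_lt with rfl | h0
  · rw [ArcLoop.tube_zero]
    exact hΩ.frontier_subset (K.mem_frontier_iff.2 ⟨j, s, rfl⟩)
  · exact interior_subset (h.tube_mem_interior j s h0 ht')

theorem apply_tube_eq (h : K.IsTubular δ₀) (hΩ : IsClosed Ω) {f : ℂ → ℝ} (hf : ContDiff ℝ ∞ f)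
    (hd : ∀ x ∈ Ω, fderiv ℝ f x = 0) (j : Fin K.k) (s : ℝ) {t : ℝ} (ht : 0 ≤ t) (ht' : t < δ₀) :
    f ((K.loop j).tube s t) = f ((K.loop j).γ 0) := by
  have hconv : Convex ℝ {z : ℂ | z.im ∈ Ico 0 δ₀} :=
    (convex_Ico 0 δ₀).linear_preimage Complex.imLm
  have := hconv.norm_image_sub_le_of_norm_hasFDerivWithin_le (𝕜 := ℝ) (C := 0)
    (f := fun z : ℂ => f ((K.loop j).tube z.re z.im))
    (fun z hz => ((hf.differentiable (by simp) _).hasFDerivAt.comp z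
      ((K.loop j).hasFDerivAt_tube z)).hasFDerivWithinAt)
    (fun z hz => by
      rw [hd _ (h.tube_mem hΩ j _ hz.1 hz.2)]
      simp) (x := (⟨0, 0⟩ : ℂ)) (y := ⟨s, t⟩)
    (show (0 : ℝ) ∈ Ico 0 δ₀ from ⟨le_rfl, h.pos⟩) (show t ∈ Ico 0 δ₀ from ⟨ht, ht'⟩)
  rw [zero_mul] at this
  have e := sub_eq_zero.1 (norm_le_zero_iff.1 this)
  simpa only [ArcLoop.tube_zero] using e

/-- A function with vanishing derivative on a compact domain is a combination of winding numbers. -/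
theorem eq_sum_winding (h : K.IsTubular δ₀) (hΩ : IsCompact Ω) {f : ℂ → ℝ} (hf : ContDiff ℝ ∞ f)
    (hd : ∀ x ∈ Ω, fderiv ℝ f x = 0) :
    (∀ j, f ((K.loop j).γ 0) = ∑ i, K.windingMatrix j i * f ((K.loop i).γ 0)) ∧
      ∀ z ∈ interior Ω, f z = ∑ i, (K.loop i).winding z * f ((K.loop i).γ 0) := by
  classical
  have hΩc := hΩ.isClosed
  set C : Fin K.k → ℝ := fun j => f ((K.loop j).γ 0) -
    ∑ i, K.windingMatrix j i * f ((K.loop i).γ 0) with hC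
  set G : ℂ → ℝ := fun z => K.collar δ₀ (fun j _ _ => C j) z with hG
  set F : ℂ → ℝ := fun z => if z ∈ frontier Ω then G z else
    (if z ∈ Ω then f z else 0) - ∑ i, (K.loop i).winding z * f ((K.loop i).γ 0) with hF
  have hGt : ∀ j s t, |t| < δ₀ → G ((K.loop j).tube s t) = C j := fun j s t ht =>
    h.collar_tube (a := fun j _ _ => C j) (fun _ _ _ _ => rfl) s ht
  have hFt : ∀ j s t, |t| < δ₀ → F ((K.loop j).tube s t) = C j := by
    intro j s t ht
    rcases lt_trichotomy t 0 with h0 | rfl | h0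
    · rw [hF]
      simp only
      rw [if_neg (h.tube_notMem_frontier j s ht h0.ne),
        if_neg (h.tube_notMem j s h0 (abs_lt.1 ht).1)]
      simp only [h.winding_tube_neg _ j s h0 (abs_lt.1 ht).1, sub_mul, Finset.sum_sub_distrib,
        ite_mul, one_mul, zero_mul, Finset.sum_ite_eq', Finset.mem_univ, if_true, hC]
      ring
    · rw [← hGt j s 0 ht, hF]
      exact if_pos (K.mem_frontier_iff.2 ⟨j, s, ((K.loop j).tube_zero s).symm⟩)
    · rw [hF]
      simp only
      rw [if_neg (h.tube_notMem_frontier j s ht h0.ne'),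
        if_pos (h.tube_mem hΩc j s h0.le (abs_lt.1 ht).2),
        h.apply_tube_eq hΩc hf hd j s h0.le (abs_lt.1 ht).2]
      simp only [h.winding_tube _ j s h0 (abs_lt.1 ht).2, hC]
  have hw : ∀ z, z ∉ frontier Ω → ∀ᶠ y in 𝓝 z,
      ∑ i, (K.loop i).winding y * f ((K.loop i).γ 0) =
        ∑ i, (K.loop i).winding z * f ((K.loop i).γ 0) := fun z hz => by
    have : ∀ᶠ y in 𝓝 z, ∀ i, (K.loop i).winding y = (K.loop i).winding z :=
      eventually_all.2 fun i => (K.loop i).eventually_winding_eq fun ⟨s, hs⟩ =>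
        hz (K.mem_frontier_iff.2 ⟨i, s, hs⟩)
    filter_upwards [this] with y hy
    simp only [hy]
  have hloc : ∀ z, ∀ᶠ y in 𝓝 z, F y = F z := by
    intro z
    by_cases hz : z ∈ frontier Ω
    · obtain ⟨j, s, rfl⟩ := K.mem_frontier_iff.1 hz
      have h0 : |(0 : ℝ)| < δ₀ := by rw [abs_zero]; exact h.pos
      have := h.eventually_eq_tube j s h0
      have e := hFt j s 0 h0
      rw [ArcLoop.tube_zero] at this e
      filter_upwards [this]
      rintro _ ⟨s', t', ht', rfl⟩
      rw [hFt j s' t' ht', e]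
    · by_cases hzΩ : z ∈ Ω
      · have hzi : z ∈ interior Ω := by_contra fun hn => hz ⟨subset_closure hzΩ, hn⟩
        have hfd : ∀ᶠ y in 𝓝 z, fderiv ℝ f y = 0 := by
          filter_upwards [isOpen_interior.mem_nhds hzi] with y hy
          exact hd y (interior_subset hy)
        filter_upwards [isOpen_interior.mem_nhds hzi, hw z hz,
          eventually_eq_of_fderiv_eq_zero (hf.differentiable (by simp)) hfd] with y hy h1 h2
        rw [hF]
        simp only
        rw [if_neg hz, if_neg fun hy' => hy'.2 hy, if_pos hzΩ, if_pos (interior_subset hy), h1, h2]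
      · filter_upwards [hΩc.isOpen_compl.mem_nhds hzΩ, hw z hz] with y hy h1
        rw [hF]
        simp only
        rw [if_neg hz, if_neg fun hy' => hy (hΩc.frontier_subset hy'), if_neg hzΩ, if_neg hy, h1]
  have hconst : ∀ z z', F z = F z' := fun z z' =>
    isPreconnected_univ.eq_of_eventually_eq (fun x _ => (hloc x).filter_mono nhdsWithin_le_nhds)
      (mem_univ z) (mem_univ z')
  have hlim : Tendsto F (cocompact ℂ) (𝓝 0) := by
    have h1 : Tendsto (fun z => -∑ i, (K.loop i).winding z * f ((K.loop i).γ 0)) (cocompact ℂ)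
        (𝓝 (-∑ i, 0 * f ((K.loop i).γ 0))) :=
      (tendsto_finsetSum _ fun i _ => ((K.loop i).tendsto_winding).mul_const _).neg
    simp only [zero_mul, Finset.sum_const_zero, neg_zero] at h1
    refine h1.congr' ?_
    filter_upwards [hΩ.compl_mem_cocompact] with z hz
    rw [hF]
    simp only
    rw [if_neg fun hz' => hz (hΩc.frontier_subset hz'), if_neg hz, zero_sub]
  have hzero : ∀ z, F z = 0 := fun z =>
    tendsto_nhds_unique (tendsto_const_nhds.congr fun y => hconst z y) hlim
  constructor
  · intro j
    have := hzero ((K.loop j).tube 0 0)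
    rw [hFt j 0 0 (by rw [abs_zero]; exact h.pos)] at this
    exact sub_eq_zero.1 this
  · intro z hz
    have := hzero z
    rw [hF] at this
    simp only at this
    rw [if_neg fun hz' => hz'.2 hz, if_pos (interior_subset hz)] at this
    exact sub_eq_zero.1 this

theorem eq_zero_of_forall_γ_eq_zero (h : K.IsTubular δ₀) (hΩ : IsCompact Ω) {f : ℂ → ℝ}
    (hf : ContDiff ℝ ∞ f) (hd : ∀ x ∈ Ω, fderiv ℝ f x = 0)
    (h0 : ∀ i, f ((K.loop i).γ 0) = 0) : ∀ x ∈ Ω, f x = 0 := by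
  intro x hx
  by_cases hx' : x ∈ frontier Ω
  · obtain ⟨j, s, rfl⟩ := K.mem_frontier_iff.1 hx'
    have := h.apply_tube_eq hΩ.isClosed hf hd j s le_rfl h.pos
    rwa [ArcLoop.tube_zero, h0] at this
  · rw [(h.eq_sum_winding hΩ hf hd).2 x (by_contra fun hn => hx' ⟨subset_closure hx, hn⟩)]
    simp [h0]

theorem exists_contDiff_windingMatrix (h : K.IsTubular δ₀) (hΩ : IsCompact Ω) (i : Fin K.k) :
    ∃ W : ℂ → ℝ, ContDiff ℝ ∞ W ∧ (∀ x ∈ Ω, fderiv ℝ W x = 0) ∧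
      ∀ j s, W ((K.loop j).γ s) = K.windingMatrix j i := by
  classical
  have hΩc := hΩ.isClosed
  set G : ℂ → ℝ := fun z => K.collar δ₀ (fun j _ _ => K.windingMatrix j i) z with hG
  set V : ℂ → ℝ := fun z => if z ∈ interior Ω then (K.loop i).winding z else G z with hV
  have hVt : ∀ j s t, |t| < δ₀ → V ((K.loop j).tube s t) = K.windingMatrix j i := by
    intro j s t ht
    rw [hV]
    simp only
    split_ifs with hm
    · rcases lt_trichotomy t 0 with h0 | rfl | h0
      · exact absurd (interior_subset hm) (h.tube_notMem j s h0 (abs_lt.1 ht).1)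
      · exact absurd hm (K.mem_frontier_iff.2 ⟨j, s, ((K.loop j).tube_zero s).symm⟩).2
      · exact h.winding_tube i j s h0 (abs_lt.1 ht).2
    · exact h.collar_tube (a := fun j _ _ => K.windingMatrix j i) (fun _ _ _ _ => rfl) s ht
  have h0 : |(0 : ℝ)| < δ₀ := by rw [abs_zero]; exact h.pos
  have hloc : ∀ z ∈ Ω, ∀ᶠ y in 𝓝 z, V y = V z := by
    intro z hz
    by_cases hz' : z ∈ frontier Ω
    · obtain ⟨j, s, rfl⟩ := K.mem_frontier_iff.1 hz'
      have := h.eventually_eq_tube j s h0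
      have e := hVt j s 0 h0
      rw [ArcLoop.tube_zero] at this e
      filter_upwards [this]
      rintro _ ⟨s', t', ht', rfl⟩
      rw [hVt j s' t' ht', e]
    · have hzi : z ∈ interior Ω := by_contra fun hn => hz' ⟨subset_closure hz, hn⟩
      filter_upwards [isOpen_interior.mem_nhds hzi, (K.loop i).eventually_winding_eq
        fun ⟨s, hs⟩ => hz' (K.mem_frontier_iff.2 ⟨i, s, hs⟩)] with y hy hy'
      rw [hV]
      simp only
      rw [if_pos hy, if_pos hzi, hy']
  obtain ⟨W, hW, hWV⟩ := exists_contDiff_eventuallyEq hΩ (isOpen_eventually_eq V) hloc (g := V)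
    fun z hz => ((contDiffAt_const (c := V z)).congr_of_eventuallyEq hz).contDiffWithinAt
  refine ⟨W, hW, fun x hx => ?_, fun j s => ?_⟩
  · have e : W =ᶠ[𝓝 x] fun _ => V x := (hWV x hx).trans (hloc x hx)
    rw [e.fderiv_eq, fderiv_fun_const]
    rfl
  · have hm : (K.loop j).γ s ∈ Ω := hΩc.frontier_subset (K.mem_frontier_iff.2 ⟨j, s, rfl⟩)
    rw [(hWV _ hm).eq_of_nhds]
    have e := hVt j s 0 h0
    rwa [ArcLoop.tube_zero] at e

end IsTubular

end SmoothBoundary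

namespace SmoothBoundary

variable {Ω : Set ℂ} {K : SmoothBoundary Ω} {δ₀ : ℝ}

/-- The integral of a field of linear forms along a boundary curve. -/
noncomputable def period (K : SmoothBoundary Ω) (A : ℂ → ℂ →L[ℝ] ℝ) (j : Fin K.k) : ℝ :=
  ∫ s in 0..(K.loop j).l, A ((K.loop j).γ s) ((K.loop j).T s)

theorem IsTubular.green_of_isCompact (h : K.IsTubular δ₀) (hΩ : IsCompact Ω) {g : ℂ → ℝ}
    (hg : ContDiff ℝ 1 g) (v : ℂ) : ∫ z in Ω, fderiv ℝ g z v =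
      -∑ i, ∫ s in 0..(K.loop i).l, g ((K.loop i).γ s) * (K.loop i).nc v s := by
  obtain ⟨R, hR⟩ := hΩ.isBounded.subset_ball 0
  obtain ⟨χ, hχ, hχ1, hχ0, -⟩ := exists_contDiff_cutoff (A := Metric.closedBall (0 : ℂ) R)
    (B := (Metric.ball (0 : ℂ) (R + 1))ᶜ) Metric.isClosed_closedBall
    Metric.isOpen_ball.isClosed_compl (by
      rw [disjoint_compl_right_iff_subset]
      exact Metric.closedBall_subset_ball (by linarith))
  set F : ℂ → ℝ := fun z => χ z * g z with hF
  have hFs : ContDiff ℝ 1 F := (hχ.of_le (by simp)).mul hg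
  have hc : HasCompactSupport F := HasCompactSupport.intro (isCompact_closedBall (0 : ℂ) (R + 1))
    fun z hz => by
      rw [hF]
      simp only
      rw [hχ0 z fun hz' => hz (Metric.ball_subset_closedBall hz'), zero_mul]
  have h0 : Tendsto F (cocompact ℂ) (𝓝 0) := by
    refine tendsto_const_nhds.congr' ?_
    filter_upwards [hc.isCompact.compl_mem_cocompact] with z hz
    exact (image_eq_zero_of_notMem_tsupport hz).symm
  have hi : Integrable (fderiv ℝ F) :=
    (hFs.continuous_fderiv (by simp)).integrable_of_hasCompactSupport (hc.fderiv (𝕜 := ℝ))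
  have hev : ∀ z ∈ Ω, F =ᶠ[𝓝 z] g := fun z hz => by
    filter_upwards [Metric.isOpen_ball.mem_nhds (hR hz)] with y hy
    rw [hF]
    simp only
    rw [hχ1 y (Metric.ball_subset_closedBall hy), one_mul]
  have key := h.green hΩ.isClosed le_rfl h.pos hFs h0 hi v
  rw [innerDomain_zero] at key
  rw [setIntegral_congr_fun hΩ.isClosed.measurableSet fun z hz => by
    rw [← (hev z hz).fderiv_eq], key]
  congr 1
  refine Finset.sum_congr rfl fun i _ => ?_
  congr 1
  funext s
  rw [ArcLoop.tube_zero, ArcLoop.jac, zero_mul, sub_zero, one_mul,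
    (hev _ (hΩ.isClosed.frontier_subset (K.mem_frontier_iff.2 ⟨i, s, rfl⟩))).eq_of_nhds]

theorem fderiv_apply_const {A : ℂ → ℂ →L[ℝ] ℝ} (hA : Differentiable ℝ A) (x v w : ℂ) :
    fderiv ℝ (fun y => A y w) x v = fderiv ℝ A x v w := by
  rw [fderiv_clm_apply (hA x) (differentiableAt_const w)]
  simp

/-- Stokes' theorem for a closed field of linear forms and a locally constant function. -/
theorem IsTubular.sum_mul_period (h : K.IsTubular δ₀) (hΩ : IsCompact Ω) {f : ℂ → ℝ}
    (hf : ContDiff ℝ ∞ f) (hd : ∀ x ∈ Ω, fderiv ℝ f x = 0) {A : ℂ → ℂ →L[ℝ] ℝ}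
    (hA : ContDiff ℝ ∞ A) (hs : ∀ x ∈ Ω, ∀ v w, fderiv ℝ A x v w = fderiv ℝ A x w v) :
    ∑ j, f ((K.loop j).γ 0) * K.period A j = 0 := by
  have hAv : ∀ v, ContDiff ℝ ∞ fun z => A z v := fun v => hA.clm_apply contDiff_const
  have hg : ∀ v, ContDiff ℝ 1 fun z => f z * A z v := fun v => (hf.mul (hAv v)).of_le (by simp)
  have hder : ∀ x ∈ Ω, ∀ v w, fderiv ℝ (fun z => f z * A z v) x w = f x * fderiv ℝ A x w v := by
    intro x hx v w
    have := ((hf.differentiable (by simp) x).hasFDerivAt.mul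
      ((hAv v).differentiable (by simp) x).hasFDerivAt).fderiv
    refine (congrArg (fun L => L w) this).trans ?_
    simp [hd x hx, fderiv_apply_const (hA.differentiable (by simp))]
  have e1 := h.green_of_isCompact hΩ (hg Complex.I) 1
  have e2 := h.green_of_isCompact hΩ (hg 1) Complex.I
  have e3 : ∫ z in Ω, fderiv ℝ (fun z => f z * A z Complex.I) z 1 =
      ∫ z in Ω, fderiv ℝ (fun z => f z * A z 1) z Complex.I :=
    setIntegral_congr_fun hΩ.isClosed.measurableSet fun z hz => by
      rw [hder z hz, hder z hz, hs z hz]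
  rw [e1, e2, neg_inj] at e3
  rw [← sub_eq_zero, ← Finset.sum_sub_distrib] at e3
  refine neg_eq_zero.1 (Eq.trans ?_ e3)
  rw [← Finset.sum_neg_distrib]
  refine Finset.sum_congr rfl fun j _ => ?_
  have hγ := (K.loop j).continuous_γ
  have hc : ∀ v w, Continuous fun s => f ((K.loop j).γ s) * A ((K.loop j).γ s) v *
      (K.loop j).nc w s := fun v w =>
    (((hg v).continuous).comp hγ).mul ((K.loop j).continuous_nc w)
  rw [← intervalIntegral.integral_sub ((hc _ _).intervalIntegrable _ _)
    ((hc _ _).intervalIntegrable _ _), period, ← intervalIntegral.integral_const_mul,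
    ← intervalIntegral.integral_neg]
  congr 1
  funext s
  have hfs := h.apply_tube_eq hΩ.isClosed hf hd j s le_rfl h.pos
  rw [ArcLoop.tube_zero] at hfs
  have hT : A ((K.loop j).γ s) ((K.loop j).T s) = ((K.loop j).T s).re * A ((K.loop j).γ s) 1 +
      ((K.loop j).T s).im * A ((K.loop j).γ s) Complex.I := by
    conv_lhs => rw [← Complex.re_add_im ((K.loop j).T s)]
    have e1 : (((K.loop j).T s).re : ℂ) = ((K.loop j).T s).re • (1 : ℂ) := by simp
    have e2 : (((K.loop j).T s).im : ℂ) * Complex.I = ((K.loop j).T s).im • Complex.I := by simp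
    rw [e1, e2, map_add, map_smul, map_smul, smul_eq_mul, smul_eq_mul]
  rw [hfs, hT]
  simp [ArcLoop.nc]
  ring

theorem exists_period_eq_winding (hΩ : IsCompact Ω) {z : ℂ} (hz : z ∉ Ω) :
    ∃ A : ℂ → ℂ →L[ℝ] ℝ, ContDiff ℝ ∞ A ∧
      (∀ x ∈ Ω, ∀ v w, fderiv ℝ A x v w = fderiv ℝ A x w v) ∧
      ∀ j, K.period A j = 2 * Real.pi * (K.loop j).winding z := by
  set L : ℂ →L[ℝ] ℂ →L[ℝ] ℝ :=
    (ContinuousLinearMap.compL ℝ ℂ ℂ ℝ Complex.imCLM).comp (ContinuousLinearMap.mul ℝ ℂ) with hL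
  have hLv : ∀ a v, L a v = (a * v).im := fun a v => by simp [hL]
  have hsm : ContDiffOn ℝ ∞ (fun x : ℂ => L (x - z)⁻¹) {z}ᶜ := fun x hx =>
    (L.contDiff.contDiffAt.comp x ((contDiffAt_id.sub contDiffAt_const).inv
      (sub_ne_zero.2 hx))).contDiffWithinAt
  obtain ⟨A, hA, hAe⟩ := exists_contDiff_eventuallyEq hΩ isOpen_compl_singleton
    (fun x hx => fun e => hz (e ▸ hx) : Ω ⊆ {z}ᶜ) hsm
  refine ⟨A, hA, fun x hx v w => ?_, fun j => ?_⟩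
  · have hxz : x - z ≠ 0 := sub_ne_zero.2 fun e => hz (e ▸ hx)
    have h1 := ((hasDerivAt_inv hxz).comp_sub_const x z).hasFDerivAt.restrictScalars ℝ
    have h2 := (L.hasFDerivAt.comp x h1).fderiv
    rw [(hAe x hx).fderiv_eq]
    have h3 : ∀ v w, fderiv ℝ (fun x : ℂ => L (x - z)⁻¹) x v w = (v * -((x - z) ^ 2)⁻¹ * w).im := by
      intro v w
      refine (congrArg (fun M : ℂ →L[ℝ] ℂ →L[ℝ] ℝ => M v w) h2).trans ?_
      simp [hLv]
    rw [h3, h3]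
    congr 1
    ring
  · rw [period, ArcLoop.winding, ← mul_assoc, mul_one_div_cancel (by positivity), one_mul]
    congr 1
    funext s
    have hm : (K.loop j).γ s ∈ Ω := hΩ.isClosed.frontier_subset (K.mem_frontier_iff.2 ⟨j, s, rfl⟩)
    rw [(hAe _ hm).eq_of_nhds, hLv, div_eq_inv_mul]

end SmoothBoundary

namespace ArcLoop

variable (c : ArcLoop) {A : ℂ → ℂ →L[ℝ] ℝ}

/-- The primitive of a field of linear forms in normal coordinates, obtained by integration along
the loop and then along a normal. -/
noncomputable def tubePrimitive (A : ℂ → ℂ →L[ℝ] ℝ) (s t : ℝ) : ℝ :=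
  (∫ u in 0..s, A (c.γ u) (c.T u)) + ∫ τ in 0..t, A (c.tube s τ) (Complex.I * c.T s)

theorem tubePrimitive_congr (hA : Continuous A)
    (hp : ∫ u in 0..c.l, A (c.γ u) (c.T u) = 0) {s s' : ℝ} (h : c.γ s = c.γ s') (t : ℝ) :
    c.tubePrimitive A s t = c.tubePrimitive A s' t := by
  have hc : Continuous fun u => A (c.γ u) (c.T u) := (hA.comp c.continuous_γ).clm_apply c.continuous_T
  have hper : Function.Periodic (fun u => A (c.γ u) (c.T u)) c.l := fun u => by
    simp only [c.periodic u, c.periodic_T u]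
  have ha : Function.Periodic (fun s => ∫ u in 0..s, A (c.γ u) (c.T u)) c.l := fun s => by
    simp only
    rw [← intervalIntegral.integral_add_adjacent_intervals (hc.intervalIntegrable 0 s)
      (hc.intervalIntegrable s (s + c.l)), hper.intervalIntegral_add_eq s 0, zero_add, hp, add_zero]
  obtain ⟨n, rfl⟩ := c.γ_eq_iff.1 h
  unfold tubePrimitive
  have e : ∫ u in 0..s + n * c.l, A (c.γ u) (c.T u) = ∫ u in 0..s, A (c.γ u) (c.T u) :=
    (ha.int_mul n) s
  rw [e, ← c.T_eq_of_γ_eq h]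
  simp only [c.tube_eq_of_γ_eq h]

theorem contDiff_normal_apply (hA : ContDiff ℝ ∞ A) :
    ContDiff ℝ ∞ fun p : ℝ × ℝ => A (c.tube p.1 p.2) (Complex.I * c.T p.1) :=
  (hA.comp c.contDiff_tube).clm_apply (contDiff_const.mul (c.smooth_T.comp contDiff_fst))

theorem contDiff_tangent_apply (hA : ContDiff ℝ ∞ A) :
    ContDiff ℝ ∞ fun p : ℝ × ℝ => A (c.γ p.2) (c.T p.2) :=
  (hA.comp (c.smooth.comp contDiff_snd)).clm_apply (c.smooth_T.comp contDiff_snd)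

theorem contDiff_tubePrimitive (hA : ContDiff ℝ ∞ A) :
    ContDiff ℝ ∞ fun z : ℂ => c.tubePrimitive A z.re z.im :=
  ((contDiff_primitive (c.contDiff_tangent_apply hA)).comp
    ((contDiff_const (c := (0 : ℝ))).prodMk Complex.reCLM.contDiff)).add
    ((contDiff_primitive (c.contDiff_normal_apply hA)).comp
      (Complex.reCLM.contDiff.prodMk Complex.imCLM.contDiff))

theorem fderiv_normal_apply (hA : ContDiff ℝ ∞ A) (s τ : ℝ) :
    fderiv ℝ (fun p : ℝ × ℝ => A (c.tube p.1 p.2) (Complex.I * c.T p.1)) (s, τ) (1, 0) =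
      fderiv ℝ A (c.tube s τ) (c.jac s τ • c.T s) (Complex.I * c.T s) +
        A (c.tube s τ) ((-c.κ s) • c.T s) := by
  have e1 : HasDerivAt (fun s => A (c.tube s τ) (Complex.I * c.T s)) (fderiv ℝ
      (fun p : ℝ × ℝ => A (c.tube p.1 p.2) (Complex.I * c.T p.1)) (s, τ) (1, 0)) s :=
    HasFDerivAt.comp_hasDerivAt (l := fun p : ℝ × ℝ => A (c.tube p.1 p.2) (Complex.I * c.T p.1)) s
      ((c.contDiff_normal_apply hA).differentiable (by simp) (s, τ)).hasFDerivAt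
      ((hasDerivAt_id s).prodMk (hasDerivAt_const s τ))
  have e2 : HasDerivAt (fun s => A (c.tube s τ)) (fderiv ℝ A (c.tube s τ) (c.jac s τ • c.T s)) s :=
    (hA.differentiable (by simp) _).hasFDerivAt.comp_hasDerivAt s (c.hasDerivAt_tube_fst s τ)
  have e3 := e2.clm_apply ((c.hasDerivAt_T s).const_mul Complex.I)
  have e : Complex.I * (Complex.I * c.κ s * c.T s) = (-c.κ s) • c.T s := by
    rw [Complex.real_smul, Complex.ofReal_neg]
    linear_combination (c.κ s * c.T s : ℂ) * Complex.I_mul_I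
  rw [e] at e3
  exact e1.unique e3

theorem hasDerivAt_tangent_apply (hA : ContDiff ℝ ∞ A) (s τ : ℝ) :
    HasDerivAt (fun τ => A (c.tube s τ) (c.jac s τ • c.T s))
      (fderiv ℝ A (c.tube s τ) (Complex.I * c.T s) (c.jac s τ • c.T s) +
        A (c.tube s τ) ((-c.κ s) • c.T s)) τ := by
  have e : HasDerivAt (fun τ => c.jac s τ) (-c.κ s) τ := by
    have := ((hasDerivAt_id τ).mul_const (c.κ s)).const_sub 1
    simpa [jac] using this
  have e2 : HasDerivAt (fun τ => A (c.tube s τ)) (fderiv ℝ A (c.tube s τ) (Complex.I * c.T s)) τ :=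
    (hA.differentiable (by simp) _).hasFDerivAt.comp_hasDerivAt τ (c.hasDerivAt_tube_snd s τ)
  exact e2.clm_apply (e.smul_const (c.T s))

theorem integral_fderiv_normal (hA : ContDiff ℝ ∞ A) {s t : ℝ} (ht : 0 ≤ t)
    (hs : ∀ τ ∈ Icc 0 t, ∀ v w, fderiv ℝ A (c.tube s τ) v w = fderiv ℝ A (c.tube s τ) w v) :
    ∫ τ in 0..t, fderiv ℝ (fun p : ℝ × ℝ => A (c.tube p.1 p.2) (Complex.I * c.T p.1)) (s, τ) (1, 0) =
      A (c.tube s t) (c.jac s t • c.T s) - A (c.γ s) (c.T s) := by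
  have hc : Continuous fun τ => fderiv ℝ (fun p : ℝ × ℝ =>
      A (c.tube p.1 p.2) (Complex.I * c.T p.1)) (s, τ) (1, 0) :=
    (((c.contDiff_normal_apply hA).continuous_fderiv (by simp)).clm_apply continuous_const).comp
      (by fun_prop : Continuous fun τ : ℝ => (s, τ))
  rw [intervalIntegral.integral_eq_sub_of_hasDerivAt
    (f := fun τ => A (c.tube s τ) (c.jac s τ • c.T s)) (fun τ hτ => ?_) (hc.intervalIntegrable _ _),
    tube_zero, show c.jac s 0 = 1 by simp [jac], one_smul]
  rw [uIcc_of_le ht] at hτ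
  rw [c.fderiv_normal_apply hA, hs τ hτ]
  exact c.hasDerivAt_tangent_apply hA s τ

theorem hasFDerivAt_tubePrimitive (hA : ContDiff ℝ ∞ A) {z : ℂ} (ht : 0 ≤ z.im)
    (hs : ∀ τ ∈ Icc 0 z.im, ∀ v w,
      fderiv ℝ A (c.tube z.re τ) v w = fderiv ℝ A (c.tube z.re τ) w v) :
    HasFDerivAt (fun z : ℂ => c.tubePrimitive A z.re z.im)
      ((A (c.tube z.re z.im)).comp (c.tubeDeriv z.re z.im)) z := by
  have hcont : Continuous fun u => A (c.γ u) (c.T u) :=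
    (hA.continuous.comp c.continuous_γ).clm_apply c.continuous_T
  have h1 : HasFDerivAt (fun z : ℂ => ∫ u in 0..z.re, A (c.γ u) (c.T u))
      (A (c.γ z.re) (c.T z.re) • Complex.reCLM) z :=
    (intervalIntegral.integral_hasDerivAt_right (hcont.intervalIntegrable 0 z.re)
      (hcont.stronglyMeasurableAtFilter _ _) hcont.continuousAt).comp_hasFDerivAt z
      Complex.reCLM.hasFDerivAt
  have h2 := (hasFDerivAt_primitive (c.contDiff_normal_apply hA)
    ((Complex.reCLM.prod Complex.imCLM) z)).comp z (Complex.reCLM.prod Complex.imCLM).hasFDerivAt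
  refine (h1.add h2).congr_fderiv (ContinuousLinearMap.ext fun v => ?_)
  simp only [ContinuousLinearMap.prod_apply, Complex.reCLM_apply, Complex.imCLM_apply]
  rw [_root_.add_apply, ContinuousLinearMap.comp_apply, ContinuousLinearMap.comp_apply,
    _root_.add_apply, c.integral_fderiv_normal hA ht hs, tubeDeriv, _root_.add_apply, map_add,
    ContinuousLinearMap.smulRight_apply, ContinuousLinearMap.smulRight_apply, map_smul, map_smul]
  simp only [_root_.smul_apply, smul_eq_mul, ContinuousLinearMap.coe_fst',
    ContinuousLinearMap.coe_snd', ContinuousLinearMap.prod_apply, Complex.reCLM_apply,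
    Complex.imCLM_apply, map_smul]
  ring

end ArcLoop

namespace SmoothBoundary

variable {Ω : Set ℂ} {K : SmoothBoundary Ω} {δ₀ : ℝ}

/-- A closed field of linear forms is exact near the boundary if its boundary periods vanish. -/
theorem IsTubular.exists_primitive_near_frontier (h : K.IsTubular δ₀) (hΩ : IsClosed Ω)
    {A : ℂ → ℂ →L[ℝ] ℝ} (hA : ContDiff ℝ ∞ A)
    (hs : ∀ x ∈ Ω, ∀ v w, fderiv ℝ A x v w = fderiv ℝ A x w v) (hp : ∀ j, K.period A j = 0) :
    ∃ G : ℂ → ℝ, ContDiff ℝ ∞ G ∧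
      ∀ x ∈ frontier Ω, ∀ᶠ y in 𝓝 x, y ∈ Ω → fderiv ℝ G y = A y := by
  set g := K.collar δ₀ fun j => (K.loop j).tubePrimitive A with hg
  have hgt : ∀ j s t, |t| < δ₀ → g ((K.loop j).tube s t) = (K.loop j).tubePrimitive A s t :=
    fun j s t ht => h.collar_tube
      (fun s s' t e => (K.loop j).tubePrimitive_congr hA.continuous (hp j) e t) s ht
  set U : Set ℂ := {z | ∃ j s t, |t| < δ₀ ∧ (K.loop j).tube s t = z} with hU
  have hUo : IsOpen U := isOpen_iff_mem_nhds.2 fun z ⟨j, s, t, ht, e⟩ => by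
    subst e
    filter_upwards [h.eventually_eq_tube j s ht] with z hz
    exact ⟨j, hz⟩
  have hsm : ∀ z ∈ U, ContDiffAt ℝ ∞ g z := by
    rintro _ ⟨j, s, t, ht, rfl⟩
    obtain ⟨ψ, h1, -, h3⟩ := h.exists_localInverse j s ht
    refine (((K.loop j).contDiff_tubePrimitive hA).contDiffAt.comp _ h1).congr_of_eventuallyEq ?_
    filter_upwards [h3] with z hz
    conv_lhs => rw [← hz.1]
    exact hgt j _ _ hz.2
  have hder : ∀ j s t, 0 ≤ t → t < δ₀ →
      fderiv ℝ g ((K.loop j).tube s t) = A ((K.loop j).tube s t) := by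
    intro j s t ht0 ht
    have ht' : |t| < δ₀ := by rwa [abs_of_nonneg ht0]
    have e1 := (K.loop j).hasFDerivAt_tubePrimitive hA (z := ⟨s, t⟩) ht0 fun τ hτ =>
      hs _ (h.tube_mem hΩ j s hτ.1 (hτ.2.trans_lt ht))
    have e2 := ((hsm _ ⟨j, s, t, ht', rfl⟩).differentiableAt (by simp)).hasFDerivAt.comp
      (⟨s, t⟩ : ℂ) ((K.loop j).hasFDerivAt_tube ⟨s, t⟩)
    have e3 : (g ∘ fun z : ℂ => (K.loop j).tube z.re z.im) =ᶠ[𝓝 ⟨s, t⟩]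
        fun z : ℂ => (K.loop j).tubePrimitive A z.re z.im := by
      have : ∀ᶠ z : ℂ in 𝓝 ⟨s, t⟩, |z.im| < δ₀ :=
        (Complex.continuous_im.abs.isOpen_preimage _ isOpen_Iio).mem_nhds ht'
      filter_upwards [this] with z hz
      exact hgt j _ _ hz
    have e4 := e2.unique (e1.congr_of_eventuallyEq e3)
    have hdet : ((K.loop j).tubeDeriv s t).det ≠ 0 := by
      rw [ArcLoop.det_tubeDeriv]
      exact h.jac_ne_zero j s ht'
    ext v
    obtain ⟨u, rfl⟩ := (((K.loop j).tubeDeriv s t).toContinuousLinearEquivOfDetNeZero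
      hdet).surjective v
    exact congrArg (fun L => L u) e4
  have h0 : |(0 : ℝ)| < δ₀ := by rw [abs_zero]; exact h.pos
  obtain ⟨G, hG, hGe⟩ := exists_contDiff_eventuallyEq K.isCompact_frontier hUo
    (fun x hx => by
      obtain ⟨j, s, rfl⟩ := K.mem_frontier_iff.1 hx
      exact ⟨j, s, 0, h0, (K.loop j).tube_zero s⟩)
    fun z hz => (hsm z hz).contDiffWithinAt
  refine ⟨G, hG, fun x hx => ?_⟩
  have hx' := hx
  obtain ⟨j, s, rfl⟩ := K.mem_frontier_iff.1 hx'
  have := h.eventually_eq_tube j s h0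
  rw [ArcLoop.tube_zero] at this
  filter_upwards [this, eventually_eventually_nhds.2 (hGe _ hx)]
  rintro _ ⟨s', t', ht', rfl⟩ hev hm
  have hev' : G =ᶠ[𝓝 _] g := hev
  rw [hev'.fderiv_eq]
  refine hder j s' t' (not_lt.1 fun hn => ?_) (abs_lt.1 ht').2
  exact h.tube_notMem j s' hn (abs_lt.1 ht').1 hm

/-- A closed field of linear forms with vanishing boundary periods is exact. -/
theorem IsTubular.exists_primitive (h : K.IsTubular δ₀) (hΩ : IsClosed Ω)
    {A : ℂ → ℂ →L[ℝ] ℝ} (hA : ContDiff ℝ ∞ A)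
    (hs : ∀ x ∈ Ω, ∀ v w, fderiv ℝ A x v w = fderiv ℝ A x w v) (hp : ∀ j, K.period A j = 0) :
    ∃ f : ℂ → ℝ, ContDiff ℝ ∞ f ∧ ∀ x ∈ Ω, A x = fderiv ℝ f x := by
  classical
  obtain ⟨G, hG, hGA⟩ := h.exists_primitive_near_frontier hΩ hA hs hp
  have hG' : ContDiff ℝ ∞ (fderiv ℝ G) := hG.fderiv_right (by simp)
  set β : ℂ → ℂ →L[ℝ] ℝ := fun x => if x ∈ Ω then A x - fderiv ℝ G x else 0 with hβ
  have hcases : ∀ z, (β =ᶠ[𝓝 z] fun _ => 0) ∨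
      z ∈ Ω ∧ β =ᶠ[𝓝 z] fun x => A x - fderiv ℝ G x := by
    intro z
    by_cases hz : z ∈ frontier Ω
    · left
      filter_upwards [hGA z hz] with y hy
      rw [hβ]
      simp only
      split_ifs with hm
      · rw [hy hm, sub_self]
      · rfl
    · by_cases hzΩ : z ∈ Ω
      · have hzi : z ∈ interior Ω := by_contra fun hn => hz ⟨subset_closure hzΩ, hn⟩
        refine Or.inr ⟨hzΩ, ?_⟩
        filter_upwards [isOpen_interior.mem_nhds hzi] with y hy
        exact if_pos (interior_subset hy)
      · left
        filter_upwards [hΩ.isOpen_compl.mem_nhds hzΩ] with y hy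
        exact if_neg hy
  have hβs : ContDiff ℝ ∞ β := contDiff_iff_contDiffAt.2 fun z => by
    rcases hcases z with e | ⟨-, e⟩
    · exact contDiffAt_const.congr_of_eventuallyEq e
    · exact (hA.sub hG').contDiffAt.congr_of_eventuallyEq e
  have hsymm : ∀ z ∈ (univ : Set ℂ), ∀ v w, fderiv ℝ β z v w = fderiv ℝ β z w v := by
    intro z _ v w
    rcases hcases z with e | ⟨hz, e⟩
    · rw [e.fderiv_eq, fderiv_fun_const]
      rfl
    · have hsG : IsSymmSndFDerivAt ℝ G z := hG.contDiffAt.isSymmSndFDerivAt (by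
        rw [minSmoothness_of_isRCLikeNormedField]
        exact WithTop.coe_le_coe.2 (le_top : (2 : ℕ∞) ≤ ⊤))
      have := (((hA.differentiable (by simp) z).hasFDerivAt).sub
        ((hG'.differentiable (by simp) z).hasFDerivAt)).fderiv
      rw [e.fderiv_eq]
      refine (congrArg (fun L : ℂ →L[ℝ] ℂ →L[ℝ] ℝ => L v w) this).trans
        (Eq.trans ?_ (congrArg (fun L : ℂ →L[ℝ] ℂ →L[ℝ] ℝ => L w v) this).symm)
      have e1 := hs z hz v w
      have e2 := hsG v w
      simp only [_root_.sub_apply]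
      rw [e1, e2]
  obtain ⟨f, hf⟩ := convex_univ.exists_forall_hasFDerivAt_of_fderiv_symmetric isOpen_univ
    (hβs.differentiable (by simp)).differentiableOn hsymm
  have hfd : fderiv ℝ f = β := funext fun z => (hf z trivial).fderiv
  have hfs : ContDiff ℝ ∞ f := contDiff_infty_iff_fderiv.2
    ⟨fun z => (hf z trivial).differentiableAt, by rwa [hfd]⟩
  refine ⟨fun z => G z + f z, hG.add hfs, fun x hx => ?_⟩
  have := ((hG.differentiable (by simp) x).hasFDerivAt.add (hf x trivial)).fderiv
  refine (Eq.trans this ?_).symm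
  rw [hβ]
  simp only
  rw [if_pos hx, add_sub_cancel]

end SmoothBoundary

namespace SmoothBoundary

variable {Ω : Set ℂ} {K : SmoothBoundary Ω} {δ₀ : ℝ}

theorem fderiv_toFun_eq_zero (α : closedForms Ω 0) : ∀ x ∈ Ω, fderiv ℝ α.1.toFun x = 0 := by
  intro x hx
  have := α.2.2 x hx
  rwa [← PlaneForm.ofFun_toFun α.1, PlaneForm.d_ofFun, PlaneForm.ofField_eq_zero_iff] at this

theorem fderiv_toField_symm (α : closedForms Ω 1) :
    ∀ x ∈ Ω, ∀ v w, fderiv ℝ α.1.toField x v w = fderiv ℝ α.1.toField x w v := by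
  intro x hx
  have := α.2.2 x hx
  rwa [← PlaneForm.ofField_toField α.1,
    PlaneForm.d_ofField_eq_zero_iff (α.2.1.toField.differentiable (by simp) x)] at this

/-- The values of a closed `0`-form on the boundary curves. -/
noncomputable def boundaryValues (K : SmoothBoundary Ω) : closedForms Ω 0 →ₗ[ℝ] (Fin K.k → ℝ) where
  toFun α j := α.1.toFun ((K.loop j).γ 0)
  map_add' α β := funext fun j => map_add (ContinuousAlternatingMap.constOfIsEmptyLIE ℝ ℂ ℝ
    (Fin 0)).symm (α.1 ((K.loop j).γ 0)) (β.1 ((K.loop j).γ 0))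
  map_smul' c α := funext fun j => map_smul (ContinuousAlternatingMap.constOfIsEmptyLIE ℝ ℂ ℝ
    (Fin 0)).symm c (α.1 ((K.loop j).γ 0))

theorem intervalIntegrable_period {A : ℂ → ℂ →L[ℝ] ℝ} (hA : ContDiff ℝ ∞ A) (j : Fin K.k) :
    IntervalIntegrable (fun s => A ((K.loop j).γ s) ((K.loop j).T s)) volume 0 (K.loop j).l :=
  ((hA.continuous.comp (K.loop j).continuous_γ).clm_apply
    (K.loop j).continuous_T).intervalIntegrable _ _

/-- The periods of a closed `1`-form along the boundary curves. -/
noncomputable def boundaryPeriods (K : SmoothBoundary Ω) :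
    closedForms Ω 1 →ₗ[ℝ] (Fin K.k → ℝ) where
  toFun α j := K.period α.1.toField j
  map_add' α β := funext fun j => by
    rw [Pi.add_apply, period, period, period, ← intervalIntegral.integral_add
      (intervalIntegrable_period α.2.1.toField j) (intervalIntegrable_period β.2.1.toField j)]
    rfl
  map_smul' c α := funext fun j => by
    rw [RingHom.id_apply, Pi.smul_apply, period, period, ← intervalIntegral.integral_smul]
    rfl

theorem ker_boundaryValues (K : SmoothBoundary Ω) (hΩ : IsCompact Ω) :
    LinearMap.ker K.boundaryValues = (exactForms Ω 0).comap (closedForms Ω 0).subtype := by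
  obtain ⟨δ₀, h⟩ := K.exists_isTubular
  have hz : ∀ (α : PlaneForm 0) x, α x = 0 ↔ α.toFun x = 0 := fun α x =>
    (ContinuousAlternatingMap.constOfIsEmptyLIE ℝ ℂ ℝ (Fin 0)).symm.map_eq_zero_iff.symm
  ext α
  constructor
  · intro hα
    refine ⟨α.2.1, fun x hx => (hz α.1 x).2 ?_⟩
    exact h.eq_zero_of_forall_γ_eq_zero hΩ α.2.1.toFun (fderiv_toFun_eq_zero α)
      (fun i => congrFun (LinearMap.mem_ker.1 hα) i) x hx
  · rintro ⟨-, hα⟩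
    refine LinearMap.mem_ker.2 (funext fun j => (hz α.1 _).1 (hα _ ?_))
    exact hΩ.isClosed.frontier_subset (K.mem_frontier_iff.2 ⟨j, 0, rfl⟩)

theorem period_fderiv {f : ℂ → ℝ} (hf : ContDiff ℝ ∞ f) {A : ℂ → ℂ →L[ℝ] ℝ} (j : Fin K.k)
    (h : ∀ s, A ((K.loop j).γ s) = fderiv ℝ f ((K.loop j).γ s)) : K.period A j = 0 := by
  have hd : ∀ s, HasDerivAt (fun s => f ((K.loop j).γ s))
      (fderiv ℝ f ((K.loop j).γ s) ((K.loop j).T s)) s := fun s =>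
    (hf.differentiable (by simp) _).hasFDerivAt.comp_hasDerivAt s ((K.loop j).hasDerivAt_γ s)
  simp only [period, h]
  rw [intervalIntegral.integral_eq_sub_of_hasDerivAt (fun s _ => hd s)
    (intervalIntegrable_period (hf.fderiv_right (by simp)) j)]
  have := (K.loop j).periodic 0
  rw [zero_add] at this
  rw [this, sub_self]

theorem ker_boundaryPeriods (K : SmoothBoundary Ω) (hΩ : IsCompact Ω) :
    LinearMap.ker K.boundaryPeriods = (exactForms Ω 1).comap (closedForms Ω 1).subtype := by
  obtain ⟨δ₀, h⟩ := K.exists_isTubular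
  ext α
  constructor
  · intro hα
    obtain ⟨f, hf, hfα⟩ := h.exists_primitive hΩ.isClosed α.2.1.toField (fderiv_toField_symm α)
      fun j => congrFun (LinearMap.mem_ker.1 hα) j
    refine ⟨α.2.1, PlaneForm.ofFun f, PlaneForm.smooth_ofFun hf, fun x hx => ?_⟩
    rw [PlaneForm.d_ofFun, ← PlaneForm.ofField_congr (hfα x hx), PlaneForm.ofField_toField]
    rfl
  · rintro ⟨-, β, hβ, hα⟩
    refine LinearMap.mem_ker.2 (funext fun j => period_fderiv hβ.toFun j fun s => ?_)
    have := hα _ (hΩ.isClosed.frontier_subset (K.mem_frontier_iff.2 ⟨j, s, rfl⟩))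
    rw [← PlaneForm.ofFun_toFun β, PlaneForm.d_ofFun] at this
    exact (congrArg PlaneForm.linearFormEquiv.symm this).trans
      (PlaneForm.linearFormEquiv.symm_apply_apply _)

theorem isProj_boundaryValues (K : SmoothBoundary Ω) (hΩ : IsCompact Ω) :
    LinearMap.IsProj (LinearMap.range K.boundaryValues) (Matrix.toLin' K.windingMatrix) := by
  obtain ⟨δ₀, h⟩ := K.exists_isTubular
  constructor
  · intro x
    rw [Matrix.toLin'_apply, Matrix.mulVec_eq_sum]
    refine Submodule.sum_mem _ fun i _ => ?_
    rw [op_smul_eq_smul]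
    obtain ⟨W, hW, hd, hWγ⟩ := h.exists_contDiff_windingMatrix hΩ i
    have hm : PlaneForm.ofFun W ∈ closedForms Ω 0 := ⟨PlaneForm.smooth_ofFun hW, fun y hy => by
      rw [PlaneForm.d_ofFun, PlaneForm.ofField_eq_zero_iff, hd y hy]⟩
    refine Submodule.smul_mem _ _ (LinearMap.mem_range.2 ⟨⟨_, hm⟩, funext fun j => ?_⟩)
    change (PlaneForm.ofFun W).toFun _ = _
    rw [PlaneForm.toFun_ofFun, hWγ]
    rfl
  · rintro _ ⟨α, rfl⟩
    rw [Matrix.toLin'_apply]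
    funext j
    exact ((h.eq_sum_winding hΩ α.2.1.toFun (fderiv_toFun_eq_zero α)).1 j).symm

theorem isProj_boundaryPeriods (K : SmoothBoundary Ω) (hΩ : IsCompact Ω) :
    LinearMap.IsProj (LinearMap.range K.boundaryPeriods)
      (Matrix.toLin' (1 - K.windingMatrix.transpose)) := by
  obtain ⟨δ₀, h⟩ := K.exists_isTubular
  have hp := h.pos
  constructor
  · intro x
    rw [Matrix.toLin'_apply, Matrix.mulVec_eq_sum]
    refine Submodule.sum_mem _ fun i _ => ?_
    rw [op_smul_eq_smul]
    obtain ⟨A, hA, hs, hper⟩ := K.exists_period_eq_winding hΩ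
      (h.tube_notMem i 0 (t := -(δ₀ / 2)) (by linarith) (by linarith))
    have hm : PlaneForm.ofField A ∈ closedForms Ω 1 := ⟨PlaneForm.smooth_ofField hA, fun y hy =>
      (PlaneForm.d_ofField_eq_zero_iff (hA.differentiable (by simp) y)).2 (hs y hy)⟩
    have he : (1 - K.windingMatrix.transpose).transpose i =
        (-(1 / (2 * Real.pi))) • K.boundaryPeriods ⟨_, hm⟩ := by
      funext j
      change _ = -(1 / (2 * Real.pi)) * K.period (PlaneForm.ofField A).toField j
      rw [PlaneForm.toField_ofField, hper, h.winding_tube_neg j i 0 (by linarith) (by linarith)]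
      simp only [Matrix.transpose_apply, Matrix.sub_apply, Matrix.one_apply]
      have := Real.pi_pos
      field_simp
      ring
    refine Submodule.smul_mem _ _ ?_
    rw [he]
    exact Submodule.smul_mem _ _ (LinearMap.mem_range_self _ _)
  · rintro _ ⟨α, rfl⟩
    rw [Matrix.toLin'_apply, Matrix.sub_mulVec, Matrix.one_mulVec, sub_eq_self]
    funext i
    obtain ⟨W, hW, hd, hWγ⟩ := h.exists_contDiff_windingMatrix hΩ i
    have := h.sum_mul_period hΩ hW hd α.2.1.toField (fderiv_toField_symm α)
    simp only [hWγ] at this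
    exact this

theorem finrank_deRhamCohomology_zero (K : SmoothBoundary Ω) (hΩ : IsCompact Ω) :
    FiniteDimensional ℝ (DeRhamCohomology Ω 0) ∧
      (Module.finrank ℝ (DeRhamCohomology Ω 0) : ℝ) = K.windingMatrix.trace := by
  have e := (Submodule.quotEquivOfEq _ _ (K.ker_boundaryValues hΩ).symm).trans
    K.boundaryValues.quotKerEquivRange
  refine ⟨Module.Finite.equiv e.symm, ?_⟩
  rw [e.finrank_eq, ← (K.isProj_boundaryValues hΩ).trace, Matrix.trace_toLin'_eq]

theorem finrank_deRhamCohomology_one (K : SmoothBoundary Ω) (hΩ : IsCompact Ω) :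
    FiniteDimensional ℝ (DeRhamCohomology Ω 1) ∧
      (Module.finrank ℝ (DeRhamCohomology Ω 1) : ℝ) = K.k - K.windingMatrix.trace := by
  have e := (Submodule.quotEquivOfEq _ _ (K.ker_boundaryPeriods hΩ).symm).trans
    K.boundaryPeriods.quotKerEquivRange
  refine ⟨Module.Finite.equiv e.symm, ?_⟩
  rw [e.finrank_eq, ← (K.isProj_boundaryPeriods hΩ).trace, Matrix.trace_toLin'_eq,
    Matrix.trace_sub, Matrix.trace_one, Matrix.trace_transpose, Fintype.card_fin]

theorem subsingleton_deRhamCohomology (Ω : Set ℂ) {n : ℕ} (hn : 2 ≤ n) :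
    Subsingleton (DeRhamCohomology Ω n) := by
  rw [Submodule.Quotient.subsingleton_iff, Submodule.eq_top_iff']
  intro α
  match n, hn with
  | 2, _ =>
    obtain ⟨β, hβ, hα⟩ := PlaneForm.exists_d_eq α.2.1
    exact ⟨α.2.1, β, hβ, fun x _ => hα x⟩
  | n + 3, _ =>
    exact ⟨α.2.1, 0, PlaneForm.smooth_zero _, fun x _ =>
      (PlaneForm.eq_zero_of_three_le (by omega) _).trans
        (PlaneForm.eq_zero_of_three_le (by omega) _).symm⟩

theorem finiteDimensional_deRhamCohomology (K : SmoothBoundary Ω) (hΩ : IsCompact Ω) :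
    ∀ n, FiniteDimensional ℝ (DeRhamCohomology Ω n)
  | 0 => (K.finrank_deRhamCohomology_zero hΩ).1
  | 1 => (K.finrank_deRhamCohomology_one hΩ).1
  | n + 2 => by
    have := subsingleton_deRhamCohomology Ω (n := n + 2) (by omega)
    infer_instance

/-- The Gauss–Bonnet formula. -/
theorem totalCurvature_eq_eulerCharacteristic (K : SmoothBoundary Ω) (hΩ : IsCompact Ω) :
    K.totalCurvature = 2 * Real.pi * (eulerCharacteristic Ω : ℝ) := by
  have h2 := subsingleton_deRhamCohomology Ω (n := 2) le_rfl
  rw [K.totalCurvature_eq, eulerCharacteristic, Finset.sum_range_succ, Finset.sum_range_succ,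
    Finset.sum_range_one, Module.finrank_zero_of_subsingleton (M := DeRhamCohomology Ω 2)]
  push_cast
  rw [(K.finrank_deRhamCohomology_zero hΩ).2, (K.finrank_deRhamCohomology_one hΩ).2]
  ring

end SmoothBoundary

theorem mainTheorem2 (Ω : Set ℂ) (hΩ : IsClosed Ω) (K : SmoothBoundary Ω) :
    -- the potential and the energy are well defined: the limits exist, and the integrals converge
    (∀ w ∈ interior Ω,
      Tendsto (truncatedPotential Ω w) (𝓝[>] 0) (𝓝 (renormalizedPotential Ω w))) ∧
    (∀ δ > 0, IntegrableOn (renormalizedPotential Ω) (innerDomain Ω δ)) ∧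
    Tendsto K.truncatedEnergy (𝓝[>] 0) (𝓝 K.energy) ∧
    -- the renormalized formula
    (∃ l : ℝ,
      Tendsto (fun ε : ℝ => K.length / ε - 1 / 2 * K.cosIntegral ε) (𝓝[>] 0) (𝓝 l) ∧
      K.energy = l + Real.pi / 8 * K.totalCurvature) ∧
    -- the formula without a limit
    (∀ i j, IntegrableOn (K.sinDensity i j) (K.pairs i j)) ∧
    K.energy = -(1 / 2) * K.sinIntegral + Real.pi / 8 * K.totalCurvature ∧
    -- the curvature term of a compact domain
    (IsCompact Ω →
      (∀ n, FiniteDimensional ℝ (DeRhamCohomology Ω n)) ∧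
      Real.pi / 8 * K.totalCurvature = Real.pi ^ 2 * (eulerCharacteristic Ω : ℝ) / 4) := by
  obtain ⟨δ₀, h⟩ := K.exists_isTubular
  have hE := K.tendsto_truncatedEnergy hΩ
  have hE' : K.energy = _ := hE.limUnder_eq
  refine ⟨fun w hw => (renormalizedPotential_eq hΩ hw).2.1,
    fun δ hδ => (h.integrableOn_renormalizedPotential hΩ hδ).1, hE'.symm ▸ hE,
    ⟨_, K.tendsto_cosIntegral, hE'⟩, K.integrableOn_sinDensity, hE', fun hc =>
      ⟨K.finiteDimensional_deRhamCohomology hc, ?_⟩⟩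
  rw [K.totalCurvature_eq_eulerCharacteristic hc]
  ring
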